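/- Notation. Let $\Gamma=\mathrm{SL}_2(\mathbb Z)$ act on the upper half plane $\mathbb H$ and put $Y=\Gamma\backslash\mathbb H$. For $n\ge 0$ let $\mathcal M_n=\mathbb Z[X_1,X_2]_n$ be the $\Gamma$-module of binary forms of degree $n$, with action $(\gamma P)(X_1,X_2)=P(dX_1-bX_2,-cX_1+aX_2)$ for $\gamma=\begin{pmatrix}a&b\\c&d\end{pmatrix}$. Let $\mathcal M_n^\flat\subset\mathcal M_n$ be the submodule spanned by $e_\nu^\flat=(-1)^{n-\nu}\binom n\nu X_1^{n-\nu}X_2^{\nu}$ $(0\le\nu\le n)$; it is dual to $\mathcal M_n$ through the $\Gamma$-invariant pairing with $\langle e_\nu^\flat,X_1^\mu X_2^{n-\mu}\rangle=\delta_{\nu\mu}$. Let $S_\bullet(\mathbb H)$ be the singular chain complex of $\mathbb H$ and $\mathcal{MS}(\mathbb H)=\mathrm{coker}(\partial:S_2(\mathbb H)\to S_1(\mathbb H))$; write $\{\alpha,\beta\}\in\mathcal{MS}(\mathbb H)$ for the class of a path from $\alpha$ to $\beta$. Then $$H_1(Y,\mathcal M_n)=\ker\big((\mathcal{MS}(\mathbb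 H)\otimes\mathcal M_n)_\Gamma\to(S_0(\mathbb H)\otimes\mathcal M_n)_\Gamma\big),$$ $$H^1(Y,\mathcal M_n^\flat)\otimes\mathbb C=\mathrm{coker}\big(\mathrm{Hom}(S_0(\mathbb H),\mathcal M_n^\flat\otimes\mathbb C)^\Gamma\to\mathrm{Hom}(\mathcal{MS}(\mathbb H),\mathcal M_n^\flat\otimes\mathbb C)^\Gamma\big),$$ and $\langle\ ,\ \rangle:(H^1(Y,\mathcal M_n^\flat)\otimes\mathbb C)\times H_1(Y,\mathcal M_n)\to\mathbb C$ is the induced pairing. For even $n\ge 2$ let $E_{n+2}$ be the Eisenstein series of weight $n+2$ for $\Gamma$ with constant term $1$, and let $\mathrm{Eis}_n\in H^1(Y,\mathcal M_n^\flat)\otimes\mathbb C$ be the class of the cocycle $\{\alpha,\beta\}\mapsto\int_\alpha^\beta E_{n+2}(z)(X_1-zX_2)^n\,dz$. Let $F\subset\mathbb R$ be a real quadratic field, $\alpha\mapsto\alpha'$ its nontrivial automorphism, and $\mathcal O$ an order of $F$. Let $Cl_{\mathcal O}^+$ be the group of proper (that is, invertible) fractional $\mathcal O$-ideals modulo principal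 ideals generated by totally positive elements. Let $\varepsilon_0>1$ be the generator of the group of totally positive units of $\mathcal O$. For $\mathcal A\in Cl_{\mathcal O}^+$ and $k\ge 2$, choose a representative $\mathfrak a$ of $\mathcal A$, of norm $N\mathfrak a=[\mathcal O:\mathfrak a]$, a $\mathbb Z$-basis $\alpha_1,\alpha_2$ of $\mathfrak a$ with $\alpha_1\alpha_2'-\alpha_1'\alpha_2>0$, the matrix $\gamma_0\in\Gamma$ with $\gamma_0\begin{pmatrix}\alpha_1\\\alpha_2\end{pmatrix}=\begin{pmatrix}\varepsilon_0\alpha_1\\\varepsilon_0\alpha_2\end{pmatrix}$, and $\tau\in\mathbb H$. Put $$N_{\alpha_1,\alpha_2}(X_1,X_2)=-\frac1{N\mathfrak a}(\alpha_2X_1-\alpha_1X_2)(\alpha_2'X_1-\alpha_1'X_2)\in\mathcal M_2,$$ which is fixed by $\gamma_0$, and $$\mathfrak z_{\mathcal O,k}(\mathcal A)=[\{\tau,\gamma_0\tau\}\otimes N_{\alpha_1,\alpha_2}^{k-1}]\in H_1(Y,\mathcal M_{2k-2}).$$ Let $\zeta_{\mathcal O}(\mathcal A,s)=\sum_{\mathfrak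 a\subset\mathcal O,\ \mathfrak a\in\mathcal A}(N\mathfrak a)^{-s}$ $(\mathrm{Re}(s)>1)$. Proposition. Let $F$ be a real quadratic field, $\mathcal O$ an order of $F$, $k\ge 2$ an integer and $\mathcal A\in Cl_{\mathcal O}^+$. The function $\zeta_{\mathcal O}(\mathcal A^{-1},s)$ continues meromorphically to $\mathbb C$, holomorphically outside $s=1$, and, for every choice of $\mathfrak a,\alpha_1,\alpha_2,\tau$ as above, $$\langle\mathrm{Eis}_{2k-2},\mathfrak z_{\mathcal O,k}(\mathcal A)\rangle=(-1)^k\,\frac{\zeta_{\mathcal O}(\mathcal A^{-1},1-k)}{\zeta(1-2k)},$$ where $\zeta$ is the Riemann zeta function. -/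

import Mathlib

open scoped MatrixGroups UpperHalfPlane TensorProduct nonZeroDivisors

noncomputable section

namespace HeckeCycle

/-! ## Singular chains of the upper half plane with their action of `SL(2, ℤ)` -/

/-- Singular `q`-simplices of `ℍ`. -/
abbrev Simplex (q : ℕ) : Type := C(stdSimplex ℝ (Fin (q + 1)), ℍ)

/-- `S_q(ℍ)`: the free abelian group on the singular `q`-simplices of `ℍ`. -/
abbrev Chain (q : ℕ) : Type := Simplex q →₀ ℤ

lemma continuous_smul_SL (γ : SL(2, ℤ)) : Continuous (fun z : ℍ => γ • z) :=
  continuous_const_smul (Matrix.SpecialLinearGroup.mapGL ℝ γ)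

/-- The translate `γσ` of a singular simplex. -/
def Simplex.act {q : ℕ} (γ : SL(2, ℤ)) (σ : Simplex q) : Simplex q :=
  ⟨fun x => γ • σ x, (continuous_smul_SL γ).comp σ.continuous⟩

/-- The `i`-th face `σ ∘ δ_i`, where `δ_i` omits the `i`-th vertex. -/
def Simplex.face {q : ℕ} (i : Fin (q + 2)) (σ : Simplex (q + 1)) : Simplex q :=
  ⟨fun x => σ (stdSimplex.map (Fin.succAbove i) x),
    σ.continuous.comp (stdSimplex.continuous_map _)⟩

/-- The boundary operator `∂ : S_{q+1}(ℍ) → S_q(ℍ)`. -/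
def boundary (q : ℕ) : Chain (q + 1) →ₗ[ℤ] Chain q :=
  Finsupp.lsum ℤ fun σ =>
    LinearMap.toSpanSingleton ℤ (Chain q)
      (∑ i : Fin (q + 2), (-1 : ℤ) ^ (i : ℕ) • Finsupp.single (σ.face i) 1)

lemma boundary_single (q : ℕ) (σ : Simplex (q + 1)) :
    boundary q (Finsupp.single σ 1) =
      ∑ i : Fin (q + 2), (-1 : ℤ) ^ (i : ℕ) • Finsupp.single (σ.face i) 1 := by
  simp [boundary]

/-- The action of `SL(2, ℤ)` on `S_q(ℍ)`. -/
def chainRep (q : ℕ) : Representation ℤ SL(2, ℤ) (Chain q) where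
  toFun γ := Finsupp.lmapDomain ℤ ℤ (Simplex.act γ)
  map_one' := by
    refine Finsupp.lhom_ext' fun σ => LinearMap.ext_ring ?_
    have : Simplex.act 1 σ = σ := by ext x; simp [Simplex.act]
    simp [this]
  map_mul' γ δ := by
    refine Finsupp.lhom_ext' fun σ => LinearMap.ext_ring ?_
    have : Simplex.act (γ * δ) σ = Simplex.act γ (Simplex.act δ σ) := by
      ext x; simp [Simplex.act, mul_smul]
    simp [this]

lemma chainRep_single {q : ℕ} (γ : SL(2, ℤ)) (σ : Simplex q) :
    chainRep q γ (Finsupp.single σ 1) = Finsupp.single (σ.act γ) 1 := by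
  simp [chainRep]

lemma boundary_chainRep (q : ℕ) (γ : SL(2, ℤ)) (c : Chain (q + 1)) :
    boundary q (chainRep (q + 1) γ c) = chainRep q γ (boundary q c) := by
  suffices h : boundary q ∘ₗ chainRep (q + 1) γ = chainRep q γ ∘ₗ boundary q from
    LinearMap.congr_fun h c
  refine Finsupp.lhom_ext' fun σ => LinearMap.ext_ring ?_
  simp only [LinearMap.comp_apply, Finsupp.lsingle_apply, chainRep_single, boundary_single,
    map_sum, map_smul]
  rfl

/-- `MS(ℍ) = coker (∂ : S_2(ℍ) → S_1(ℍ))`. -/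
abbrev MS : Type := Chain 1 ⧸ LinearMap.range (boundary 1)

/-- The action of `SL(2, ℤ)` on `MS(ℍ)`. -/
def msRep : Representation ℤ SL(2, ℤ) MS :=
  (chainRep 1).quotient (LinearMap.range (boundary 1)) fun γ => by
    rintro _ ⟨c, rfl⟩
    exact ⟨chainRep 2 γ c, boundary_chainRep 1 γ c⟩

lemma boundary_boundary (c : Chain 2) : boundary 0 (boundary 1 c) = 0 := by
  suffices h : boundary 0 ∘ₗ boundary 1 = 0 from LinearMap.congr_fun h c
  refine Finsupp.lhom_ext' fun σ => LinearMap.ext_ring ?_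
  have key : ∀ (i j : Fin 3) (a b : Fin 2),
      (i.succAbove ∘ a.succAbove : Fin 1 → Fin 3) = j.succAbove ∘ b.succAbove →
      Simplex.face a (Simplex.face i σ) = Simplex.face b (Simplex.face j σ) := by
    intro i j a b h
    ext x
    simp only [Simplex.face, ContinuousMap.coe_mk, stdSimplex.map_comp_apply]
    rw [h]
  have h1 := key 0 1 0 0 (by decide)
  have h2 := key 0 2 1 0 (by decide)
  have h3 := key 1 2 1 1 (by decide)
  have hb : ∀ τ : Simplex 1, boundary 0 (Finsupp.single τ 1) =
      Finsupp.single (τ.face 0) 1 - Finsupp.single (τ.face 1) 1 := fun τ => by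
    rw [boundary_single, Fin.sum_univ_two]
    simp [sub_eq_add_neg]
  rw [LinearMap.comp_apply, Finsupp.lsingle_apply, LinearMap.comp_apply, boundary_single, Fin.sum_univ_three,
    map_add, map_add, map_smul, map_smul, map_smul, hb, hb, hb, h1, h2, h3]
  simp

/-- The map `∂ : MS(ℍ) → S_0(ℍ)` induced by the boundary operator. -/
def msBoundary : MS →ₗ[ℤ] Chain 0 :=
  (LinearMap.range (boundary 1)).liftQ (boundary 0) (by
    rintro _ ⟨c, rfl⟩
    exact boundary_boundary c)

/-- `∂ : MS(ℍ) → S_0(ℍ)` as a map of `SL(2, ℤ)`-modules. -/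
def msBoundaryMap : Representation.IntertwiningMap msRep (chainRep 0) where
  __ := msBoundary
  isIntertwining' γ := by
    refine Submodule.linearMap_qext _ (LinearMap.ext fun c => ?_)
    exact boundary_chainRep 0 γ c

/-- The straight path from `α` to `β`, as a singular `1`-simplex. -/
def segmentSimplex (α β : ℍ) : Simplex 1 where
  toFun x := ⟨(x 0 : ℂ) * α + (x 1 : ℂ) * β, by
    have h0 := x.2.1 0
    have h1 := x.2.1 1
    have hs : x.1 0 + x.1 1 = 1 := by simpa [Fin.sum_univ_two] using x.2.2
    have ha := α.im_pos
    have hb := β.im_pos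
    change 0 < ((x.1 0 : ℂ) * α + (x.1 1 : ℂ) * β).im
    simp only [Complex.add_im, Complex.mul_im, Complex.ofReal_re, Complex.ofReal_im, zero_mul,
      add_zero, UpperHalfPlane.coe_im]
    rcases h0.eq_or_lt with h | h
    · have : x.1 1 = 1 := by linarith
      rw [this, ← h]; simpa using hb
    · have := mul_pos h ha
      have := mul_nonneg h1 hb.le
      linarith⟩
  continuous_toFun := by
    rw [UpperHalfPlane.isEmbedding_coe.continuous_iff]
    have h : ∀ i, Continuous fun x : stdSimplex ℝ (Fin 2) => ((x i : ℝ) : ℂ) := fun i =>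
      Complex.continuous_ofReal.comp ((continuous_apply i).comp continuous_subtype_val)
    exact ((h 0).mul continuous_const).add ((h 1).mul continuous_const)

/-- `{α, β} ∈ MS(ℍ)`: the class of a path from `α` to `β`. -/
def path (α β : ℍ) : MS := Submodule.Quotient.mk (Finsupp.single (segmentSimplex α β) 1)

/-- The point `z`, as a singular `0`-simplex. -/
def point (z : ℍ) : Simplex 0 := ContinuousMap.const _ z

lemma simplex_zero_eq (σ : Simplex 0) : σ = point (σ (stdSimplex.vertex 0)) := by
  ext x
  have : x = stdSimplex.vertex 0 := Subsingleton.elim _ _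
  simp [point, this]

lemma msBoundary_path (α β : ℍ) :
    msBoundary (path α β) = Finsupp.single (point β) 1 - Finsupp.single (point α) 1 := by
  have h0 : Simplex.face 0 (segmentSimplex α β) = point β := by
    rw [simplex_zero_eq (Simplex.face 0 (segmentSimplex α β))]
    congr 1
    simp only [Simplex.face, ContinuousMap.coe_mk, stdSimplex.map_vertex]
    ext
    simp [segmentSimplex]
  have h1 : Simplex.face 1 (segmentSimplex α β) = point α := by
    rw [simplex_zero_eq (Simplex.face 1 (segmentSimplex α β))]
    congr 1
    simp only [Simplex.face, ContinuousMap.coe_mk, stdSimplex.map_vertex]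
    ext
    simp [segmentSimplex]
  change boundary 0 (Finsupp.single (segmentSimplex α β) 1) = _
  rw [boundary_single, Fin.sum_univ_two, h0, h1]
  simp [sub_eq_add_neg]

/-! ## Homology and cohomology of `Y = SL(2, ℤ) \ ℍ` with coefficients -/

section Coefficients

variable {V W : Type} [AddCommGroup V] [AddCommGroup W]

/-- The map `(MS(ℍ) ⊗ M)_Γ → (S_0(ℍ) ⊗ M)_Γ` induced by `∂`. -/
def coinvariantsBoundary (ρ : Representation ℤ SL(2, ℤ) V) :
    (msRep.tprod ρ).Coinvariants →ₗ[ℤ] ((chainRep 0).tprod ρ).Coinvariants :=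
  Representation.Coinvariants.map _ _ (msBoundaryMap.rTensor ρ)

/-- `H_1(Y, M) = ker ((MS(ℍ) ⊗ M)_Γ → (S_0(ℍ) ⊗ M)_Γ)`. -/
abbrev H1 (ρ : Representation ℤ SL(2, ℤ) V) : Submodule ℤ (msRep.tprod ρ).Coinvariants :=
  LinearMap.ker (coinvariantsBoundary ρ)

/-- The homology class of `{τ, γτ} ⊗ P`, for `P` with `γP = P`. -/
def hyperbolicClass (ρ : Representation ℤ SL(2, ℤ) V) (γ : SL(2, ℤ)) (P : V) (hP : ρ γ P = P)
    (τ : ℍ) : H1 ρ :=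
  ⟨Representation.Coinvariants.mk _ (path τ (γ • τ) ⊗ₜ[ℤ] P), by
    rw [LinearMap.mem_ker]
    change Representation.Coinvariants.mk _ (msBoundary (path τ (γ • τ)) ⊗ₜ[ℤ] P) = 0
    rw [msBoundary_path, TensorProduct.sub_tmul, map_sub, sub_eq_zero]
    have h := Representation.Coinvariants.mk_self_apply ((chainRep 0).tprod ρ) γ
      ((Finsupp.single (point τ) 1 : Chain 0) ⊗ₜ[ℤ] P)
    rw [Representation.tprod_apply, TensorProduct.map_tmul, chainRep_single, hP] at h
    exact h⟩

/-- The coboundary `Hom(S_0(ℍ), M)^Γ → Hom(MS(ℍ), M)^Γ`. -/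
def coboundary (ρ : Representation ℤ SL(2, ℤ) V) :
    ((chainRep 0).linHom ρ).invariants →ₗ[ℤ] (msRep.linHom ρ).invariants where
  toFun ψ := ⟨ψ.1 ∘ₗ msBoundary, fun γ => by
    have h := ψ.2 γ
    refine LinearMap.ext fun c => ?_
    have h' := LinearMap.congr_fun h (msBoundary c)
    have e : chainRep 0 γ⁻¹ (msBoundary c) = msBoundary (msRep γ⁻¹ c) :=
      (LinearMap.congr_fun (msBoundaryMap.isIntertwining' γ⁻¹) c).symm
    simpa [Representation.linHom_apply, e] using h'⟩
  map_add' _ _ := rfl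
  map_smul' _ _ := rfl

/-- `H^1(Y, M) = coker (Hom(S_0(ℍ), M)^Γ → Hom(MS(ℍ), M)^Γ)`. -/
abbrev Coh1 (ρ : Representation ℤ SL(2, ℤ) V) : Type :=
  (msRep.linHom ρ).invariants ⧸ LinearMap.range (coboundary ρ)

/-- For a `Γ`-module `S` and a `Γ`-equivariant pairing `B : V × W → ℂ`, the pairing
`Hom(S, V)^Γ × (S ⊗ W)_Γ → ℂ`, `(φ, s ⊗ w) ↦ B (φ s) w`. -/
def chainPairing {S : Type} [AddCommGroup S] (θ : Representation ℤ SL(2, ℤ) S)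
    (ρ : Representation ℤ SL(2, ℤ) V) (ρ' : Representation ℤ SL(2, ℤ) W)
    (B : V →ₗ[ℤ] W →ₗ[ℤ] ℂ) (hB : ∀ γ v w, B (ρ γ v) (ρ' γ w) = B v w) :
    (θ.linHom ρ).invariants →ₗ[ℤ] (θ.tprod ρ').Coinvariants →ₗ[ℤ] ℂ where
  toFun φ := Representation.Coinvariants.lift _ (TensorProduct.lift (B ∘ₗ φ.1)) fun γ => by
    refine TensorProduct.ext' fun s w => ?_
    have h := LinearMap.congr_fun (φ.2 γ) (θ γ s)
    have h' : ρ γ (φ.1 s) = φ.1 (θ γ s) := by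
      simpa [Representation.linHom_apply, ← Module.End.mul_apply, ← map_mul] using h
    simp [← h', hB]
  map_add' φ ψ := by
    refine Representation.Coinvariants.hom_ext (TensorProduct.ext' fun s w => ?_)
    change B ((φ.1 + ψ.1) s) w = B (φ.1 s) w + B (ψ.1 s) w
    simp
  map_smul' n φ := by
    refine Representation.Coinvariants.hom_ext (TensorProduct.ext' fun s w => ?_)
    change B ((n • φ.1) s) w = n • B (φ.1 s) w
    simp

/-- The pairing `H^1(Y, V) × H_1(Y, W) → ℂ` induced by a `Γ`-equivariant pairing
`B : V × W → ℂ`. -/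
def cohPairing (ρ : Representation ℤ SL(2, ℤ) V) (ρ' : Representation ℤ SL(2, ℤ) W)
    (B : V →ₗ[ℤ] W →ₗ[ℤ] ℂ) (hB : ∀ γ v w, B (ρ γ v) (ρ' γ w) = B v w) :
    Coh1 ρ →ₗ[ℤ] H1 ρ' →ₗ[ℤ] ℂ :=
  (LinearMap.range (coboundary ρ)).liftQ
    ((LinearMap.lcomp ℤ ℂ (H1 ρ').subtype) ∘ₗ chainPairing msRep ρ ρ' B hB) (by
      rintro _ ⟨ψ, rfl⟩
      refine LinearMap.ext fun c => ?_
      have h : chainPairing msRep ρ ρ' B hB (coboundary ρ ψ) =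
          chainPairing (chainRep 0) ρ ρ' B hB ψ ∘ₗ coinvariantsBoundary ρ' := by
        refine Representation.Coinvariants.hom_ext (TensorProduct.ext' fun s w => ?_)
        rfl
      change chainPairing msRep ρ ρ' B hB (coboundary ρ ψ) c.1 = 0
      rw [h, LinearMap.comp_apply, LinearMap.mem_ker.mp c.2, map_zero])

end Coefficients

/-! ## Binary forms -/

open MvPolynomial in
/-- The pair `(dX₁ - bX₂, -cX₁ + aX₂)` for `γ = (a, b; c, d)`. -/
def substPair (R : Type) [CommRing R] (γ : SL(2, ℤ)) : Fin 2 → MvPolynomial (Fin 2) R :=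
  ![C ((γ 1 1 : ℤ) : R) * X 0 - C ((γ 0 1 : ℤ) : R) * X 1,
    -(C ((γ 1 0 : ℤ) : R) * X 0) + C ((γ 0 0 : ℤ) : R) * X 1]

/-- The substitution `P(X₁, X₂) ↦ P(dX₁ - bX₂, -cX₁ + aX₂)` for `γ = (a, b; c, d)`. -/
def subst (R : Type) [CommRing R] (γ : SL(2, ℤ)) :
    MvPolynomial (Fin 2) R →ₐ[R] MvPolynomial (Fin 2) R :=
  MvPolynomial.aeval (substPair R γ)

lemma subst_one (R : Type) [CommRing R] : subst R 1 = AlgHom.id R _ := by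
  refine MvPolynomial.algHom_ext fun i => ?_
  fin_cases i <;> simp [subst, substPair]

lemma subst_mul (R : Type) [CommRing R] (γ δ : SL(2, ℤ)) :
    subst R (γ * δ) = (subst R γ).comp (subst R δ) := by
  refine MvPolynomial.algHom_ext fun i => ?_
  fin_cases i <;>
  · simp [subst, substPair, Matrix.mul_apply, Fin.sum_univ_two]
    ring

lemma C_mul_X_isHomogeneous {R : Type} [CommRing R] (c : R) (j : Fin 2) :
    (MvPolynomial.C c * MvPolynomial.X j : MvPolynomial (Fin 2) R).IsHomogeneous 1 := by
  simpa using MvPolynomial.isHomogeneous_C_mul_X c j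

lemma substPair_isHomogeneous (R : Type) [CommRing R] (γ : SL(2, ℤ)) (i : Fin 2) :
    (substPair R γ i).IsHomogeneous 1 := by
  revert i
  exact Fin.forall_fin_two.mpr
    ⟨(C_mul_X_isHomogeneous _ _).sub (C_mul_X_isHomogeneous _ _),
      (C_mul_X_isHomogeneous _ _).neg.add (C_mul_X_isHomogeneous _ _)⟩

lemma subst_isHomogeneous (R : Type) [CommRing R] (γ : SL(2, ℤ)) {n : ℕ}
    {P : MvPolynomial (Fin 2) R} (hP : P.IsHomogeneous n) : (subst R γ P).IsHomogeneous n := by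
  have h := hP.aeval (substPair R γ) (substPair_isHomogeneous R γ)
  rwa [one_mul] at h

/-- The space `R[X₁, X₂]_n` of binary forms of degree `n`. For `R = ℤ` it is `M_n`. For `R = ℂ` it
is `M_n^♭ ⊗ ℂ`, since the elements `e_ν^♭ = (-1)^(n-ν) (n choose ν) X₁^(n-ν) X₂^ν` form a
`ℂ`-basis of it. -/
def Form (R : Type) [CommRing R] (n : ℕ) : Type :=
  MvPolynomial.homogeneousSubmodule (Fin 2) R n

instance (R : Type) [CommRing R] (n : ℕ) : AddCommGroup (Form R n) :=
  inferInstanceAs (AddCommGroup (MvPolynomial.homogeneousSubmodule (Fin 2) R n))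

/-- The polynomial underlying a binary form. -/
def Form.poly {R : Type} [CommRing R] {n : ℕ} : Form R n →+ MvPolynomial (Fin 2) R :=
  (MvPolynomial.homogeneousSubmodule (Fin 2) R n).subtype.toAddMonoidHom

lemma Form.poly_injective {R : Type} [CommRing R] {n : ℕ} :
    Function.Injective (Form.poly : Form R n →+ MvPolynomial (Fin 2) R) :=
  Subtype.val_injective

/-- A homogeneous polynomial, as a binary form. -/
def Form.mk {R : Type} [CommRing R] {n : ℕ} (P : MvPolynomial (Fin 2) R)
    (hP : P.IsHomogeneous n) : Form R n := ⟨P, hP⟩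

@[simp] lemma Form.poly_mk {R : Type} [CommRing R] {n : ℕ} (P : MvPolynomial (Fin 2) R)
    (hP : P.IsHomogeneous n) : (Form.mk P hP).poly = P := rfl

lemma Form.coeff_zsmul {R : Type} [CommRing R] {n : ℕ} (c : ℤ) (P : Form R n) (m : Fin 2 →₀ ℕ) :
    (c • P).poly.coeff m = c • P.poly.coeff m := by
  rw [map_zsmul]
  exact map_zsmul (MvPolynomial.coeffAddMonoidHom m) c P.poly

/-- The action of `SL(2, ℤ)` on binary forms. -/
def formRep (R : Type) [CommRing R] (n : ℕ) : Representation ℤ SL(2, ℤ) (Form R n) where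
  toFun γ := AddMonoidHom.toIntLinearMap
    { toFun := fun P => Form.mk (subst R γ P.poly) (subst_isHomogeneous R γ P.2)
      map_zero' := Form.poly_injective (by simp)
      map_add' := fun P Q => Form.poly_injective (by simp) }
  map_one' := LinearMap.ext fun P => Form.poly_injective (by
    change subst R 1 P.poly = P.poly
    rw [subst_one]; rfl)
  map_mul' γ δ := LinearMap.ext fun P => Form.poly_injective (by
    change subst R (γ * δ) P.poly = subst R γ (subst R δ P.poly)
    rw [subst_mul]; rfl)

lemma formRep_poly (R : Type) [CommRing R] (n : ℕ) (γ : SL(2, ℤ)) (P : Form R n) :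
    (formRep R n γ P).poly = subst R γ P.poly := rfl

/-- The exponent of the monomial `X₁^i X₂^j`. -/
def expo (i j : ℕ) : Fin 2 →₀ ℕ := Finsupp.single 0 i + Finsupp.single 1 j

lemma monomial_expo_isHomogeneous {R : Type} [CommRing R] {n i j : ℕ} (h : i + j = n) (c : R) :
    (MvPolynomial.monomial (expo i j) c).IsHomogeneous n := by
  refine MvPolynomial.isHomogeneous_monomial c ?_
  simp [expo, Finsupp.degree_eq_sum, Fin.sum_univ_two, h]

/-- The pairing `M_n^♭ × M_n → ℤ`, extended to `(M_n^♭ ⊗ ℂ) × M_n → ℂ`: it is characterised by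
`⟨e_ν^♭, e_μ⟩ = δ_{ν, μ}`, where `e_μ = X₁^μ X₂^(n-μ)` and
`e_ν^♭ = (-1)^(n-ν) (n choose ν) X₁^(n-ν) X₂^ν`. -/
def formPairing (n : ℕ) : Form ℂ n →ₗ[ℤ] Form ℤ n →ₗ[ℤ] ℂ :=
  LinearMap.mk₂ ℤ
    (fun P Q => ∑ ν ∈ Finset.range (n + 1),
      P.poly.coeff (expo (n - ν) ν) / ((-1) ^ (n - ν) * (n.choose ν : ℂ)) *
        ((Q.poly.coeff (expo ν (n - ν)) : ℤ) : ℂ))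
    (fun P P' Q => by
      simp [add_div, add_mul, Finset.sum_add_distrib])
    (fun c P Q => by
      simp only [Form.coeff_zsmul, zsmul_eq_mul, Finset.mul_sum]
      refine Finset.sum_congr rfl fun ν _ => ?_
      ring)
    (fun P Q Q' => by
      simp [mul_add, Finset.sum_add_distrib])
    (fun c P Q => by
      simp only [Form.coeff_zsmul, zsmul_eq_mul, Finset.mul_sum]
      refine Finset.sum_congr rfl fun ν _ => ?_
      push_cast
      ring)

lemma formPairing_apply {n : ℕ} (P : Form ℂ n) (Q : Form ℤ n) :
    formPairing n P Q = ∑ ν ∈ Finset.range (n + 1),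
      P.poly.coeff (expo (n - ν) ν) / ((-1) ^ (n - ν) * (n.choose ν : ℂ)) *
        ((Q.poly.coeff (expo ν (n - ν)) : ℤ) : ℂ) := rfl

lemma expo_apply_zero (i j : ℕ) : expo i j 0 = i := by simp [expo]

lemma expo_apply_one (i j : ℕ) : expo i j 1 = j := by simp [expo]

lemma expo_inj {i j i' j' : ℕ} : expo i j = expo i' j' ↔ i = i' ∧ j = j' := by
  refine ⟨fun h => ?_, fun h => by rw [h.1, h.2]⟩
  constructor
  · simpa [expo_apply_zero] using DFunLike.congr_fun h 0
  · simpa [expo_apply_one] using DFunLike.congr_fun h 1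

/-- A binary form is the sum of its monomials. -/
lemma Form.poly_eq_sum {R : Type} [CommRing R] {n : ℕ} (P : Form R n) :
    P.poly = ∑ ν ∈ Finset.range (n + 1),
      MvPolynomial.monomial (expo ν (n - ν)) (P.poly.coeff (expo ν (n - ν))) := by
  ext m
  rw [MvPolynomial.coeff_sum]
  simp only [MvPolynomial.coeff_monomial]
  by_cases hm : m 0 + m 1 = n
  · have e : m = expo (m 0) (n - m 0) := by
      ext i; fin_cases i
      · simp [expo_apply_zero]
      · simp [expo_apply_one]; omega
    rw [Finset.sum_eq_single (m 0)]
    · rw [if_pos e.symm, ← e]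
    · intro b _ hb
      rw [if_neg]
      intro h
      exact hb (by rw [← h, expo_apply_zero])
    · intro h
      exact absurd (Finset.mem_range.mpr (by omega)) h
  · have hz : P.poly.coeff m = 0 := by
      refine MvPolynomial.IsHomogeneous.coeff_eq_zero P.2 ?_
      simpa [Finsupp.degree_eq_sum, Fin.sum_univ_two] using hm
    rw [hz, Finset.sum_eq_zero]
    intro ν hν
    rw [if_neg]
    rintro rfl
    apply hm
    rw [expo_apply_zero, expo_apply_one]
    have := Finset.mem_range.mp hν
    omega

/-- `⟨e_ν^♭, e_μ⟩ = δ_{ν, μ}`. -/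
lemma formPairing_basis {n ν μ : ℕ} (hν : ν ≤ n) (hμ : μ ≤ n) :
    formPairing n
      (Form.mk (MvPolynomial.monomial (expo (n - ν) ν) ((-1) ^ (n - ν) * (n.choose ν : ℂ)))
        (monomial_expo_isHomogeneous (by omega) _))
      (Form.mk (MvPolynomial.monomial (expo μ (n - μ)) 1)
        (monomial_expo_isHomogeneous (by omega) _)) = if ν = μ then 1 else 0 := by
  rw [formPairing_apply, Finset.sum_eq_single ν]
  · change MvPolynomial.coeff _ (MvPolynomial.monomial _ _) / _ *
      ((MvPolynomial.coeff _ (MvPolynomial.monomial _ _) : ℤ) : ℂ) = _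
    have h : (n.choose ν : ℂ) ≠ 0 := by exact_mod_cast (Nat.choose_pos hν).ne'
    rw [MvPolynomial.coeff_monomial, MvPolynomial.coeff_monomial, if_pos rfl,
      div_self (mul_ne_zero (pow_ne_zero _ (by norm_num)) h)]
    by_cases e : ν = μ
    · subst e; simp
    · rw [if_neg (fun h => e (expo_inj.mp h).1.symm), if_neg e]; simp
  · intro b _ hb
    change MvPolynomial.coeff _ (MvPolynomial.monomial _ _) / _ * _ = _
    rw [MvPolynomial.coeff_monomial, if_neg (fun h => hb (expo_inj.mp h).2.symm)]
    simp
  · intro h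
    exact absurd (Finset.mem_range.mpr (by omega)) h

/-- The form `(uX₁ + vX₂)^n`. -/
def powForm (n : ℕ) (u v : ℂ) : Form ℂ n :=
  Form.mk ((MvPolynomial.C u * MvPolynomial.X 0 + MvPolynomial.C v * MvPolynomial.X 1) ^ n) (by
    have h := ((C_mul_X_isHomogeneous u 0).add (C_mul_X_isHomogeneous v 1)).pow n
    rwa [one_mul] at h)

lemma powForm_poly (n : ℕ) (u v : ℂ) :
    (powForm n u v).poly = ∑ ν ∈ Finset.range (n + 1),
      MvPolynomial.monomial (expo ν (n - ν)) (u ^ ν * v ^ (n - ν) * (n.choose ν : ℂ)) := by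
  rw [powForm, Form.poly_mk, add_pow]
  refine Finset.sum_congr rfl fun ν _ => ?_
  rw [MvPolynomial.monomial_eq]
  simp [expo, Finsupp.prod_add_index', pow_add, mul_pow, Finsupp.prod_single_index]
  ring

lemma formPairing_powForm (n : ℕ) (u v : ℂ) (Q : Form ℤ n) :
    formPairing n (powForm n u v) Q = MvPolynomial.aeval ![v, -u] Q.poly := by
  rw [formPairing_apply, Q.poly_eq_sum, map_sum]
  refine Finset.sum_congr rfl fun ν hν => ?_
  have hν' : ν ≤ n := by have := Finset.mem_range.mp hν; omega
  have h1 : (powForm n u v).poly.coeff (expo (n - ν) ν) =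
      u ^ (n - ν) * v ^ ν * (n.choose ν : ℂ) := by
    rw [powForm_poly, MvPolynomial.coeff_sum, Finset.sum_eq_single (n - ν)]
    · have e : n - (n - ν) = ν := by omega
      rw [MvPolynomial.coeff_monomial, e, if_pos rfl, Nat.choose_symm hν']
    · intro b _ hb
      rw [MvPolynomial.coeff_monomial, if_neg (fun h => hb (expo_inj.mp h).1)]
    · intro h
      exact absurd (Finset.mem_range.mpr (by omega)) h
  have h : (n.choose ν : ℂ) ≠ 0 := by exact_mod_cast (Nat.choose_pos hν').ne'
  rw [← Q.poly_eq_sum, h1, MvPolynomial.aeval_monomial]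
  have h3 : (expo ν (n - ν)).prod (fun i k => (![v, -u] : Fin 2 → ℂ) i ^ k) =
      v ^ ν * (-u) ^ (n - ν) := by
    simp [expo, Finsupp.prod_add_index', pow_add, Finsupp.prod_single_index]
  rw [h3, neg_pow u]
  have h4 : ((-1 : ℂ) ^ (n - ν)) * (-1) ^ (n - ν) = 1 := by
    rw [← mul_pow]; simp
  have h5 : ((-1 : ℂ) ^ (n - ν)) ≠ 0 := pow_ne_zero _ (by norm_num)
  simp only [eq_intCast]
  field_simp
  linear_combination (-(u ^ (n - ν) * v ^ ν * ((Q.poly.coeff (expo ν (n - ν)) : ℤ) : ℂ))) * h4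

lemma subst_powForm (n : ℕ) (γ : SL(2, ℤ)) (u v : ℂ) :
    formRep ℂ n γ (powForm n u v) =
      powForm n (u * (γ 1 1 : ℤ) - v * (γ 1 0 : ℤ)) (v * (γ 0 0 : ℤ) - u * (γ 0 1 : ℤ)) := by
  refine Form.poly_injective ?_
  rw [formRep_poly, powForm, powForm, Form.poly_mk, Form.poly_mk]
  simp only [subst, substPair, map_pow, map_add, map_mul, MvPolynomial.aeval_X,
    MvPolynomial.aeval_C, MvPolynomial.algebraMap_eq, map_sub]
  congr 1
  simp
  ring

lemma aeval_subst {R : Type} [CommRing R] [Algebra R ℂ] (γ : SL(2, ℤ))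
    (Q : MvPolynomial (Fin 2) R) (x y : ℂ) :
    MvPolynomial.aeval ![x, y] (subst R γ Q) =
      MvPolynomial.aeval ![(γ 1 1 : ℤ) * x - (γ 0 1 : ℤ) * y,
        -((γ 1 0 : ℤ) * x) + (γ 0 0 : ℤ) * y] Q := by
  rw [subst, ← AlgHom.comp_apply]
  congr 1
  refine MvPolynomial.algHom_ext fun i => ?_
  fin_cases i <;> simp [substPair]

lemma formPairing_powForm_equivariant (n : ℕ) (γ : SL(2, ℤ)) (u v : ℂ) (Q : Form ℤ n) :
    formPairing n (formRep ℂ n γ (powForm n u v)) (formRep ℤ n γ Q) =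
      formPairing n (powForm n u v) Q := by
  have hd : ((γ 0 0 : ℤ) : ℂ) * (γ 1 1 : ℤ) - (γ 0 1 : ℤ) * (γ 1 0 : ℤ) = 1 := by
    have h := γ.det_coe
    rw [Matrix.det_fin_two] at h
    exact_mod_cast h
  rw [subst_powForm, formPairing_powForm, formPairing_powForm, formRep_poly, aeval_subst]
  congr 2
  ext i
  fin_cases i
  · simp
    linear_combination v * hd
  · simp
    linear_combination (-u) * hd

/-- The functional `⟨·, Q⟩` on all polynomials, used to see that it is `ℂ`-linear. -/
def pairAux {n : ℕ} (Q : Form ℤ n) : MvPolynomial (Fin 2) ℂ →ₗ[ℂ] ℂ :=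
  ∑ ν ∈ Finset.range (n + 1),
    (((Q.poly.coeff (expo ν (n - ν)) : ℤ) : ℂ) / ((-1) ^ (n - ν) * (n.choose ν : ℂ))) •
      MvPolynomial.lcoeff ℂ (expo (n - ν) ν)

lemma pairAux_poly {n : ℕ} (P : Form ℂ n) (Q : Form ℤ n) :
    pairAux Q P.poly = formPairing n P Q := by
  rw [formPairing_apply, pairAux, LinearMap.sum_apply]
  refine Finset.sum_congr rfl fun ν _ => ?_
  simp only [LinearMap.smul_apply, MvPolynomial.lcoeff_apply, smul_eq_mul]
  ring

lemma formPairing_equivariant (n : ℕ) (γ : SL(2, ℤ)) (P : Form ℂ n) (Q : Form ℤ n) :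
    formPairing n (formRep ℂ n γ P) (formRep ℤ n γ Q) = formPairing n P Q := by
  set L : MvPolynomial (Fin 2) ℂ →ₗ[ℂ] ℂ :=
    pairAux (formRep ℤ n γ Q) ∘ₗ (subst ℂ γ).toLinearMap - pairAux Q with hL
  have hpow : ∀ t : ℂ, L (powForm n t 1).poly = 0 := by
    intro t
    have h := formPairing_powForm_equivariant n γ t 1 Q
    rw [← pairAux_poly, ← pairAux_poly, formRep_poly] at h
    simp [hL, h]
  have hmon : ∀ ν ∈ Finset.range (n + 1),
      L (MvPolynomial.monomial (expo ν (n - ν)) 1) = 0 := by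
    set q : Polynomial ℂ := ∑ ν ∈ Finset.range (n + 1), Polynomial.monomial ν
      ((n.choose ν : ℂ) * L (MvPolynomial.monomial (expo ν (n - ν)) 1)) with hq
    have hq0 : q = 0 := by
      refine Polynomial.funext fun t => ?_
      rw [hq, Polynomial.eval_finsetSum, Polynomial.eval_zero, ← hpow t, powForm_poly, map_sum]
      refine Finset.sum_congr rfl fun ν _ => ?_
      have e : (MvPolynomial.monomial (expo ν (n - ν)) (t ^ ν * 1 ^ (n - ν) * (n.choose ν : ℂ)) :
          MvPolynomial (Fin 2) ℂ) = (t ^ ν * (n.choose ν : ℂ)) •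
            MvPolynomial.monomial (expo ν (n - ν)) 1 := by
        rw [MvPolynomial.smul_monomial]; simp
      rw [e, map_smul, Polynomial.eval_monomial, smul_eq_mul]
      ring
    intro ν hν
    have h := congrArg (fun p => Polynomial.coeff p ν) hq0
    simp only [hq, Polynomial.finsetSum_coeff, Polynomial.coeff_monomial,
      Finset.sum_ite_eq', hν, if_true, Polynomial.coeff_zero] at h
    have hν' : ν ≤ n := by have := Finset.mem_range.mp hν; omega
    have hc : (n.choose ν : ℂ) ≠ 0 := by exact_mod_cast (Nat.choose_pos hν').ne'
    exact (mul_eq_zero.mp h).resolve_left hc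
  have hP : L P.poly = 0 := by
    rw [P.poly_eq_sum, map_sum]
    refine Finset.sum_eq_zero fun ν hν => ?_
    have e : (MvPolynomial.monomial (expo ν (n - ν)) (P.poly.coeff (expo ν (n - ν))) :
        MvPolynomial (Fin 2) ℂ) = P.poly.coeff (expo ν (n - ν)) •
          MvPolynomial.monomial (expo ν (n - ν)) 1 := by
      rw [MvPolynomial.smul_monomial]; simp
    rw [e, map_smul, hmon ν hν, smul_zero]
  rw [← pairAux_poly, ← pairAux_poly, formRep_poly]
  exact sub_eq_zero.mp hP

/-! ## The Eichler–Shimura map -/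

open UpperHalfPlane in
/-- The integral `∫_α^β g(z) dz` along the straight path. -/
def lineIntegral (g : ℍ → ℂ) (α β : ℍ) : ℂ :=
  ∫ t in (0 : ℝ)..1, g (ofComplex (α + t * (β - α))) * ((β : ℂ) - α)

/-- Holomorphic functions on `ℍ`. -/
def Hol (g : ℍ → ℂ) : Prop :=
  DifferentiableOn ℂ (g ∘ UpperHalfPlane.ofComplex) {z | 0 < z.im}

lemma Hol.exists_primitive {g : ℍ → ℂ} (hg : Hol g) :
    ∃ G : ℂ → ℂ, ∀ z : ℍ, HasDerivAt G (g z) z := by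
  obtain ⟨G, hG⟩ := (convex_halfSpace_im_gt 0).exists_forall_hasDerivWithinAt hg
  refine ⟨G, fun z => ?_⟩
  have h := (hG z z.im_pos).hasDerivAt
    ((isOpen_lt continuous_const Complex.continuous_im).mem_nhds z.im_pos)
  simpa using h

lemma segment_im_pos (α β : ℍ) {t : ℝ} (h0 : 0 ≤ t) (h1 : t ≤ 1) :
    0 < ((α : ℂ) + t * (β - α)).im := by
  have ha := α.im_pos
  have hb := β.im_pos
  have : ((α : ℂ) + t * (β - α)).im = (1 - t) * α.im + t * β.im := by
    simp; ring
  rw [this]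
  rcases h0.eq_or_lt with h | h
  · rw [← h]; simpa using ha
  · have := mul_pos h hb
    have := mul_nonneg (sub_nonneg.mpr h1) ha.le
    linarith

lemma lineIntegral_eq {g : ℍ → ℂ} (hg : Hol g) {G : ℂ → ℂ}
    (hG : ∀ z : ℍ, HasDerivAt G (g z) z) (α β : ℍ) : lineIntegral g α β = G β - G α := by
  have hlin : ∀ t : ℝ, HasDerivAt (fun t : ℝ => (α : ℂ) + t * (β - α)) ((β : ℂ) - α) t := by
    intro t
    simpa using ((Complex.ofRealCLM.hasDerivAt (x := t)).mul_const ((β : ℂ) - α)).const_add (α : ℂ)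
  have hmem : ∀ t ∈ Set.uIcc (0 : ℝ) 1, 0 < ((α : ℂ) + t * (β - α)).im := by
    intro t ht
    rw [Set.uIcc_of_le zero_le_one] at ht
    exact segment_im_pos α β ht.1 ht.2
  have hd : ∀ t ∈ Set.uIcc (0 : ℝ) 1, HasDerivAt (fun t : ℝ => G ((α : ℂ) + t * (β - α)))
      (g (UpperHalfPlane.ofComplex (α + t * (β - α))) * ((β : ℂ) - α)) t := by
    intro t ht
    have h := hG ⟨_, hmem t ht⟩
    rw [UpperHalfPlane.ofComplex_apply_of_im_pos (hmem t ht)]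
    exact HasDerivAt.comp t h (hlin t)
  have hc : ContinuousOn (fun t : ℝ =>
      g (UpperHalfPlane.ofComplex (α + t * (β - α))) * ((β : ℂ) - α)) (Set.uIcc 0 1) := by
    refine ContinuousOn.mul ?_ continuousOn_const
    exact hg.continuousOn.comp (f := fun t : ℝ => (α : ℂ) + t * (β - α))
      (fun t _ => (hlin t).continuousAt.continuousWithinAt) hmem
  rw [lineIntegral, intervalIntegral.integral_eq_sub_of_hasDerivAt hd hc.intervalIntegrable]
  simp

section EichlerShimura

variable {n : ℕ} (f : ModularForm 𝒮ℒ ((n + 2 : ℕ) : ℤ))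

lemma hol_modularForm : Hol f := UpperHalfPlane.mdifferentiable_iff.mp f.holo'

lemma hol_mul {F : ℂ → ℂ} (hF : Differentiable ℂ F) : Hol fun z => f z * F z := by
  have h := (hol_modularForm f).mul hF.differentiableOn
  refine h.congr fun z hz => ?_
  simp [UpperHalfPlane.ofComplex_apply_of_im_pos hz]

/-- `∫_α^β f(z) (X₁ - zX₂)^n dz`, expanded as
`∑_ν (n choose ν) (-1)^ν (∫_α^β f(z) z^ν dz) X₁^(n-ν) X₂^ν`. -/
def periodForm (α β : ℍ) : Form ℂ n :=
  Form.mk (∑ ν ∈ Finset.range (n + 1), MvPolynomial.monomial (expo (n - ν) ν)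
      ((n.choose ν : ℂ) * (-1) ^ ν * lineIntegral (fun z => f z * (z : ℂ) ^ ν) α β))
    (MvPolynomial.IsHomogeneous.sum _ _ _ fun ν hν =>
      monomial_expo_isHomogeneous (by have := Finset.mem_range.mp hν; omega) _)

lemma eval_periodForm (α β : ℍ) (x y : ℂ) :
    MvPolynomial.eval ![x, y] (periodForm f α β).poly =
      lineIntegral (fun z => f z * (x - z * y) ^ n) α β := by
  have hH : ∀ ν : ℕ, Hol fun z => f z * (z : ℂ) ^ ν := fun ν =>
    hol_mul f (F := fun z => z ^ ν) (by fun_prop)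
  choose G hG using fun ν => (hH ν).exists_primitive
  have hK : ∀ z : ℍ, HasDerivAt (fun z : ℂ => ∑ ν ∈ Finset.range (n + 1),
      ((n.choose ν : ℂ) * (-1) ^ ν * x ^ (n - ν) * y ^ ν) * G ν z) (f z * (x - z * y) ^ n) z := by
    intro z
    have h := HasDerivAt.fun_sum (u := Finset.range (n + 1)) (x := (z : ℂ))
      (A := fun ν (z : ℂ) => ((n.choose ν : ℂ) * (-1) ^ ν * x ^ (n - ν) * y ^ ν) * G ν z)
      (A' := fun ν => ((n.choose ν : ℂ) * (-1) ^ ν * x ^ (n - ν) * y ^ ν) * (f z * (z : ℂ) ^ ν))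
      fun ν _ => (hG ν z).const_mul _
    refine h.congr_deriv (Eq.symm ?_)
    rw [show x - (z : ℂ) * y = -((z : ℂ) * y) + x by ring, add_pow, Finset.mul_sum]
    refine Finset.sum_congr rfl fun ν _ => ?_
    rw [neg_pow, mul_pow]
    ring
  rw [lineIntegral_eq (hol_mul f (F := fun z => (x - z * y) ^ n) (by fun_prop)) hK, periodForm,
    Form.poly_mk, map_sum, ← Finset.sum_sub_distrib]
  refine Finset.sum_congr rfl fun ν _ => ?_
  rw [lineIntegral_eq (hH ν) (hG ν), MvPolynomial.eval_monomial]
  simp [expo, Finsupp.prod_add_index', pow_add, Finsupp.prod_single_index]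
  ring

lemma Form.ext_eval {P Q : Form ℂ n}
    (h : ∀ x y, MvPolynomial.eval ![x, y] P.poly = MvPolynomial.eval ![x, y] Q.poly) : P = Q := by
  refine Form.poly_injective (MvPolynomial.funext fun v => ?_)
  have e : v = ![v 0, v 1] := by ext i; fin_cases i <;> rfl
  rw [e]
  exact h _ _

lemma periodForm_add (α β δ : ℍ) :
    periodForm f α β + periodForm f β δ = periodForm f α δ := by
  refine Form.ext_eval fun x y => ?_
  rw [map_add, map_add, eval_periodForm, eval_periodForm, eval_periodForm]
  have h := hol_mul f (F := fun z => (x - z * y) ^ n) (by fun_prop)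
  obtain ⟨G, hG⟩ := h.exists_primitive
  rw [lineIntegral_eq h hG, lineIntegral_eq h hG, lineIntegral_eq h hG]
  ring

lemma eval_subst (γ : SL(2, ℤ)) (Q : MvPolynomial (Fin 2) ℂ) (x y : ℂ) :
    MvPolynomial.eval ![x, y] (subst ℂ γ Q) =
      MvPolynomial.eval ![(γ 1 1 : ℤ) * x - (γ 0 1 : ℤ) * y,
        -((γ 1 0 : ℤ) * x) + (γ 0 0 : ℤ) * y] Q := by
  have h := aeval_subst γ Q x y
  rwa [MvPolynomial.aeval_eq_eval, MvPolynomial.aeval_eq_eval] at h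

lemma periodForm_smul (γ : SL(2, ℤ)) (α β : ℍ) :
    periodForm f (γ • α) (γ • β) = formRep ℂ n γ (periodForm f α β) := by
  refine Form.ext_eval fun x y => ?_
  rw [formRep_poly, eval_subst, eval_periodForm, eval_periodForm]
  have h := hol_mul f (F := fun z => (x - z * y) ^ n) (by fun_prop)
  obtain ⟨G, hG⟩ := h.exists_primitive
  have h' := hol_mul f (F := fun z => (((γ 1 1 : ℤ) * x - (γ 0 1 : ℤ) * y) -
    z * (-((γ 1 0 : ℤ) * x) + (γ 0 0 : ℤ) * y)) ^ n) (by fun_prop)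
  have hG' : ∀ z : ℍ, HasDerivAt (fun z : ℂ => G ((γ • UpperHalfPlane.ofComplex z : ℍ) : ℂ))
      (f z * (((γ 1 1 : ℤ) * x - (γ 0 1 : ℤ) * y) -
        z * (-((γ 1 0 : ℤ) * x) + (γ 0 0 : ℤ) * y)) ^ n) z := by
    intro z
    have hdet1 : (Matrix.SpecialLinearGroup.mapGL ℝ γ).val.det = 1 := by
      have h0 : (Matrix.SpecialLinearGroup.mapGL ℝ γ).det.val = 1 := by simp
      exact h0
    have hdet : (0 : ℝ) < (Matrix.SpecialLinearGroup.mapGL ℝ γ).val.det := by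
      rw [hdet1]; exact one_pos
    have h1 := (UpperHalfPlane.hasStrictDerivAt_smul hdet z).hasDerivAt
    have h2 := HasDerivAt.comp (z : ℂ) (by
      rw [UpperHalfPlane.ofComplex_apply]; exact hG (γ • z)) h1
    refine h2.congr_deriv ?_
    have hf : f (γ • z) = (((γ 1 0 : ℤ) : ℂ) * z + (γ 1 1 : ℤ)) ^ (n + 2) * f z := by
      have h3 := SlashInvariantForm.slash_action_eqn' f
        (γ := Matrix.SpecialLinearGroup.mapGL ℝ γ) (MonoidHom.mem_range.mpr ⟨γ, rfl⟩) z
      rw [zpow_natCast] at h3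
      refine Eq.trans h3 ?_
      simp
    have hz : (((γ • z : ℍ)) : ℂ) = (((γ 0 0 : ℤ) : ℂ) * z + (γ 0 1 : ℤ)) /
        (((γ 1 0 : ℤ) : ℂ) * z + (γ 1 1 : ℤ)) := by
      simpa using UpperHalfPlane.coe_specialLinearGroup_apply γ z
    have hden : (((γ 1 0 : ℤ) : ℂ) * z + (γ 1 1 : ℤ)) ≠ 0 := by
      simpa [UpperHalfPlane.denom] using
        UpperHalfPlane.denom_ne_zero (Matrix.SpecialLinearGroup.mapGL ℝ γ) z
    have hd : UpperHalfPlane.denom (Matrix.SpecialLinearGroup.mapGL ℝ γ) z =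
        (((γ 1 0 : ℤ) : ℂ) * z + (γ 1 1 : ℤ)) := by
      simp [UpperHalfPlane.denom]
    rw [hd, hdet1, hf, hz]
    set D := (((γ 1 0 : ℤ) : ℂ) * z + (γ 1 1 : ℤ))
    have e : ((γ 1 1 : ℤ) : ℂ) * x - (γ 0 1 : ℤ) * y -
        z * (-((γ 1 0 : ℤ) * x) + (γ 0 0 : ℤ) * y) =
        D * (x - (((γ 0 0 : ℤ) : ℂ) * z + (γ 0 1 : ℤ)) / D * y) := by
      field_simp
      ring
    rw [e, mul_pow, pow_add, Complex.ofReal_one]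
    field_simp
  rw [lineIntegral_eq h hG, lineIntegral_eq h' hG', UpperHalfPlane.ofComplex_apply,
    UpperHalfPlane.ofComplex_apply]

/-- `r(f)` on singular `1`-chains. The integrand is holomorphic, so that the integral over a
singular `1`-simplex depends on its end points only, and it is taken over the straight path. -/
def chainPeriod : Chain 1 →ₗ[ℤ] Form ℂ n :=
  Finsupp.lsum ℤ fun σ => LinearMap.toSpanSingleton ℤ (Form ℂ n)
    (periodForm f (σ (stdSimplex.vertex 0)) (σ (stdSimplex.vertex 1)))

lemma chainPeriod_single (σ : Simplex 1) : chainPeriod f (Finsupp.single σ 1) =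
    periodForm f (σ (stdSimplex.vertex 0)) (σ (stdSimplex.vertex 1)) := by
  simp [chainPeriod]

/-- `r(f) : MS(ℍ) → M_n^♭ ⊗ ℂ`, `{α, β} ↦ ∫_α^β f(z) (X₁ - zX₂)^n dz`. -/
def msPeriod : MS →ₗ[ℤ] Form ℂ n :=
  (LinearMap.range (boundary 1)).liftQ (chainPeriod f) (by
    rw [LinearMap.range_le_ker_iff]
    refine Finsupp.lhom_ext' fun σ => LinearMap.ext_ring ?_
    have e1 : (1 : Fin 3).succAbove (1 : Fin 2) = 2 := by decide
    have e2 : (2 : Fin 3).succAbove (1 : Fin 2) = 1 := by decide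
    have e3 : (2 : Fin 3).succAbove (0 : Fin 2) = 0 := by decide
    have e4 : (1 : Fin 3).succAbove (0 : Fin 2) = 0 := by decide
    have e5 : (0 : Fin 3).succAbove (0 : Fin 2) = 1 := by decide
    have e6 : (0 : Fin 3).succAbove (1 : Fin 2) = 2 := by decide
    rw [LinearMap.comp_apply, Finsupp.lsingle_apply, LinearMap.comp_apply, boundary_single,
      Fin.sum_univ_three, map_add, map_add, map_smul, map_smul, map_smul, chainPeriod_single,
      chainPeriod_single, chainPeriod_single]
    simp only [Simplex.face, ContinuousMap.coe_mk, stdSimplex.map_vertex, e1, e2, e3, e4, e5, e6]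
    have h := periodForm_add f (σ (stdSimplex.vertex 0)) (σ (stdSimplex.vertex 1))
      (σ (stdSimplex.vertex 2))
    rw [← h]
    simp)

lemma msPeriod_path (α β : ℍ) : msPeriod f (path α β) = periodForm f α β := by
  change chainPeriod f (Finsupp.single (segmentSimplex α β) 1) = _
  rw [chainPeriod_single]
  congr 1 <;>
  · ext
    simp [segmentSimplex]

/-- The cocycle `r(f) ∈ Hom(MS(ℍ), M_n^♭ ⊗ ℂ)^Γ`. -/
def periodCocycle : (msRep.linHom (formRep ℂ n)).invariants :=
  ⟨msPeriod f, fun γ => by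
    refine Submodule.linearMap_qext _ (Finsupp.lhom_ext' fun σ => LinearMap.ext_ring ?_)
    change formRep ℂ n γ (chainPeriod f (chainRep 1 γ⁻¹ (Finsupp.single σ 1))) =
      chainPeriod f (Finsupp.single σ 1)
    rw [chainRep_single, chainPeriod_single, chainPeriod_single, ← periodForm_smul]
    simp [Simplex.act]⟩

/-- The Eichler–Shimura class `r(f) ∈ H^1(Y, M_n^♭) ⊗ ℂ = H^1(Y, M_n^♭ ⊗ ℂ)`. -/
def eichlerShimura : Coh1 (formRep ℂ n) := Submodule.Quotient.mk (periodCocycle f)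

end EichlerShimura

/-- The Eisenstein class `Eis_n = r(E_{n+2})`, where `E_{n+2}` is the Eisenstein series of weight
`n + 2` and level `SL(2, ℤ)` with constant term `1`. -/
def Eis (n : ℕ) (hn : 2 ≤ n) : Coh1 (formRep ℂ n) :=
  eichlerShimura (ModularForm.E (k := n + 2) (by omega))

/-- The pairing `⟨ , ⟩ : (H^1(Y, M_n^♭) ⊗ ℂ) × H_1(Y, M_n) → ℂ`. -/
def pairing (n : ℕ) : Coh1 (formRep ℂ n) →ₗ[ℤ] H1 (formRep ℤ n) →ₗ[ℤ] ℂ :=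
  cohPairing (formRep ℂ n) (formRep ℤ n) (formPairing n) (formPairing_equivariant n)

/-! ## Orders in real quadratic fields, narrow ideal classes and partial zeta functions -/

section NumberField

variable {F : Type*} [Field F]

/-- The group of totally positive elements of `Fˣ`. -/
def totallyPositive (F : Type*) [Field F] : Subgroup Fˣ where
  carrier := {x | ∀ φ : F →+* ℝ, 0 < φ x}
  mul_mem' hx hy φ := by
    rw [Units.val_mul, map_mul]
    exact mul_pos (hx φ) (hy φ)
  one_mem' φ := by simp
  inv_mem' {x} hx φ := by
    rw [Units.val_inv_eq_inv_val, map_inv₀]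
    exact inv_pos.mpr (hx φ)

/-- The group `O_+^×` of totally positive units of `O`. -/
def positiveUnits (O : Subring F) : Subgroup Oˣ :=
  (totallyPositive F).comap (Units.map (O.subtype : O →* F))

/-- The narrow ideal class group `Cl_O^+`: invertible fractional ideals of `O` modulo the principal
ideals generated by totally positive elements. -/
abbrev NarrowClassGroup (O : Subring F) [IsFractionRing O F] : Type _ :=
  (FractionalIdeal O⁰ F)ˣ ⧸ (totallyPositive F).map (toPrincipalIdeal O F)

/-- The norm `N𝔞 = [O : 𝔞] = [O : 𝔞 ∩ O] / [𝔞 : 𝔞 ∩ O]` of a fractional ideal of `O`. -/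
def idealNorm (O : Subring F) (𝔞 : FractionalIdeal O⁰ F) : ℚ :=
  ((𝔞 : Submodule O F).toAddSubgroup.relIndex O.toAddSubgroup : ℚ) /
    (O.toAddSubgroup.relIndex (𝔞 : Submodule O F).toAddSubgroup : ℚ)

/-- `Z` is the meromorphic continuation to `ℂ`, holomorphic outside `s = 1`, of the partial zeta
function `ζ_O(A, s) = ∑ (N𝔞)^(-s)`, `Re s > 1`, where the sum is over the invertible ideals
`𝔞 ⊆ O` in the class `A`. By the identity theorem the values of `Z` outside `1` are determined. -/
def IsPartialZeta (O : Subring F) [IsFractionRing O F] (A : NarrowClassGroup O)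
    (Z : ℂ → ℂ) : Prop :=
  (∀ s : ℂ, 1 < s.re →
    HasSum (fun 𝔞 : {𝔞 : (FractionalIdeal O⁰ F)ˣ //
        (𝔞 : FractionalIdeal O⁰ F) ≤ 1 ∧ (QuotientGroup.mk 𝔞 : NarrowClassGroup O) = A} =>
      ((idealNorm O 𝔞.1 : ℚ) : ℂ) ^ (-s)) (Z s)) ∧
  DifferentiableOn ℂ Z {1}ᶜ ∧ MeromorphicAt Z 1

section Integrality

variable [NumberField F] (O : Subring F) [Module.Finite ℤ O] [IsFractionRing O F]

/-- `xO` as a subgroup of `F`. -/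
def mulOrder (x : F) : AddSubgroup F := O.toAddSubgroup.map (AddMonoidHom.mulLeft x)

lemma exists_basis_order : ∃ (r : ℕ) (ω : Module.Basis (Fin r) ℚ F),
    O.toAddSubgroup = AddSubgroup.closure (Set.range ω) := by
  have : Module.Free ℤ O := Module.free_of_finite_type_torsion_free'
  have b := Module.finBasis ℤ O
  refine ⟨_, b.localizationLocalization ℚ ℤ⁰ F, ?_⟩
  apply AddSubgroup.toIntSubmodule.injective
  rw [AddSubgroup.toIntSubmodule_closure, b.localizationLocalization_span ℚ ℤ⁰ F]
  ext x
  simp only [LinearMap.mem_range]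
  exact ⟨fun h => ⟨⟨x, h⟩, rfl⟩, by rintro ⟨⟨a, ha⟩, rfl⟩; exact ha⟩

lemma mulOrder_relIndex {x y : F} (hx : x ≠ 0) (hy : y ≠ 0) (h : ∃ z ∈ O, x = y * z) :
    ((mulOrder O x).relIndex (mulOrder O y) : ℚ) = |Algebra.norm ℚ (x / y)| := by
  obtain ⟨r, ω, hω⟩ := exists_basis_order O
  have hbasis : ∀ u : F, (hu : u ≠ 0) → ∃ b : Module.Basis (Fin r) ℚ F,
      (∀ i, b i = u * ω i) ∧ mulOrder O u = AddSubgroup.closure (Set.range b) := by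
    intro u hu
    refine ⟨ω.map (LinearEquiv.smulOfNeZero F F u hu |>.restrictScalars ℚ), fun i => ?_, ?_⟩
    · simp
    · rw [mulOrder, hω, AddMonoidHom.map_closure]
      congr 1
      ext z
      simp
  obtain ⟨b₁, h₁, c₁⟩ := hbasis x hx
  obtain ⟨b₂, h₂, c₂⟩ := hbasis y hy
  have hle : mulOrder O x ≤ mulOrder O y := by
    obtain ⟨z, hz, rfl⟩ := h
    rintro _ ⟨w, hw, rfl⟩
    refine ⟨z * w, O.mul_mem hz hw, ?_⟩
    simp [mul_assoc]
  rw [AddSubgroup.relIndex_eq_abs_det _ _ hle b₁ b₂ c₁ c₂]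
  have e : (b₁ : Fin r → F) = (LinearMap.mulLeft ℚ (x / y)) ∘ b₂ := by
    ext i
    simp only [Function.comp_apply, LinearMap.mulLeft_apply, h₁, h₂]
    field_simp
  rw [e, Module.Basis.det_comp, Module.Basis.det_self, mul_one, Algebra.norm_apply]
  rfl

lemma norm_div_idealNorm (𝔞 : FractionalIdeal O⁰ F) {α : F} (hα : α ∈ (𝔞 : Submodule O F)) :
    ∃ m : ℤ, Algebra.norm ℚ α / idealNorm O 𝔞 = m := by
  rcases eq_or_ne α 0 with rfl | h0
  · exact ⟨0, by simp⟩
  set L := (𝔞 : Submodule O F).toAddSubgroup with hL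
  have hαL : mulOrder O α ≤ L := by
    rintro _ ⟨w, hw, rfl⟩
    have := (𝔞 : Submodule O F).smul_mem ⟨w, hw⟩ hα
    change α * w ∈ (𝔞 : Submodule O F)
    rw [mul_comm]
    exact this
  have h1 : mulOrder O 1 = O.toAddSubgroup := by
    ext z; simp [mulOrder]
  have hnorm : ∀ {x : F}, x ≠ 0 → Algebra.norm ℚ x ≠ 0 := fun hx =>
    (Algebra.norm_ne_zero_iff).mpr hx
  -- The index `s` of `αO` in the ideal is finite.
  obtain ⟨d, hd, hdL⟩ := 𝔞.isFractional
  have hs : (mulOrder O α).relIndex L ≠ 0 := by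
    have hd0 : (d : F) ≠ 0 := by
      intro h
      exact nonZeroDivisors.ne_zero hd (Subtype.ext h)
    have hinj : Function.Injective (AddMonoidHom.mulLeft (d : F)) := mul_right_injective₀ hd0
    rw [← AddSubgroup.relIndex_map_map_of_injective _ _ hinj]
    have e : (mulOrder O α).map (AddMonoidHom.mulLeft (d : F)) = mulOrder O (d * α) := by
      ext z; simp [mulOrder, mul_assoc]
    have hle : mulOrder O (d * α) ≤ L.map (AddMonoidHom.mulLeft (d : F)) :=
      e ▸ AddSubgroup.map_mono hαL
    have hle' : L.map (AddMonoidHom.mulLeft (d : F)) ≤ O.toAddSubgroup := by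
      rintro _ ⟨w, hw, rfl⟩
      obtain ⟨v, hv⟩ := hdL w hw
      have : (v : F) = d * w := hv
      change (d : F) * w ∈ O
      rw [← this]
      exact v.2
    have hmem : (d : F) * α ∈ O := hle' ⟨α, hα, rfl⟩
    have hi := mulOrder_relIndex O (mul_ne_zero hd0 h0) one_ne_zero
      ⟨(d : F) * α, hmem, by rw [one_mul]⟩
    rw [h1, div_one] at hi
    have hi0 : (mulOrder O (d * α)).relIndex O.toAddSubgroup ≠ 0 := by
      intro h
      rw [h, Nat.cast_zero] at hi
      exact (abs_ne_zero.mpr (hnorm (mul_ne_zero hd0 h0))) hi.symm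
    rw [e]
    intro h
    apply hi0
    rw [← AddSubgroup.relIndex_mul_relIndex _ _ _ hle hle', h, zero_mul]
  -- Write `α = p / q` with `p, q ∈ O` and compare indices through `pO`.
  obtain ⟨p, q, hq, hpq⟩ := IsFractionRing.div_surjective (A := O) α
  have hq0 : (q : F) ≠ 0 := by
    intro h
    exact nonZeroDivisors.ne_zero hq (Subtype.ext h)
  have hp : (p : F) = α * q := by
    rw [← hpq]
    change (p : F) = (p : F) / q * q
    rw [div_mul_cancel₀ _ hq0]
  have hp0 : (p : F) ≠ 0 := hp ▸ mul_ne_zero h0 hq0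
  have hpα : mulOrder O (p : F) ≤ mulOrder O α := by
    rw [hp]
    rintro _ ⟨w, hw, rfl⟩
    exact ⟨q * w, O.mul_mem q.2 hw, by simp [mul_assoc]⟩
  have hpO : mulOrder O (p : F) ≤ O.toAddSubgroup := by
    rintro _ ⟨w, hw, rfl⟩
    exact O.mul_mem p.2 hw
  have i1 := mulOrder_relIndex O hp0 one_ne_zero ⟨(p : F), p.2, by rw [one_mul]⟩
  have i2 := mulOrder_relIndex O hp0 h0 ⟨(q : F), q.2, hp⟩
  rw [h1, div_one] at i1
  have e2 : (p : F) / α = q := by rw [hp]; field_simp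
  rw [e2] at i2
  have hc1 : mulOrder O (p : F) ≤ L ⊓ O.toAddSubgroup := le_inf (hpα.trans hαL) hpO
  have j1 := AddSubgroup.relIndex_mul_relIndex _ _ _ hc1 inf_le_right
  have j2 := AddSubgroup.relIndex_mul_relIndex _ _ _ hc1 inf_le_left
  have j3 := AddSubgroup.relIndex_mul_relIndex _ _ _ hpα hαL
  rw [AddSubgroup.inf_relIndex_right] at j1
  rw [AddSubgroup.inf_relIndex_left, ← j3] at j2
  set s := (mulOrder O α).relIndex L
  set y := (mulOrder O (p : F)).relIndex (L ⊓ O.toAddSubgroup)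
  set u := L.relIndex O.toAddSubgroup
  set w := O.toAddSubgroup.relIndex L
  have k1 : (y : ℚ) * u = |Algebra.norm ℚ (p : F)| := by rw [← i1]; exact_mod_cast j1
  have k2 : (y : ℚ) * w = |Algebra.norm ℚ (q : F)| * s := by rw [← i2]; exact_mod_cast j2
  have hNq : |Algebra.norm ℚ (q : F)| ≠ 0 := abs_ne_zero.mpr (hnorm hq0)
  have hsQ : (s : ℚ) ≠ 0 := by exact_mod_cast hs
  have hyw : (y : ℚ) * w ≠ 0 := k2 ▸ mul_ne_zero hNq hsQ
  have hy0 : (y : ℚ) ≠ 0 := left_ne_zero_of_mul hyw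
  have hw0 : (w : ℚ) ≠ 0 := right_ne_zero_of_mul hyw
  have k3 : (y : ℚ) * u = |Algebra.norm ℚ α| * |Algebra.norm ℚ (q : F)| := by
    rw [k1, hp, map_mul, abs_mul]
  have hu0 : (u : ℚ) ≠ 0 := by
    refine right_ne_zero_of_mul (a := (y : ℚ)) ?_
    rw [k3]
    exact mul_ne_zero (abs_ne_zero.mpr (hnorm h0)) hNq
  have habs : |Algebra.norm ℚ α| / idealNorm O 𝔞 = s := by
    change |Algebra.norm ℚ α| / ((u : ℚ) / w) = s
    rw [div_div_eq_mul_div, div_eq_iff hu0]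
    apply mul_left_cancel₀ (mul_ne_zero hNq hy0)
    linear_combination (|Algebra.norm ℚ (q : F)| * |Algebra.norm ℚ α|) * k2 -
      (s : ℚ) * |Algebra.norm ℚ (q : F)| * k3
  rcases abs_choice (Algebra.norm ℚ α) with h | h
  · exact ⟨s, by rw [← h, habs]; simp⟩
  · refine ⟨-s, ?_⟩
    rw [h, neg_div] at habs
    rw [Int.cast_neg, Int.cast_natCast, ← habs, neg_neg]

end Integrality

lemma norm_eq_mul_conj [NumberField F] (hF : Module.finrank ℚ F = 2) {ι ι' : F →+* ℝ}
    (hι : ι ≠ ι') (x : F) : ((Algebra.norm ℚ x : ℚ) : ℝ) = ι x * ι' x := by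
  classical
  let σ : F →ₐ[ℚ] ℂ := (Complex.ofRealHom.comp ι).toRatAlgHom
  let σ' : F →ₐ[ℚ] ℂ := (Complex.ofRealHom.comp ι').toRatAlgHom
  have hσ : σ ≠ σ' := by
    intro h
    apply hι
    ext y
    have := DFunLike.congr_fun h y
    exact Complex.ofReal_injective this
  have hcard : Fintype.card (F →ₐ[ℚ] ℂ) = 2 := by rw [AlgHom.card, hF]
  have huniv : (Finset.univ : Finset (F →ₐ[ℚ] ℂ)) = {σ, σ'} := by
    symm
    apply Finset.eq_univ_of_card
    rw [hcard, Finset.card_pair hσ]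
  have h := Algebra.norm_eq_prod_embeddings ℚ ℂ x
  rw [huniv, Finset.prod_pair hσ] at h
  apply Complex.ofReal_injective
  rw [Complex.ofReal_mul]
  have hx : σ x * σ' x = ((ι x : ℝ) : ℂ) * ((ι' x : ℝ) : ℂ) := rfl
  rw [← hx, ← h]
  simp

/-- The polynomial `-(1/N𝔞) (α₂X₁ - α₁X₂) (α₂'X₁ - α₁'X₂)` with real coefficients, for an ideal of
norm `N𝔞 = c`, where `ι` is the given embedding `F ⊂ ℝ` and `ι' x = x'`. -/
def realNormForm (ι ι' : F →+* ℝ) (c : ℚ) (α₁ α₂ : F) : MvPolynomial (Fin 2) ℝ :=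
  -(MvPolynomial.C (1 / (c : ℝ)) *
    (MvPolynomial.C (ι α₂) * MvPolynomial.X 0 - MvPolynomial.C (ι α₁) * MvPolynomial.X 1) *
    (MvPolynomial.C (ι' α₂) * MvPolynomial.X 0 - MvPolynomial.C (ι' α₁) * MvPolynomial.X 1))

lemma exists_normForm [NumberField F] (hF : Module.finrank ℚ F = 2) {ι ι' : F →+* ℝ}
    (hι : ι ≠ ι') (O : Subring F) [Module.Finite ℤ O] [IsFractionRing O F]
    (𝔞 : FractionalIdeal O⁰ F) {α₁ α₂ : F} (h₁ : α₁ ∈ (𝔞 : Submodule O F))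
    (h₂ : α₂ ∈ (𝔞 : Submodule O F)) :
    ∃ Q : Form ℤ 2, MvPolynomial.map (Int.castRingHom ℝ) Q.poly =
      realNormForm ι ι' (idealNorm O 𝔞) α₁ α₂ := by
  obtain ⟨m₁, e₁⟩ := norm_div_idealNorm O 𝔞 h₁
  obtain ⟨m₂, e₂⟩ := norm_div_idealNorm O 𝔞 h₂
  obtain ⟨m₃, e₃⟩ := norm_div_idealNorm O 𝔞 ((𝔞 : Submodule O F).add_mem h₁ h₂)
  have key : ∀ (x : F) (m : ℤ), Algebra.norm ℚ x / idealNorm O 𝔞 = m →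
      1 / (idealNorm O 𝔞 : ℝ) * (ι x * ι' x) = m := by
    intro x m h
    rw [← norm_eq_mul_conj hF hι, one_div, mul_comm, ← div_eq_mul_inv]
    exact_mod_cast h
  have f₁ := key _ _ e₁
  have f₂ := key _ _ e₂
  have f₃ := key _ _ e₃
  rw [map_add, map_add] at f₃
  set c : ℝ := 1 / (idealNorm O 𝔞 : ℝ) with hc
  have hX : ∀ (m : ℤ) (i j : Fin 2), (MvPolynomial.C m * (MvPolynomial.X i * MvPolynomial.X j) :
      MvPolynomial (Fin 2) ℤ).IsHomogeneous 2 := fun m i j => by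
    simpa using (MvPolynomial.isHomogeneous_C (Fin 2) m).mul
      ((MvPolynomial.isHomogeneous_X ℤ i).mul (MvPolynomial.isHomogeneous_X ℤ j))
  refine ⟨Form.mk (MvPolynomial.C (-m₂) * (MvPolynomial.X 0 * MvPolynomial.X 0) +
    MvPolynomial.C (m₃ - m₁ - m₂) * (MvPolynomial.X 0 * MvPolynomial.X 1) +
    MvPolynomial.C (-m₁) * (MvPolynomial.X 1 * MvPolynomial.X 1))
    (((hX _ _ _).add (hX _ _ _)).add (hX _ _ _)), ?_⟩
  rw [Form.poly_mk, realNormForm, ← hc]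
  have g₁ : (MvPolynomial.C (m₁ : ℝ) : MvPolynomial (Fin 2) ℝ) =
      MvPolynomial.C c * (MvPolynomial.C (ι α₁) * MvPolynomial.C (ι' α₁)) := by
    rw [← f₁]; simp
  have g₂ : (MvPolynomial.C (m₂ : ℝ) : MvPolynomial (Fin 2) ℝ) =
      MvPolynomial.C c * (MvPolynomial.C (ι α₂) * MvPolynomial.C (ι' α₂)) := by
    rw [← f₂]; simp
  have g₃ : (MvPolynomial.C (m₃ : ℝ) : MvPolynomial (Fin 2) ℝ) =
      MvPolynomial.C c * ((MvPolynomial.C (ι α₁) + MvPolynomial.C (ι α₂)) *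
        (MvPolynomial.C (ι' α₁) + MvPolynomial.C (ι' α₂))) := by
    rw [← f₃]; simp
  have hC : ∀ m : ℤ, MvPolynomial.map (Int.castRingHom ℝ) (MvPolynomial.C m) =
      (MvPolynomial.C (m : ℝ) : MvPolynomial (Fin 2) ℝ) := fun m => by
    rw [MvPolynomial.map_C]; rfl
  simp only [map_add, map_mul, map_neg, map_sub, MvPolynomial.map_X, hC]
  rw [g₁, g₂, g₃]
  ring

/-- The form `N_{α₁, α₂} = -(1/N𝔞) (α₂X₁ - α₁X₂) (α₂'X₁ - α₁'X₂) ∈ M_2`, for `α₁, α₂ ∈ 𝔞`: the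
binary form with integral coefficients which is equal to it over `ℝ`. -/
def normForm [NumberField F] (hF : Module.finrank ℚ F = 2) {ι ι' : F →+* ℝ}
    (hι : ι ≠ ι') (O : Subring F) [Module.Finite ℤ O] [IsFractionRing O F]
    (𝔞 : FractionalIdeal O⁰ F) {α₁ α₂ : F} (h₁ : α₁ ∈ (𝔞 : Submodule O F))
    (h₂ : α₂ ∈ (𝔞 : Submodule O F)) : Form ℤ 2 :=
  (exists_normForm hF hι O 𝔞 h₁ h₂).choose

lemma map_normForm [NumberField F] (hF : Module.finrank ℚ F = 2) {ι ι' : F →+* ℝ}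
    (hι : ι ≠ ι') (O : Subring F) [Module.Finite ℤ O] [IsFractionRing O F]
    (𝔞 : FractionalIdeal O⁰ F) {α₁ α₂ : F} (h₁ : α₁ ∈ (𝔞 : Submodule O F))
    (h₂ : α₂ ∈ (𝔞 : Submodule O F)) :
    MvPolynomial.map (Int.castRingHom ℝ) (normForm hF hι O 𝔞 h₁ h₂).poly =
      realNormForm ι ι' (idealNorm O 𝔞) α₁ α₂ :=
  (exists_normForm hF hι O 𝔞 h₁ h₂).choose_spec

/-! ## The cycles `z_{O,k}(A)` -/

/-- The `m`-th power of a binary form. -/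
def Form.pow {n : ℕ} (Q : Form ℤ n) (m : ℕ) : Form ℤ (n * m) :=
  Form.mk (Q.poly ^ m) (MvPolynomial.IsHomogeneous.pow Q.2 m)

lemma formRep_pow {n : ℕ} {γ : SL(2, ℤ)} {Q : Form ℤ n} (h : formRep ℤ n γ Q = Q) (m : ℕ) :
    formRep ℤ (n * m) γ (Q.pow m) = Q.pow m := by
  refine Form.poly_injective ?_
  have h' : subst ℤ γ Q.poly = Q.poly := by rw [← formRep_poly, h]
  change subst ℤ γ (Q.poly ^ m) = Q.poly ^ m
  rw [map_pow, h']

/-- The choices in the construction of the cycle `z_{O,k}(A)` attached to a narrow class `A`: an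
ideal `𝔞` in `A`, a `ℤ`-basis `α₁, α₂` of `𝔞` with `α₁α₂' - α₁'α₂ > 0`, the generator `ε₀ > 1` of
the group of totally positive units, the matrix `γ₀ ∈ SL(2, ℤ)` with
`γ₀ (α₁, α₂)ᵗ = (ε₀α₁, ε₀α₂)ᵗ`, and a base point `τ ∈ ℍ`. -/
structure CycleData (ι ι' : F →+* ℝ) (O : Subring F) [IsFractionRing O F]
    (A : NarrowClassGroup O) where
  /-- the ideal `𝔞` -/
  ideal : (FractionalIdeal O⁰ F)ˣ
  ideal_mem : (QuotientGroup.mk ideal : NarrowClassGroup O) = A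
  /-- the basis `α₁, α₂` -/
  basis : Module.Basis (Fin 2) ℤ ((ideal : FractionalIdeal O⁰ F) : Submodule O F)
  orientation : 0 < ι (basis 0) * ι' (basis 1) - ι' (basis 0) * ι (basis 1)
  /-- the unit `ε₀` -/
  unit : Oˣ
  unit_generates : Subgroup.zpowers unit = positiveUnits O
  one_lt_unit : 1 < ι (unit : O)
  /-- the matrix `γ₀` -/
  matrix : SL(2, ℤ)
  matrix_mul_zero : ((matrix 0 0 : ℤ) : F) * basis 0 + ((matrix 0 1 : ℤ) : F) * basis 1 =
    (unit : O) * basis 0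
  matrix_mul_one : ((matrix 1 0 : ℤ) : F) * basis 0 + ((matrix 1 1 : ℤ) : F) * basis 1 =
    (unit : O) * basis 1
  /-- the base point `τ` -/
  basePoint : ℍ

namespace CycleData

variable [NumberField F] (hF : Module.finrank ℚ F = 2) {ι ι' : F →+* ℝ} (hι : ι ≠ ι')
  {O : Subring F} [Module.Finite ℤ O] [IsFractionRing O F] {A : NarrowClassGroup O}
  (d : CycleData ι ι' O A)

/-- The form `N_{α₁, α₂}`. -/
def form : Form ℤ 2 := normForm hF hι O d.ideal (d.basis 0).2 (d.basis 1).2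

lemma form_invariant : formRep ℤ 2 d.matrix (d.form hF hι) = d.form hF hι := by
  refine Form.poly_injective ?_
  apply MvPolynomial.map_injective (Int.castRingHom ℝ) Int.cast_injective
  have hsub : ∀ P : MvPolynomial (Fin 2) ℤ, MvPolynomial.map (Int.castRingHom ℝ)
      (subst ℤ d.matrix P) = subst ℝ d.matrix (MvPolynomial.map (Int.castRingHom ℝ) P) := by
    intro P
    induction P using MvPolynomial.induction_on with
    | C c => simp [subst]
    | add p q hp hq => simp [hp, hq]
    | mul_X p i hp =>
      rw [map_mul, map_mul, hp, map_mul, map_mul]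
      congr 1
      fin_cases i <;> simp [subst, substPair]
  rw [formRep_poly, hsub, form, map_normForm]
  set α₁ : F := (d.basis 0 : F) with hα₁
  set α₂ : F := (d.basis 1 : F) with hα₂
  set ε : F := ((d.unit : O) : F) with hε
  have a1 := congrArg ι d.matrix_mul_zero
  have a2 := congrArg ι d.matrix_mul_one
  have b1 := congrArg ι' d.matrix_mul_zero
  have b2 := congrArg ι' d.matrix_mul_one
  simp only [map_add, map_mul, map_intCast, ← hα₁, ← hα₂, ← hε] at a1 a2 b1 b2
  have hdet : ((d.matrix 0 0 : ℤ) : ℝ) * (d.matrix 1 1 : ℤ) -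
      (d.matrix 0 1 : ℤ) * (d.matrix 1 0 : ℤ) = 1 := by
    have h := d.matrix.det_coe
    rw [Matrix.det_fin_two] at h
    exact_mod_cast h
  have hΔ := d.orientation
  rw [← hα₁, ← hα₂] at hΔ
  have hεε : ι ε * ι' ε = 1 := by
    have h : (ι ε * ι' ε - 1) * (ι α₁ * ι' α₂ - ι' α₁ * ι α₂) = 0 := by
      linear_combination (ι α₁ * ι' α₂ - ι' α₁ * ι α₂) * hdet - (ι' ε * ι' α₂) * a1 -
        (((d.matrix 0 0 : ℤ) : ℝ) * ι α₁ + (d.matrix 0 1 : ℤ) * ι α₂) * b2 +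
        (ι' ε * ι' α₁) * a2 +
        (((d.matrix 1 0 : ℤ) : ℝ) * ι α₁ + (d.matrix 1 1 : ℤ) * ι α₂) * b1
    have := (mul_eq_zero.mp h).resolve_right hΔ.ne'
    linarith
  generalize idealNorm O d.ideal = c
  have C1 := congrArg (MvPolynomial.C (σ := Fin 2)) a1
  have C2 := congrArg (MvPolynomial.C (σ := Fin 2)) a2
  have D1 := congrArg (MvPolynomial.C (σ := Fin 2)) b1
  have D2 := congrArg (MvPolynomial.C (σ := Fin 2)) b2
  have E := congrArg (MvPolynomial.C (σ := Fin 2)) hεε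
  simp only [map_add, map_mul, map_one] at C1 C2 D1 D2 E
  have u1 : subst ℝ d.matrix (MvPolynomial.C (ι α₂) * MvPolynomial.X 0 -
      MvPolynomial.C (ι α₁) * MvPolynomial.X 1) = MvPolynomial.C (ι ε) *
      (MvPolynomial.C (ι α₂) * MvPolynomial.X 0 - MvPolynomial.C (ι α₁) * MvPolynomial.X 1) := by
    simp only [subst, substPair, map_sub, map_mul, MvPolynomial.aeval_X, MvPolynomial.aeval_C,
      MvPolynomial.algebraMap_eq, Matrix.cons_val_zero, Matrix.cons_val_one]
    linear_combination MvPolynomial.X 0 * C2 - MvPolynomial.X 1 * C1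
  have u2 : subst ℝ d.matrix (MvPolynomial.C (ι' α₂) * MvPolynomial.X 0 -
      MvPolynomial.C (ι' α₁) * MvPolynomial.X 1) = MvPolynomial.C (ι' ε) *
      (MvPolynomial.C (ι' α₂) * MvPolynomial.X 0 - MvPolynomial.C (ι' α₁) * MvPolynomial.X 1) := by
    simp only [subst, substPair, map_sub, map_mul, MvPolynomial.aeval_X, MvPolynomial.aeval_C,
      MvPolynomial.algebraMap_eq, Matrix.cons_val_zero, Matrix.cons_val_one]
    linear_combination MvPolynomial.X 0 * D2 - MvPolynomial.X 1 * D1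
  have u0 : subst ℝ d.matrix (MvPolynomial.C (1 / (c : ℝ))) = MvPolynomial.C (1 / (c : ℝ)) := by
    rw [subst, MvPolynomial.aeval_C, MvPolynomial.algebraMap_eq]
  rw [realNormForm, map_neg, map_mul, map_mul, u0, u1, u2]
  linear_combination (-(MvPolynomial.C (1 / (c : ℝ))) *
    (MvPolynomial.C (ι α₂) * MvPolynomial.X 0 - MvPolynomial.C (ι α₁) * MvPolynomial.X 1) *
    (MvPolynomial.C (ι' α₂) * MvPolynomial.X 0 - MvPolynomial.C (ι' α₁) * MvPolynomial.X 1)) * E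

/-- The homology class `z_{O,k}(A) = [{τ, γ₀τ} ⊗ N_{α₁, α₂}^(k-1)] ∈ H_1(Y, M_{2k-2})`. -/
def cycle (k : ℕ) : H1 (formRep ℤ (2 * (k - 1))) :=
  hyperbolicClass (formRep ℤ (2 * (k - 1))) d.matrix ((d.form hF hι).pow (k - 1))
    (formRep_pow (d.form_invariant hF hι) (k - 1)) d.basePoint

end CycleData

end NumberField

end HeckeCycle

end

open HeckeCycle

noncomputable section

set_option linter.unusedSectionVars false

namespace HeckeCycle

open Real

/-! ## Theta series of positive definite binary quadratic forms -/

/-! Embed the ideal 𝔞 in ℝ² by v ↦ (x, y) = (v, v'), a lattice of covolume Δ with oriented basis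
(a₀, b₀), (a₁, b₁). Multiplication by ε₀ becomes the automorphism (x, y) ↦ (ε₀x, ε₀⁻¹y), given on
coordinates by γ₀. Both sides of the formula are explicit multiples of one sum, S = ∑ (xy)^(-k) over
the nonzero lattice vectors modulo this automorphism.

Eisenstein side. The pairing is the integral of E_{2k}(z) N(-z, -1)^(k-1) from τ to γ₀τ. Here
2ζ(2k)E_{2k}(z) is the sum of (v₀z + v₁)^(-2k) over all nonzero integral v, and it may be integrated
term by term. With u = x(b₁z - b₀)/(Δ(v₀z + v₁)) the term of v becomes Δ^(2k-1) (xy)^(-k) (u(1 -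
u))^(k-1) du up to the power of N𝔞. Replacing z by γ₀z changes u in the same way as replacing v by
the next vector of its orbit. Hence each orbit telescopes; u runs from 0 to 1 along it, and the
orbit contributes a multiple of the beta value B(k, k). This is `hasSum_lineIntegral` and
`hasSum_pairing`.

Zeta side. The map v ↦ v𝔞⁻¹ identifies the totally positive v modulo ε₀ with the integral ideals in
the inverse class, and the norm of v𝔞⁻¹ is xy/N𝔞 (`bijective_toIdeal`, `idealNorm_toIdeal`). For an
order that need not be maximal this rests on `relIndex_mul`. Total positivity is detected by adding,
for p = 0 and p = 1, the series L_p(w) = ∑ (xy)^p |xy|^(-(w+p)). These are continued by Hecke's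
method: the theta series weighted by (xy)^p satisfies a functional equation
(`theta_functional_equation`), its integral over the closed geodesic of ε₀ unfolds to a sum of
Bessel functions over orbits (`hasSum_thetaIntegral`), and the Mellin transform is L_p times a gamma
factor (`hasSum_mellin`). The dual of a plane lattice is a rotated and scaled copy of the lattice,
so the same series stands on both sides of w ↔ 1 - w.

At w = 1 - k the series L_p with k + p odd vanishes because of the gamma factor. The other one is an
explicit multiple of L_p(k), and L_p(k) = S because k + p is even and the absolute value disappears.
So the sum of both is a multiple of S for either parity of k (`latticeZeta_one_sub`).

The comparison in `pairing_eq` uses Γ(k)² = Γ(2k)B(k, k) and the functional equation of the Riemann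
zeta function, where cos(πk) yields the sign (-1)^k. The continuation is built from one choice of
ideal, basis and base point, which exists by `nonempty_cycleData`; the identity theorem
`IsPartialZeta.eqOn` transfers the formula to every other choice. -/

lemma summable_exp_neg_mul_sq_int {c : ℝ} (hc : 0 < c) :
    Summable fun n : ℤ => rexp (-c * (n : ℝ) ^ 2) := by
  have h := summable_pow_mul_jacobiTheta₂_term_bound 0 (div_pos hc pi_pos) 0
  refine h.congr fun n => ?_
  rw [pow_zero, one_mul]
  congr 1
  field_simp
  ring

/-- `m² + n²` for an integral vector `v = (m, n)`. -/
def sqNorm (v : Fin 2 → ℤ) : ℝ := (v 0 : ℝ) ^ 2 + (v 1 : ℝ) ^ 2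

lemma sqNorm_nonneg (v : Fin 2 → ℤ) : 0 ≤ sqNorm v := by unfold sqNorm; positivity

lemma one_le_sqNorm {v : Fin 2 → ℤ} (hv : v ≠ 0) : 1 ≤ sqNorm v := by
  have h : (1 : ℤ) ≤ v 0 ^ 2 + v 1 ^ 2 := by
    by_contra! h
    apply hv
    have h0 : v 0 ^ 2 = 0 := by nlinarith [sq_nonneg (v 0), sq_nonneg (v 1)]
    have h1 : v 1 ^ 2 = 0 := by nlinarith [sq_nonneg (v 0), sq_nonneg (v 1)]
    ext i
    fin_cases i
    · simpa using h0
    · simpa using h1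
  unfold sqNorm
  exact_mod_cast h

lemma summable_exp_neg_sqNorm {c : ℝ} (hc : 0 < c) :
    Summable fun v : Fin 2 → ℤ => rexp (-c * sqNorm v) := by
  rw [← (finTwoArrowEquiv ℤ).symm.summable_iff]
  have h := summable_exp_neg_mul_sq_int hc
  refine (h.mul_of_nonneg h (fun _ => (exp_pos _).le) (fun _ => (exp_pos _).le)).congr fun p => ?_
  rw [← Real.exp_add, Function.comp_apply, sqNorm]
  congr 1
  simp
  ring

/-- Half of the exponent absorbs the power, because u^n/n! ≤ e^u at u = ct/2; the other half is left
for convergence. -/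
lemma pow_mul_exp_neg_le {c : ℝ} (hc : 0 < c) (n : ℕ) {t : ℝ} (ht : 0 ≤ t) :
    t ^ n * rexp (-c * t) ≤ n.factorial * (2 / c) ^ n * rexp (-(c / 2) * t) := by
  have h := Real.pow_div_factorial_le_exp (c / 2 * t) (by positivity) n
  rw [div_le_iff₀ (by positivity)] at h
  have e : rexp (-c * t) = rexp (-(c / 2) * t) * rexp (-(c / 2) * t) := by
    rw [← Real.exp_add]; ring_nf
  have e1 : rexp (c / 2 * t) * rexp (-(c / 2) * t) = 1 := by
    rw [← Real.exp_add]; simp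
  have e2 : t ^ n = (2 / c) ^ n * (c / 2 * t) ^ n := by
    rw [← mul_pow]; congr 1; field_simp
  calc t ^ n * rexp (-c * t)
      = ((2 / c) ^ n * rexp (-(c / 2) * t)) * ((c / 2 * t) ^ n * rexp (-(c / 2) * t)) := by
        rw [e, e2]; ring
    _ ≤ ((2 / c) ^ n * rexp (-(c / 2) * t)) *
          ((rexp (c / 2 * t) * n.factorial) * rexp (-(c / 2) * t)) := by gcongr
    _ = n.factorial * (2 / c) ^ n * rexp (-(c / 2) * t) := by
        linear_combination (2 / c) ^ n * rexp (-(c / 2) * t) * n.factorial * e1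

lemma summable_pow_mul_exp_neg_sqNorm {c : ℝ} (hc : 0 < c) (n : ℕ) :
    Summable fun v : Fin 2 → ℤ => sqNorm v ^ n * rexp (-c * sqNorm v) := by
  refine Summable.of_nonneg_of_le
    (fun v => mul_nonneg (pow_nonneg (sqNorm_nonneg v) n) (exp_pos _).le)
    (fun v => pow_mul_exp_neg_le hc n (sqNorm_nonneg v))
    ((summable_exp_neg_sqNorm (half_pos hc)).mul_left _)

/-- The theta series of the binary quadratic form `A m² + 2 B m n + C n²`. -/
def binaryTheta (A B C : ℝ) : ℝ :=
  ∑' v : Fin 2 → ℤ, rexp (-π * (A * v 0 ^ 2 + 2 * B * v 0 * v 1 + C * v 1 ^ 2))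

lemma exists_le_binaryForm {A B C : ℝ} (hC : 0 < C) (hD : 0 < A * C - B ^ 2) :
    ∃ c, 0 < c ∧ ∀ x y : ℝ, c * (x ^ 2 + y ^ 2) ≤ A * x ^ 2 + 2 * B * x * y + C * y ^ 2 := by
  have hA : 0 < A := by
    by_contra! h
    nlinarith [sq_nonneg B, mul_nonneg (neg_nonneg.mpr h) hC.le]
  -- Determinant over trace is a lower bound for the smaller eigenvalue. The difference, multiplied
  -- by the trace, is (Ax + By)² + (Bx + Cy)².
  refine ⟨(A * C - B ^ 2) / (A + C), by positivity, fun x y => ?_⟩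
  rw [div_mul_eq_mul_div, div_le_iff₀ (by positivity)]
  nlinarith [sq_nonneg (A * x + B * y), sq_nonneg (B * x + C * y)]

lemma summable_binaryTheta {A B C : ℝ} (hC : 0 < C) (hD : 0 < A * C - B ^ 2) :
    Summable fun v : Fin 2 → ℤ =>
      rexp (-π * (A * v 0 ^ 2 + 2 * B * v 0 * v 1 + C * v 1 ^ 2)) := by
  obtain ⟨c, hc, h⟩ := exists_le_binaryForm hC hD
  refine Summable.of_nonneg_of_le (fun _ => (exp_pos _).le) (fun v => ?_)
    (summable_exp_neg_sqNorm (mul_pos pi_pos hc))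
  rw [Real.exp_le_exp, sqNorm]
  nlinarith [h (v 0) (v 1), pi_pos]

lemma binaryTheta_eq_tsum_tsum {A B C : ℝ} (hC : 0 < C) (hD : 0 < A * C - B ^ 2) :
    ((binaryTheta A B C : ℝ) : ℂ) = ∑' m : ℤ, ∑' n : ℤ,
      Complex.exp (-π * (A * m ^ 2 + 2 * B * m * n + C * n ^ 2)) := by
  have hs := (finTwoArrowEquiv ℤ).symm.summable_iff.mpr (summable_binaryTheta hC hD)
  have hs' := Complex.ofRealCLM.summable hs
  rw [binaryTheta, ← (finTwoArrowEquiv ℤ).symm.tsum_eq, Complex.ofReal_tsum, Summable.tsum_prod]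
  · refine tsum_congr fun m => tsum_congr fun n => ?_
    simp
  · exact hs'

/-- A quarter turn of ℤ². It identifies the adjugate form, which Poisson summation produces, with
the original form, so that no dual lattice is needed. -/
lemma binaryTheta_swap (A B C : ℝ) : binaryTheta C (-B) A = binaryTheta A B C := by
  let e : (Fin 2 → ℤ) ≃ (Fin 2 → ℤ) :=
    { toFun := fun v => ![v 1, -v 0]
      invFun := fun v => ![-v 1, v 0]
      left_inv := fun v => by ext i; fin_cases i <;> simp
      right_inv := fun v => by ext i; fin_cases i <;> simp }
  rw [binaryTheta, ← e.tsum_eq, binaryTheta]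
  refine tsum_congr fun v => ?_
  congr 1
  simp [e]
  ring

/-- Poisson summation in one variable after the other leads to the inverse form with coefficients
C/D, -B/D, A/D; the quarter turn brings it to the shape stated. Between the two summations the
series is complex, with the cross term as a phase, and the order of summation is exchanged. -/
theorem binaryTheta_functional_equation {A B C D : ℝ} (hC : 0 < C) (hD : 0 < D)
    (hD' : D = A * C - B ^ 2) :
    binaryTheta A B C = 1 / √D * binaryTheta (A / D) (B / D) (C / D) := by
  have hC' : (C : ℂ) ≠ 0 := by exact_mod_cast hC.ne'
  have hDC : (D : ℂ) ≠ 0 := by exact_mod_cast hD.ne'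
  have hDc : (D : ℂ) = A * C - B ^ 2 := by rw [hD']; push_cast; ring
  have hA : 0 < A := by
    by_contra! h
    nlinarith [sq_nonneg B, mul_nonneg (neg_nonneg.mpr h) hC.le]
  have hA' : (A : ℂ) ≠ 0 := by exact_mod_cast hA.ne'
  -- Poisson summation over the second variable
  have s1 : ∀ m : ℤ, (∑' n : ℤ, Complex.exp (-π * (A * m ^ 2 + 2 * B * m * n + C * n ^ 2))) =
      1 / (C : ℂ) ^ (1 / 2 : ℂ) * ∑' n : ℤ,
        Complex.exp (-π * (D / C * m ^ 2 + n ^ 2 / C - 2 * Complex.I * (B / C) * m * n)) := by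
    intro m
    have h := Complex.tsum_exp_neg_quadratic (a := C) (by simpa using hC) (-B * m)
    have e1 : ∀ n : ℤ, Complex.exp (-π * (A * m ^ 2 + 2 * B * m * n + C * n ^ 2)) =
        Complex.exp (-π * A * m ^ 2) * Complex.exp (-π * C * n ^ 2 + 2 * π * (-B * m) * n) := by
      intro n; rw [← Complex.exp_add]; congr 1; ring
    have e2 : ∀ n : ℤ, Complex.exp (-π * (D / C * m ^ 2 + n ^ 2 / C -
          2 * Complex.I * (B / C) * m * n)) =
        Complex.exp (-π * A * m ^ 2) * Complex.exp (-π / C * (n + Complex.I * (-B * m)) ^ 2) := by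
      intro n; rw [← Complex.exp_add]; congr 1; rw [hDc]; field_simp
      linear_combination (B : ℂ) ^ 2 * m ^ 2 * Complex.I_sq
    simp only [e1, e2, tsum_mul_left]
    rw [h]; ring
  -- Poisson summation over the first variable
  have s2 : ∀ n : ℤ, (∑' m : ℤ, Complex.exp (-π * (D / C * m ^ 2 + n ^ 2 / C -
        2 * Complex.I * (B / C) * m * n))) =
      1 / ((D / C : ℝ) : ℂ) ^ (1 / 2 : ℂ) * ∑' m : ℤ,
        Complex.exp (-π * (((C / D : ℝ) : ℂ) * m ^ 2 + 2 * (((-(B / D) : ℝ)) : ℂ) * m * n +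
          ((A / D : ℝ) : ℂ) * n ^ 2)) := by
    intro n
    have h := Complex.tsum_exp_neg_quadratic (a := ((D / C : ℝ) : ℂ))
      (by rw [Complex.ofReal_re]; positivity) (Complex.I * (B / C) * n)
    have e1 : ∀ m : ℤ, Complex.exp (-π * (D / C * m ^ 2 + n ^ 2 / C -
          2 * Complex.I * (B / C) * m * n)) =
        Complex.exp (-π * (n ^ 2 / C)) * Complex.exp (-π * ((D / C : ℝ) : ℂ) * m ^ 2 +
          2 * π * (Complex.I * (B / C) * n) * m) := by
      intro m; rw [← Complex.exp_add]; congr 1; push_cast; ring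
    have e2 : ∀ m : ℤ, Complex.exp (-π * (((C / D : ℝ) : ℂ) * m ^ 2 +
          2 * (((-(B / D) : ℝ)) : ℂ) * m * n + ((A / D : ℝ) : ℂ) * n ^ 2)) =
        Complex.exp (-π * (n ^ 2 / C)) * Complex.exp (-π / ((D / C : ℝ) : ℂ) *
          (m + Complex.I * (Complex.I * (B / C) * n)) ^ 2) := by
      intro m; rw [← Complex.exp_add]; congr 1; push_cast
      have hI : Complex.I * (Complex.I * (B / C) * n) = -(B / C * n) := by
        linear_combination (B / C * n : ℂ) * Complex.I_sq
      have hAe : (A : ℂ) = (D + B ^ 2) / C := by rw [hDc]; field_simp; ring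
      rw [hI, hAe]
      field_simp
      ring
    simp only [e1, e2, tsum_mul_left]
    rw [h]; ring
  -- The cross term is purely imaginary here, so the absolute values form a product of two
  -- Gaussians.
  have hsum : Summable (Function.uncurry fun n m : ℤ => Complex.exp (-π * (D / C * m ^ 2 +
      n ^ 2 / C - 2 * Complex.I * (B / C) * m * n))) := by
    rw [← summable_norm_iff]
    have f1 := summable_exp_neg_mul_sq_int (c := π * (1 / C)) (by positivity)
    have f2 := summable_exp_neg_mul_sq_int (c := π * (D / C)) (by positivity)
    refine (f1.mul_of_nonneg f2 (fun _ => (exp_pos _).le) (fun _ => (exp_pos _).le)).congr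
      fun p => ?_
    rw [← Real.exp_add, Function.uncurry_apply_pair, Complex.norm_exp]
    congr 1
    have e : (-π * (D / C * (p.2 : ℂ) ^ 2 + (p.1 : ℂ) ^ 2 / C -
        2 * Complex.I * (B / C) * p.2 * p.1) : ℂ) =
        ((-(π * (1 / C)) * p.1 ^ 2 + -(π * (D / C)) * p.2 ^ 2 : ℝ) : ℂ) +
          ((2 * π * (B / C) * p.2 * p.1 : ℝ) : ℂ) * Complex.I := by
      push_cast; ring
    rw [e, Complex.add_re, Complex.re_ofReal_mul, Complex.ofReal_re, Complex.I_re, mul_zero,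
      add_zero]
  have hfac : (1 / (C : ℂ) ^ (1 / 2 : ℂ)) * (1 / ((D / C : ℝ) : ℂ) ^ (1 / 2 : ℂ)) =
      ((1 / √D : ℝ) : ℂ) := by
    have hh : ((1 / 2 : ℝ) : ℂ) = 1 / 2 := by push_cast; ring
    rw [← hh, ← Complex.ofReal_cpow hC.le, ← Complex.ofReal_cpow (by positivity),
      ← Real.sqrt_eq_rpow, ← Real.sqrt_eq_rpow]
    have : √D = √C * √(D / C) := by
      rw [← Real.sqrt_mul hC.le]; congr 1; field_simp
    rw [this]
    push_cast
    rw [one_div_mul_one_div]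
  have hq1 : 0 < A / D := by positivity
  have hq2 : 0 < C / D * (A / D) - (-(B / D)) ^ 2 := by
    have : C / D * (A / D) - (-(B / D)) ^ 2 = 1 / D := by
      rw [div_mul_div_comm, neg_sq, div_pow, ← pow_two, ← sub_div, div_eq_div_iff (by positivity)
        (by positivity), hD']
      ring
    rw [this]; positivity
  apply Complex.ofReal_injective
  rw [← binaryTheta_swap (A / D), Complex.ofReal_mul,
    binaryTheta_eq_tsum_tsum hq1 hq2, binaryTheta_eq_tsum_tsum hC (hD' ▸ hD), ← hfac]
  simp only [s1, tsum_mul_left]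
  rw [Summable.tsum_comm hsum]
  simp only [s2, tsum_mul_left]
  rw [mul_assoc]
  congr 2
  have hs := (finTwoArrowEquiv ℤ).symm.summable_iff.mpr (summable_binaryTheta hq1 hq2)
  have hs' := Complex.ofRealCLM.summable hs
  refine Summable.tsum_comm (f := fun m n : ℤ => Complex.exp (-π * (((C / D : ℝ) : ℂ) * m ^ 2 +
    2 * (((-(B / D) : ℝ)) : ℂ) * m * n + ((A / D : ℝ) : ℂ) * n ^ 2))) ?_
  refine hs'.congr fun p => ?_
  simp [Function.uncurry]

end HeckeCycle

namespace HeckeCycle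

open Real

/-! ## Lattices in `ℝ²` with a hyperbolic automorphism -/

/-- An oriented lattice `{(v₀ x₀ + v₁ x₁, v₀ y₀ + v₁ y₁)}` in `ℝ²` that meets the coordinate axes
in the origin only, with an automorphism `(x, y) ↦ (εx, ε⁻¹y)`, where `ε > 1`. -/
structure HyperbolicLattice where
  /-- the first coordinates of the basis -/
  a : Fin 2 → ℝ
  /-- the second coordinates of the basis -/
  b : Fin 2 → ℝ
  covol_pos' : 0 < a 0 * b 1 - a 1 * b 0
  x_ne_zero' : ∀ v : Fin 2 → ℤ, v ≠ 0 → v 0 * a 0 + v 1 * a 1 ≠ 0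
  y_ne_zero' : ∀ v : Fin 2 → ℤ, v ≠ 0 → v 0 * b 0 + v 1 * b 1 ≠ 0
  /-- the eigenvalue of the automorphism -/
  ε : ℝ
  one_lt : 1 < ε
  /-- the matrix of the automorphism -/
  γ : SL(2, ℤ)
  γ_a : ∀ i, (γ i 0 : ℝ) * a 0 + (γ i 1 : ℝ) * a 1 = ε * a i
  γ_b : ∀ i, (γ i 0 : ℝ) * b 0 + (γ i 1 : ℝ) * b 1 = ε⁻¹ * b i

namespace HyperbolicLattice

variable (Λ : HyperbolicLattice)

/-- The covolume. -/
def covol : ℝ := Λ.a 0 * Λ.b 1 - Λ.a 1 * Λ.b 0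

lemma covol_pos : 0 < Λ.covol := Λ.covol_pos'

/-- The first coordinate of a lattice vector. -/
def x (v : Fin 2 → ℤ) : ℝ := v 0 * Λ.a 0 + v 1 * Λ.a 1

/-- The second coordinate of a lattice vector. -/
def y (v : Fin 2 → ℤ) : ℝ := v 0 * Λ.b 0 + v 1 * Λ.b 1

lemma x_ne_zero {v : Fin 2 → ℤ} (hv : v ≠ 0) : Λ.x v ≠ 0 := Λ.x_ne_zero' v hv

lemma y_ne_zero {v : Fin 2 → ℤ} (hv : v ≠ 0) : Λ.y v ≠ 0 := Λ.y_ne_zero' v hv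

lemma ε_pos : 0 < Λ.ε := one_pos.trans Λ.one_lt

@[simp] lemma x_zero : Λ.x 0 = 0 := by simp [x]

@[simp] lemma y_zero : Λ.y 0 = 0 := by simp [y]

@[simp] lemma x_neg (v : Fin 2 → ℤ) : Λ.x (-v) = -Λ.x v := by simp [x]; ring

@[simp] lemma y_neg (v : Fin 2 → ℤ) : Λ.y (-v) = -Λ.y v := by simp [y]; ring

/-- The automorphism of `ℤ²` given by a matrix. -/
def vecEquiv (γ : SL(2, ℤ)) : (Fin 2 → ℤ) ≃ (Fin 2 → ℤ) where
  toFun v := Matrix.vecMul v γ.1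
  invFun v := Matrix.vecMul v (γ⁻¹).1
  left_inv v := by
    change Matrix.vecMul (Matrix.vecMul v (γ : Matrix (Fin 2) (Fin 2) ℤ)) (γ⁻¹ : SL(2, ℤ)) = v
    rw [Matrix.vecMul_vecMul, ← Matrix.SpecialLinearGroup.coe_mul]; simp
  right_inv v := by
    change Matrix.vecMul (Matrix.vecMul v (γ⁻¹ : SL(2, ℤ))) (γ : Matrix (Fin 2) (Fin 2) ℤ) = v
    rw [Matrix.vecMul_vecMul, ← Matrix.SpecialLinearGroup.coe_mul]; simp

lemma vecEquiv_apply (γ : SL(2, ℤ)) (v : Fin 2 → ℤ) (i : Fin 2) :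
    vecEquiv γ v i = v 0 * γ 0 i + v 1 * γ 1 i := by
  simp [vecEquiv, Matrix.vecMul, dotProduct, Fin.sum_univ_two]

lemma vecEquiv_one (v : Fin 2 → ℤ) : vecEquiv 1 v = v := by
  simp [vecEquiv]

/-- Matrices act on row vectors from the right, hence the reversed order. -/
lemma vecEquiv_mul (γ δ : SL(2, ℤ)) (v : Fin 2 → ℤ) :
    vecEquiv (γ * δ) v = vecEquiv δ (vecEquiv γ v) := by
  simp [vecEquiv, Matrix.vecMul_vecMul]

lemma vecEquiv_zero (γ : SL(2, ℤ)) : vecEquiv γ 0 = 0 := by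
  simp [vecEquiv]

lemma vecEquiv_ne_zero (γ : SL(2, ℤ)) {v : Fin 2 → ℤ} (hv : v ≠ 0) : vecEquiv γ v ≠ 0 := by
  intro h
  exact hv ((vecEquiv γ).injective (h.trans (vecEquiv_zero γ).symm))

lemma x_vecEquiv (v : Fin 2 → ℤ) : Λ.x (vecEquiv Λ.γ v) = Λ.ε * Λ.x v := by
  simp only [x, vecEquiv_apply]
  push_cast
  linear_combination (v 0 : ℝ) * Λ.γ_a 0 + (v 1 : ℝ) * Λ.γ_a 1

lemma y_vecEquiv (v : Fin 2 → ℤ) : Λ.y (vecEquiv Λ.γ v) = Λ.ε⁻¹ * Λ.y v := by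
  simp only [y, vecEquiv_apply]
  push_cast
  linear_combination (v 0 : ℝ) * Λ.γ_b 0 + (v 1 : ℝ) * Λ.γ_b 1

lemma x_vecEquiv_zpow (j : ℤ) (v : Fin 2 → ℤ) :
    Λ.x (vecEquiv (Λ.γ ^ j) v) = Λ.ε ^ j * Λ.x v := by
  induction j with
  | zero => simp [vecEquiv_one]
  | succ n ih =>
    rw [zpow_add_one, vecEquiv_mul, x_vecEquiv, ih, zpow_add_one₀ Λ.ε_pos.ne']; ring
  | pred n ih =>
    have h := Λ.x_vecEquiv (vecEquiv (Λ.γ ^ (-(n : ℤ) - 1)) v)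
    rw [← vecEquiv_mul, ← zpow_add_one, sub_add_cancel, ih] at h
    rw [zpow_sub_one₀ Λ.ε_pos.ne']
    have := Λ.ε_pos.ne'
    field_simp
    linarith

lemma y_vecEquiv_zpow (j : ℤ) (v : Fin 2 → ℤ) :
    Λ.y (vecEquiv (Λ.γ ^ j) v) = Λ.ε ^ (-j) * Λ.y v := by
  induction j with
  | zero => simp [vecEquiv_one]
  | succ n ih =>
    rw [zpow_add_one, vecEquiv_mul, y_vecEquiv, ih, neg_add, zpow_add₀ Λ.ε_pos.ne', zpow_neg_one]
    ring
  | pred n ih =>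
    have h := Λ.y_vecEquiv (vecEquiv (Λ.γ ^ (-(n : ℤ) - 1)) v)
    rw [← vecEquiv_mul, ← zpow_add_one, sub_add_cancel, ih] at h
    have := Λ.ε_pos.ne'
    rw [neg_sub, sub_neg_eq_add, add_comm, zpow_add_one₀ this]
    rw [neg_neg] at h
    field_simp at h
    linarith

/-- A fundamental domain for the action of the automorphism on the nonzero lattice vectors. -/
def fundDomain : Set (Fin 2 → ℤ) :=
  {v | v ≠ 0 ∧ |Λ.y v| ≤ |Λ.x v| ∧ |Λ.x v| < Λ.ε ^ 2 * |Λ.y v|}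

/-- The nonzero lattice vectors are the translates of the fundamental domain. -/
lemma bijective_translate : Function.Bijective
    (fun p : ℤ × Λ.fundDomain =>
      (⟨vecEquiv (Λ.γ ^ p.1) p.2, vecEquiv_ne_zero _ p.2.2.1⟩ : {v : Fin 2 → ℤ // v ≠ 0})) := by
  have hε := Λ.ε_pos
  have hε2 : 1 < Λ.ε ^ 2 := one_lt_pow₀ Λ.one_lt two_ne_zero
  -- Each application of the automorphism multiplies |x|/|y| by ε², and the fundamental domain is
  -- the range 1 ≤ |x|/|y| < ε². The claim thus reduces to the powers of ε² dividing the positive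
  -- half line into disjoint intervals.
  have hq : ∀ (j : ℤ) (v : Fin 2 → ℤ), |Λ.x (vecEquiv (Λ.γ ^ j) v)| /
      |Λ.y (vecEquiv (Λ.γ ^ j) v)| = (Λ.ε ^ 2) ^ j * (|Λ.x v| / |Λ.y v|) := by
    intro j v
    rw [x_vecEquiv_zpow, y_vecEquiv_zpow, abs_mul, abs_mul, abs_of_pos (zpow_pos hε _),
      abs_of_pos (zpow_pos hε _), zpow_neg, ← zpow_natCast, ← zpow_mul]
    have : Λ.ε ^ (((2 : ℕ) : ℤ) * j) = Λ.ε ^ j * Λ.ε ^ j := by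
      rw [← zpow_add₀ hε.ne']; congr 1; push_cast; ring
    rw [this]
    have := (zpow_pos hε j).ne'
    field_simp
  have hD : ∀ v : Fin 2 → ℤ, v ∈ Λ.fundDomain ↔ v ≠ 0 ∧ 1 ≤ |Λ.x v| / |Λ.y v| ∧
      |Λ.x v| / |Λ.y v| < Λ.ε ^ 2 := by
    intro v
    refine and_congr_right fun hv => ?_
    have := abs_pos.mpr (Λ.y_ne_zero hv)
    rw [le_div_iff₀ this, div_lt_iff₀ this, one_mul]
  constructor
  · rintro ⟨j, v, hv⟩ ⟨j', v', hv'⟩ h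
    have h' : vecEquiv (Λ.γ ^ j) v = vecEquiv (Λ.γ ^ j') v' := congrArg Subtype.val h
    have key : (Λ.ε ^ 2) ^ j * (|Λ.x v| / |Λ.y v|) = (Λ.ε ^ 2) ^ j' * (|Λ.x v'| / |Λ.y v'|) := by
      rw [← hq, ← hq, h']
    obtain ⟨-, h1, h2⟩ := (hD v).mp hv
    obtain ⟨-, h1', h2'⟩ := (hD v').mp hv'
    have aux : ∀ (i i' : ℤ) (r r' : ℝ), 1 ≤ r → r' < Λ.ε ^ 2 →
        (Λ.ε ^ 2) ^ i * r = (Λ.ε ^ 2) ^ i' * r' → i ≤ i' := by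
      intro i i' r r' hr hr' he
      have hp := zpow_pos (one_pos.trans hε2) i'
      have : (Λ.ε ^ 2) ^ i < (Λ.ε ^ 2) ^ (i' + 1) := by
        rw [zpow_add_one₀ (by positivity)]
        calc (Λ.ε ^ 2) ^ i ≤ (Λ.ε ^ 2) ^ i * r :=
              le_mul_of_one_le_right (zpow_pos (by positivity) _).le hr
          _ < _ := by rw [he]; gcongr
      have := (zpow_lt_zpow_iff_right₀ hε2).mp this
      omega
    have hj : j = j' := le_antisymm (aux _ _ _ _ h1 h2' key) (aux _ _ _ _ h1' h2 key.symm)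
    subst hj
    have := (vecEquiv (Λ.γ ^ j)).injective h'
    subst this
    rfl
  · rintro ⟨v, hv⟩
    have hpos : 0 < |Λ.x v| / |Λ.y v| :=
      div_pos (abs_pos.mpr (Λ.x_ne_zero hv)) (abs_pos.mpr (Λ.y_ne_zero hv))
    obtain ⟨j, h1, h2⟩ := exists_mem_Ico_zpow hpos hε2
    have hp := zpow_pos (one_pos.trans hε2) j
    refine ⟨⟨j, ⟨vecEquiv (Λ.γ ^ (-j)) v, (hD _).mpr ⟨vecEquiv_ne_zero _ hv, ?_, ?_⟩⟩⟩, ?_⟩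
    · rw [hq, zpow_neg, ← div_eq_inv_mul, le_div_iff₀ hp, one_mul]
      exact h1
    · rw [hq, zpow_neg, ← div_eq_inv_mul, div_lt_iff₀ hp, mul_comm, ← zpow_add_one₀ (by positivity)]
      exact h2
    · refine Subtype.ext ?_
      change vecEquiv (Λ.γ ^ j) (vecEquiv (Λ.γ ^ (-j)) v) = v
      rw [← vecEquiv_mul, ← zpow_add, neg_add_cancel, zpow_zero, vecEquiv_one]

/-- The nonzero lattice vectors are the translates of the fundamental domain. -/
def translateEquiv : ℤ × Λ.fundDomain ≃ {v : Fin 2 → ℤ // v ≠ 0} :=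
  Equiv.ofBijective _ Λ.bijective_translate

lemma translateEquiv_apply (p : ℤ × Λ.fundDomain) :
    (Λ.translateEquiv p : Fin 2 → ℤ) = vecEquiv (Λ.γ ^ p.1) p.2 := rfl

/-- In coordinates x² + y² is the form of the Gram matrix, whose determinant is the square of the
covolume, so it is positive definite. -/
lemma exists_sqNorm_le : ∃ c, 0 < c ∧ ∀ v, c * sqNorm v ≤ Λ.x v ^ 2 + Λ.y v ^ 2 := by
  have hΔ := Λ.covol_pos
  have hC : 0 < Λ.a 1 ^ 2 + Λ.b 1 ^ 2 := by
    by_contra! h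
    have h1 : Λ.a 1 = 0 := by nlinarith [sq_nonneg (Λ.a 1), sq_nonneg (Λ.b 1)]
    have h2 : Λ.b 1 = 0 := by nlinarith [sq_nonneg (Λ.a 1), sq_nonneg (Λ.b 1)]
    simp [covol, h1, h2] at hΔ
  obtain ⟨c, hc, h⟩ := exists_le_binaryForm (A := Λ.a 0 ^ 2 + Λ.b 0 ^ 2)
    (B := Λ.a 0 * Λ.a 1 + Λ.b 0 * Λ.b 1) hC (by
      have : (Λ.a 0 ^ 2 + Λ.b 0 ^ 2) * (Λ.a 1 ^ 2 + Λ.b 1 ^ 2) -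
        (Λ.a 0 * Λ.a 1 + Λ.b 0 * Λ.b 1) ^ 2 = Λ.covol ^ 2 := by unfold covol; ring
      rw [this]; positivity)
  refine ⟨c, hc, fun v => (h (v 0) (v 1)).trans (le_of_eq ?_)⟩
  unfold x y
  ring

lemma exists_le_sqNorm : ∃ c, 0 < c ∧ ∀ v, Λ.x v ^ 2 + Λ.y v ^ 2 ≤ c * sqNorm v := by
  -- Cauchy–Schwarz gives the sum of squares; the extra 1 only makes positivity immediate.
  refine ⟨Λ.a 0 ^ 2 + Λ.a 1 ^ 2 + Λ.b 0 ^ 2 + Λ.b 1 ^ 2 + 1, by positivity, fun v => ?_⟩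
  unfold x y sqNorm
  nlinarith [sq_nonneg (v 0 * Λ.a 1 - v 1 * Λ.a 0), sq_nonneg (v 0 * Λ.b 1 - v 1 * Λ.b 0),
    sq_nonneg (v 0 : ℝ), sq_nonneg (v 1 : ℝ)]

/-- A lattice sum of a polynomial times a Gaussian converges. -/
lemma summable_norm_pow_mul_exp {c : ℝ} (hc : 0 < c) (p : ℕ) :
    Summable fun v => (Λ.x v ^ 2 + Λ.y v ^ 2) ^ p * rexp (-c * (Λ.x v ^ 2 + Λ.y v ^ 2)) := by
  obtain ⟨c₁, hc₁, h₁⟩ := Λ.exists_sqNorm_le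
  obtain ⟨c₂, hc₂, h₂⟩ := Λ.exists_le_sqNorm
  refine Summable.of_nonneg_of_le (fun v => by positivity) (fun v => ?_)
    ((summable_pow_mul_exp_neg_sqNorm (mul_pos hc hc₁) p).mul_left (c₂ ^ p))
  rw [← mul_assoc, ← mul_pow]
  have h3 : rexp (-c * (Λ.x v ^ 2 + Λ.y v ^ 2)) ≤ rexp (-(c * c₁) * sqNorm v) := by
    rw [Real.exp_le_exp]
    nlinarith [h₁ v]
  have h4 := h₂ v
  have h5 := sqNorm_nonneg v
  gcongr

lemma abs_xy_le (v : Fin 2 → ℤ) : |Λ.x v * Λ.y v| ≤ Λ.x v ^ 2 + Λ.y v ^ 2 := by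
  rw [abs_le]
  constructor <;> nlinarith [sq_nonneg (Λ.x v + Λ.y v), sq_nonneg (Λ.x v - Λ.y v),
    sq_nonneg (Λ.x v), sq_nonneg (Λ.y v)]

lemma summable_xy_pow_mul_exp {c : ℝ} (hc : 0 < c) (p : ℕ) :
    Summable fun v => |Λ.x v * Λ.y v| ^ p * rexp (-c * (Λ.x v ^ 2 + Λ.y v ^ 2)) := by
  refine Summable.of_nonneg_of_le (fun v => by positivity) (fun v => ?_)
    (Λ.summable_norm_pow_mul_exp hc p)
  have := Λ.abs_xy_le v
  gcongr

/-- `∑ (xy)^p exp (-π (α x² + β y²))` over the lattice. -/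
def theta (p : ℕ) (α β : ℝ) : ℝ :=
  ∑' v, (Λ.x v * Λ.y v) ^ p * rexp (-π * (α * Λ.x v ^ 2 + β * Λ.y v ^ 2))

lemma exp_diagonal_le {α β c : ℝ} (hα : c ≤ α) (hβ : c ≤ β) (v : Fin 2 → ℤ) :
    rexp (-π * (α * Λ.x v ^ 2 + β * Λ.y v ^ 2)) ≤
      rexp (-(π * c) * (Λ.x v ^ 2 + Λ.y v ^ 2)) := by
  rw [Real.exp_le_exp]
  have h : c * Λ.x v ^ 2 + c * Λ.y v ^ 2 ≤ α * Λ.x v ^ 2 + β * Λ.y v ^ 2 := by gcongr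
  nlinarith [pi_pos]

lemma summable_theta (p : ℕ) {α β : ℝ} (hα : 0 < α) (hβ : 0 < β) :
    Summable fun v => (Λ.x v * Λ.y v) ^ p * rexp (-π * (α * Λ.x v ^ 2 + β * Λ.y v ^ 2)) := by
  refine Summable.of_norm_bounded
    (Λ.summable_xy_pow_mul_exp (mul_pos pi_pos (lt_min hα hβ)) p) fun v => ?_
  rw [norm_mul, norm_pow, Real.norm_eq_abs, Real.norm_of_nonneg (exp_pos _).le]
  exact mul_le_mul_of_nonneg_left (Λ.exp_diagonal_le (min_le_left _ _) (min_le_right _ _) v)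
    (by positivity)

/-- The theta series of the form `α x² + β y² + 2 c x y` on the lattice. -/
def mixedTheta (α β c : ℝ) : ℝ :=
  ∑' v, rexp (-π * (α * Λ.x v ^ 2 + β * Λ.y v ^ 2 + 2 * c * (Λ.x v * Λ.y v)))

lemma mixedTheta_eq (α β c : ℝ) : Λ.mixedTheta α β c =
    binaryTheta (α * Λ.a 0 ^ 2 + β * Λ.b 0 ^ 2 + 2 * c * (Λ.a 0 * Λ.b 0))
      (α * Λ.a 0 * Λ.a 1 + β * Λ.b 0 * Λ.b 1 + c * (Λ.a 0 * Λ.b 1 + Λ.a 1 * Λ.b 0))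
      (α * Λ.a 1 ^ 2 + β * Λ.b 1 ^ 2 + 2 * c * (Λ.a 1 * Λ.b 1)) := by
  refine tsum_congr fun v => ?_
  congr 1
  unfold x y
  ring

/-- In the lattice basis the form has determinant (αβ - c²)·covol², which is the D of the functional
equation for binary forms. -/
lemma mixedTheta_functional_equation {α β c D : ℝ} (hα : 0 < α)
    (hc : c ^ 2 < α * β) (hD : D = (α * β - c ^ 2) * Λ.covol ^ 2) :
    Λ.mixedTheta α β c = 1 / √D * Λ.mixedTheta (α / D) (β / D) (c / D) := by
  have hΔ := Λ.covol_pos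
  have hD0 : 0 < D := by rw [hD]; exact mul_pos (by linarith) (by positivity)
  have hab : 0 < Λ.a 1 ^ 2 + Λ.b 1 ^ 2 := by
    by_contra! h
    have h1 : Λ.a 1 = 0 := by nlinarith [sq_nonneg (Λ.a 1), sq_nonneg (Λ.b 1)]
    have h2 : Λ.b 1 = 0 := by nlinarith [sq_nonneg (Λ.a 1), sq_nonneg (Λ.b 1)]
    simp [covol, h1, h2] at hΔ
  have hβ : 0 < β := by
    by_contra! h
    nlinarith [sq_nonneg c, mul_nonneg (neg_nonneg.mpr h) hα.le]
  obtain ⟨m, hm, hle⟩ := exists_le_binaryForm (A := α) (B := c) hβ (by linarith)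
  rw [mixedTheta_eq, mixedTheta_eq, binaryTheta_functional_equation (D := D)]
  · congr 2 <;> ring
  · have := hle (Λ.a 1) (Λ.b 1)
    have := mul_pos hm hab
    linarith
  · exact hD0
  · rw [hD]; unfold covol; ring

lemma theta_zero (α β : ℝ) : Λ.theta 0 α β = Λ.mixedTheta α β 0 := by
  refine tsum_congr fun v => ?_
  simp

/-- Differentiation in the mixed coefficient brings down the factor -2πxy. The correction μc² of the
first coefficient is of second order and does not contribute at c = 0; it is there so that μ can
later be chosen to keep the determinant constant. -/
lemma hasDerivAt_mixedTheta {α β μ : ℝ} (hα : 0 < α) (hβ : 0 < β) (hμ : 0 ≤ μ) :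
    HasDerivAt (fun c => Λ.mixedTheta (α + μ * c ^ 2) β c) (-(2 * π) * Λ.theta 1 α β) 0 := by
  set m := min α β with hm
  have hm0 : 0 < m := lt_min hα hβ
  have key := hasDerivAt_tsum_of_isPreconnected
    (u := fun v => π * (2 * μ * (m / 2) + 2) * ((Λ.x v ^ 2 + Λ.y v ^ 2) ^ 1 *
      rexp (-(π * (m / 2)) * (Λ.x v ^ 2 + Λ.y v ^ 2))))
    (g := fun v c => rexp (-π * ((α + μ * c ^ 2) * Λ.x v ^ 2 + β * Λ.y v ^ 2 +
      2 * c * (Λ.x v * Λ.y v))))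
    (g' := fun v c => rexp (-π * ((α + μ * c ^ 2) * Λ.x v ^ 2 + β * Λ.y v ^ 2 +
      2 * c * (Λ.x v * Λ.y v))) * (-π * (2 * μ * c * Λ.x v ^ 2 + 2 * (Λ.x v * Λ.y v))))
    (t := Set.Ioo (-(m / 2)) (m / 2)) (y₀ := 0) (y := 0)
    ((Λ.summable_norm_pow_mul_exp (c := π * (m / 2)) (by positivity) 1).mul_left _)
    isOpen_Ioo isPreconnected_Ioo ?_ ?_ ⟨by linarith, by linarith⟩ ?_ ⟨by linarith, by linarith⟩
  · refine key.congr_deriv ?_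
    rw [theta, ← tsum_mul_left]
    refine tsum_congr fun v => ?_
    simp
    ring
  · intro v c _
    refine HasDerivAt.exp ?_
    have h := (((((((hasDerivAt_id c).pow 2).const_mul μ).const_add α).mul_const
      (Λ.x v ^ 2)).add_const (β * Λ.y v ^ 2)).add
        (((hasDerivAt_id c).const_mul 2).mul_const (Λ.x v * Λ.y v))).const_mul (-π)
    refine h.congr_deriv ?_
    simp only [id, Nat.cast_ofNat, Nat.add_one_sub_one]
    ring
  · intro v c hc
    have hc' : |c| ≤ m / 2 := abs_le.mpr ⟨hc.1.le, hc.2.le⟩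
    rw [norm_mul, Real.norm_of_nonneg (exp_pos _).le, norm_mul, norm_neg,
      Real.norm_of_nonneg pi_pos.le, Real.norm_eq_abs, pow_one]
    have h1 : rexp (-π * ((α + μ * c ^ 2) * Λ.x v ^ 2 + β * Λ.y v ^ 2 +
        2 * c * (Λ.x v * Λ.y v))) ≤ rexp (-(π * (m / 2)) * (Λ.x v ^ 2 + Λ.y v ^ 2)) := by
      rw [Real.exp_le_exp]
      have h2 : m * Λ.x v ^ 2 + m * Λ.y v ^ 2 ≤ α * Λ.x v ^ 2 + β * Λ.y v ^ 2 :=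
        add_le_add (mul_le_mul_of_nonneg_right (min_le_left _ _) (sq_nonneg _))
          (mul_le_mul_of_nonneg_right (min_le_right _ _) (sq_nonneg _))
      -- For |c| < m/2 the mixed term costs at most half of the lower bound m of the diagonal form.
      -- The remaining m/2 gives a majorant independent of c.
      have h3 : -(m / 2) * (Λ.x v ^ 2 + Λ.y v ^ 2) ≤ 2 * c * (Λ.x v * Λ.y v) := by
        nlinarith [mul_nonneg (sub_nonneg.mpr hc.2.le) (sq_nonneg (Λ.x v - Λ.y v)),
          mul_nonneg (neg_le_iff_add_nonneg.mp hc.1.le) (sq_nonneg (Λ.x v + Λ.y v))]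
      have h4 : 0 ≤ μ * c ^ 2 * Λ.x v ^ 2 := by positivity
      have h5 : m / 2 * (Λ.x v ^ 2 + Λ.y v ^ 2) ≤ (α + μ * c ^ 2) * Λ.x v ^ 2 +
        β * Λ.y v ^ 2 + 2 * c * (Λ.x v * Λ.y v) := by linarith
      have := mul_le_mul_of_nonneg_left h5 pi_pos.le
      linarith
    have h6 : |2 * μ * c * Λ.x v ^ 2 + 2 * (Λ.x v * Λ.y v)| ≤
        (2 * μ * (m / 2) + 2) * (Λ.x v ^ 2 + Λ.y v ^ 2) := by
      calc _ ≤ |2 * μ * c * Λ.x v ^ 2| + |2 * (Λ.x v * Λ.y v)| := abs_add_le _ _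
        _ = 2 * μ * |c| * Λ.x v ^ 2 + 2 * |Λ.x v * Λ.y v| := by
          rw [abs_mul, abs_mul, abs_mul, abs_mul 2, abs_of_pos (two_pos (α := ℝ)),
            abs_of_nonneg hμ, abs_of_nonneg (sq_nonneg (Λ.x v))]
        _ ≤ 2 * μ * (m / 2) * (Λ.x v ^ 2 + Λ.y v ^ 2) + 2 * (Λ.x v ^ 2 + Λ.y v ^ 2) := by
          have := Λ.abs_xy_le v
          gcongr
          linarith [sq_nonneg (Λ.y v)]
        _ = _ := by ring
    calc _ ≤ rexp (-(π * (m / 2)) * (Λ.x v ^ 2 + Λ.y v ^ 2)) *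
          (π * ((2 * μ * (m / 2) + 2) * (Λ.x v ^ 2 + Λ.y v ^ 2))) := by gcongr
      _ = _ := by ring
  · refine (Λ.summable_theta 0 hα hβ).congr fun v => ?_
    simp

/-- The case p = 1 is obtained from the mixed theta series by differentiation at c = 0. With μ = 1/β
the determinant (α + μc²)β - c² does not depend on c, so D is constant along the curve. On the other
side the coefficient is c/D, and the chain rule yields the additional factor 1/D. -/
theorem theta_functional_equation {p : ℕ} (hp : p ≤ 1) {α β D : ℝ} (hα : 0 < α) (hβ : 0 < β)
    (hD : D = α * β * Λ.covol ^ 2) :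
    Λ.theta p α β = 1 / (√D * D ^ p) * Λ.theta p (α / D) (β / D) := by
  have hΔ := Λ.covol_pos
  have hD0 : 0 < D := by rw [hD]; positivity
  interval_cases p
  · rw [theta_zero, theta_zero, Λ.mixedTheta_functional_equation (c := 0) (D := D) hα
      (by simpa using mul_pos hα hβ) (by rw [hD]; ring)]
    simp
  · -- compare derivatives with respect to the mixed coefficient, at constant discriminant
    have h1 := Λ.hasDerivAt_mixedTheta hα hβ (inv_pos.mpr hβ).le
    have h2 := Λ.hasDerivAt_mixedTheta (div_pos hα hD0) (div_pos hβ hD0)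
      (mul_pos (inv_pos.mpr hβ) hD0).le
    have hlin : HasDerivAt (fun c : ℝ => c / D) (1 / D) 0 := (hasDerivAt_id (0 : ℝ)).div_const D
    have h3 := (HasDerivAt.comp (0 : ℝ) (by simpa using h2) hlin).const_mul (1 / √D)
    have e : (fun c => Λ.mixedTheta (α + β⁻¹ * c ^ 2) β c) = fun c => 1 / √D *
        ((fun c => Λ.mixedTheta (α / D + β⁻¹ * D * c ^ 2) (β / D) c) ∘ fun c => c / D) c := by
      funext c
      rw [Λ.mixedTheta_functional_equation (D := D) (by positivity)]
      · simp only [Function.comp_apply]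
        congr 2
        field_simp
      · have : (α + β⁻¹ * c ^ 2) * β = α * β + c ^ 2 := by field_simp
        rw [this]
        linarith [mul_pos hα hβ]
      · rw [hD]
        field_simp
        ring
    rw [e] at h1
    have h4 := h1.unique h3
    have h5 : (2 * π) ≠ 0 := by positivity
    apply mul_left_cancel₀ (neg_ne_zero.mpr h5)
    rw [h4]
    field_simp

end HyperbolicLattice
end HeckeCycle

namespace HeckeCycle

open Real MeasureTheory

/-! ## The Mellin transform of a Bessel function -/

/-- `e^{Lr} + e^{-Lr}`. -/
def twoCosh (L r : ℝ) : ℝ := rexp (L * r) + rexp (-(L * r))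

lemma twoCosh_pos (L r : ℝ) : 0 < twoCosh L r := by unfold twoCosh; positivity

lemma continuous_twoCosh (L : ℝ) : Continuous (twoCosh L) := by unfold twoCosh; fun_prop

/-- The sigmoid at 2Lr is e^{Lr}/(e^{Lr} + e^{-Lr}), and its complement is e^{-Lr} over the same
denominator. -/
lemma sigmoid_mul_one_sub (L r : ℝ) :
    sigmoid (2 * L * r) * (1 - sigmoid (2 * L * r)) = (twoCosh L r ^ 2)⁻¹ := by
  have e : rexp (-(2 * L * r)) = rexp (-(L * r)) * rexp (-(L * r)) := by
    rw [← Real.exp_add]; ring_nf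
  have e1 : rexp (L * r) * rexp (-(L * r)) = 1 := by rw [← Real.exp_add]; simp
  have h0 : 1 + rexp (-(2 * L * r)) ≠ 0 := by positivity
  have h2 := (twoCosh_pos L r).ne'
  rw [sigmoid_def]
  have h3 : 1 + rexp (-(2 * L * r)) = twoCosh L r * rexp (-(L * r)) := by
    rw [e, twoCosh, add_mul, e1]
  have h4 := (Real.exp_pos (-(L * r))).ne'
  rw [h3]
  field_simp
  unfold twoCosh
  linear_combination e1

lemma ofReal_cpow_eq_exp {y : ℝ} (hy : 0 < y) (z : ℂ) :
    (y : ℂ) ^ z = Complex.exp (Real.log y * z) := by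
  rw [Complex.cpow_def_of_ne_zero (by exact_mod_cast hy.ne'), Complex.ofReal_log hy.le]

/-- Substitute u = sigmoid(2Lr): then du = 2L u(1 - u) dr and (u(1 - u))^(s/2) = (e^{Lr} +
e^{-Lr})^(-s), and the line becomes the unit interval. -/
lemma integral_twoCosh_cpow {L : ℝ} (hL : 0 < L) {s : ℂ} (hs : 0 < s.re) :
    Integrable (fun r : ℝ => (twoCosh L r : ℂ) ^ (-s)) ∧
      ∫ r : ℝ, (twoCosh L r : ℂ) ^ (-s) = 1 / (2 * L) * Complex.betaIntegral (s / 2) (s / 2) := by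
  have hs2 : 0 < (s / 2).re := by
    rw [Complex.div_ofNat_re]; positivity
  set g : ℝ → ℂ := fun x => (x : ℂ) ^ (s / 2 - 1) * (1 - (x : ℂ)) ^ (s / 2 - 1) with hg
  set f : ℝ → ℝ := fun r => sigmoid (2 * L * r) with hf
  have hinj : Set.InjOn f Set.univ := fun r _ r' _ h => by
    have := sigmoid_injective h
    have hL2 : (2 * L) ≠ 0 := by positivity
    exact mul_left_cancel₀ hL2 this
  have himage : f '' Set.univ = Set.Ioo 0 1 := by
    rw [← range_sigmoid, Set.image_univ]
    ext x
    simp only [Set.mem_range, hf]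
    refine ⟨fun ⟨r, hr⟩ => ⟨_, hr⟩, fun ⟨r, hr⟩ => ⟨r / (2 * L), ?_⟩⟩
    rw [← hr]; congr 1; field_simp
  have hderiv : ∀ r ∈ Set.univ, HasDerivWithinAt f (2 * L * (twoCosh L r ^ 2)⁻¹) Set.univ r := by
    intro r _
    rw [← sigmoid_mul_one_sub]
    have h := (hasDerivAt_sigmoid (2 * L * r)).comp r ((hasDerivAt_id r).const_mul (2 * L))
    refine (h.congr_deriv ?_).hasDerivWithinAt
    simp; ring
  have hcomp : ∀ r, |2 * L * (twoCosh L r ^ 2)⁻¹| • g (f r) =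
      (2 * L : ℂ) * (twoCosh L r : ℂ) ^ (-s) := by
    intro r
    have hc := twoCosh_pos L r
    have hsm := sigmoid_mul_one_sub L r
    have h0 := sigmoid_pos (2 * L * r)
    have h1 : 0 < 1 - sigmoid (2 * L * r) := sub_pos.mpr (sigmoid_lt_one _)
    have hg' : g (f r) = ((twoCosh L r ^ 2)⁻¹ : ℝ) ^ (s / 2 - 1) := by
      rw [← hsm, Complex.ofReal_mul, Complex.mul_cpow_ofReal_nonneg h0.le h1.le, hg]
      simp [hf]
    have hcc : (twoCosh L r : ℂ) ≠ 0 := by exact_mod_cast hc.ne'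
    rw [abs_of_pos (by positivity), hg', Complex.real_smul, Complex.ofReal_inv,
      ← Complex.ofReal_inv, Complex.ofReal_mul, mul_assoc]
    push_cast
    congr 1
    have h2 : (((twoCosh L r : ℂ) ^ 2)⁻¹) ≠ 0 := by positivity
    rw [Complex.cpow_sub _ _ h2, Complex.cpow_one, mul_div_cancel₀ _ h2]
    have h3 : ((twoCosh L r : ℂ) ^ 2)⁻¹ = (((twoCosh L r ^ 2)⁻¹ : ℝ) : ℂ) := by push_cast; rfl
    rw [h3, ofReal_cpow_eq_exp (by positivity), ofReal_cpow_eq_exp hc, Real.log_inv, Real.log_pow]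
    congr 1
    push_cast
    ring
  have hLc : (2 * L : ℂ) ≠ 0 := by exact_mod_cast (by positivity : (2 * L) ≠ 0)
  constructor
  · have hb := (intervalIntegrable_iff_integrableOn_Ioo_of_le zero_le_one).mp
      (Complex.betaIntegral_convergent hs2 hs2)
    rw [← himage, integrableOn_image_iff_integrableOn_abs_deriv_smul MeasurableSet.univ hderiv hinj,
      integrableOn_univ] at hb
    have h := (hb.congr (Filter.Eventually.of_forall hcomp)).const_mul (2 * L : ℂ)⁻¹
    refine h.congr (Filter.Eventually.of_forall fun r => ?_)
    simp only
    rw [inv_mul_cancel_left₀ hLc]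
  · rw [Complex.betaIntegral, intervalIntegral.integral_of_le zero_le_one,
      integral_Ioc_eq_integral_Ioo, ← himage,
      integral_image_eq_integral_abs_deriv_smul MeasurableSet.univ hderiv hinj,
      setIntegral_univ, integral_congr_ae (Filter.Eventually.of_forall hcomp),
      integral_const_mul, one_div, inv_mul_cancel_left₀ hLc]

/-- `κ(y) = ∫ exp (-π y (e^{Lr} + e^{-Lr})) dr`, a multiple of the Bessel function `K₀(2πy)`. -/
def bessel (L y : ℝ) : ℝ := ∫ r : ℝ, rexp (-(π * twoCosh L r * y))

lemma bessel_nonneg (L y : ℝ) : 0 ≤ bessel L y := integral_nonneg fun _ => (Real.exp_pos _).le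

/-- Absolute convergence for Fubini: the integral of the norm over y is a constant times (e^{Lr} +
e^{-Lr})^(-Re s), which is integrable in r. -/
lemma integrable_bessel_integrand {L : ℝ} (hL : 0 < L) {s : ℂ} (hs : 0 < s.re) :
    Integrable (Function.uncurry fun (r y : ℝ) =>
      (y : ℂ) ^ (s - 1) * Complex.exp (-((π * twoCosh L r : ℝ) * y : ℂ)))
      (volume.prod (volume.restrict (Set.Ioi 0))) := by
  have hm : ∀ r, 0 < π * twoCosh L r := fun r => mul_pos pi_pos (twoCosh_pos L r)
  have hnorm : ∀ r : ℝ, ∀ y ∈ Set.Ioi (0 : ℝ),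
      ‖(y : ℂ) ^ (s - 1) * Complex.exp (-((π * twoCosh L r : ℝ) * y : ℂ))‖ =
        y ^ (s.re - 1) * rexp (-(π * twoCosh L r * y)) := by
    intro r y hy
    rw [norm_mul, Complex.norm_cpow_eq_rpow_re_of_pos hy, Complex.norm_exp, Complex.sub_re,
      Complex.one_re]
    congr 2
    rw [← Complex.ofReal_mul, ← Complex.ofReal_neg, Complex.ofReal_re]
  have hmeas : AEStronglyMeasurable (Function.uncurry fun (r y : ℝ) =>
      (y : ℂ) ^ (s - 1) * Complex.exp (-((π * twoCosh L r : ℝ) * y : ℂ)))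
      ((volume : Measure ℝ).prod (volume.restrict (Set.Ioi 0))) := by
    have hc := continuous_twoCosh L
    have h1 : Measurable fun q : ℝ × ℝ => (q.2 : ℂ) ^ (s - 1) :=
      (Complex.measurable_ofReal.comp measurable_snd).pow_const _
    have h2 : Continuous fun q : ℝ × ℝ => Complex.exp (-((π * twoCosh L q.1 : ℝ) * q.2 : ℂ)) := by
      fun_prop
    exact (h1.mul h2.measurable).aestronglyMeasurable
  have hreal : ∀ r : ℝ, IntegrableOn (fun y : ℝ => y ^ (s.re - 1) *
      rexp (-(π * twoCosh L r * y))) (Set.Ioi 0) := by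
    intro r
    have h := integrableOn_rpow_mul_exp_neg_mul_rpow (p := 1) (s := s.re - 1)
      (b := π * twoCosh L r) (by linarith) one_pos (hm r)
    simpa using h
  rw [integrable_prod_iff hmeas]
  constructor
  · filter_upwards [hmeas.prodMk_left] with r hr
    refine (integrable_norm_iff hr).mp ?_
    exact (hreal r).congr_fun (fun y hy => (hnorm r y hy).symm) measurableSet_Ioi
  · have h := (integral_twoCosh_cpow hL (s := s.re) (by simpa using hs)).1.norm
    refine (h.const_mul ((1 / π) ^ s.re * Real.Gamma s.re)).congr
      (Filter.Eventually.of_forall fun r => ?_)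
    simp only [Function.uncurry_apply_pair]
    rw [setIntegral_congr_fun measurableSet_Ioi (hnorm r),
      Real.integral_rpow_mul_exp_neg_mul_Ioi hs (hm r),
      Complex.norm_cpow_eq_rpow_re_of_pos (twoCosh_pos L r), Complex.neg_re, Complex.ofReal_re,
      ← div_div, Real.div_rpow (by positivity) (twoCosh_pos L r).le,
      Real.rpow_neg (twoCosh_pos L r).le]
    ring

/-- The Mellin transform of `κ`. -/
theorem hasMellin_bessel {L : ℝ} (hL : 0 < L) {s : ℂ} (hs : 0 < s.re) :
    HasMellin (fun y => (bessel L y : ℂ)) s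
      ((π : ℂ) ^ (-s) * Complex.Gamma (s / 2) ^ 2 / (2 * L)) := by
  have hI := integrable_bessel_integrand hL hs
  have hs2 : 0 < (s / 2).re := by
    rw [Complex.div_ofNat_re]; positivity
  have e : ∀ y : ℝ, (∫ r : ℝ, (y : ℂ) ^ (s - 1) *
      Complex.exp (-((π * twoCosh L r : ℝ) * y : ℂ))) = (y : ℂ) ^ (s - 1) • (bessel L y : ℂ) := by
    intro y
    rw [integral_const_mul, smul_eq_mul, bessel, ← integral_complex_ofReal]
    congr 1
    refine integral_congr_ae (Filter.Eventually.of_forall fun r => ?_)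
    push_cast
    rfl
  constructor
  · have h := hI.integral_prod_right
    exact h.congr (Filter.Eventually.of_forall e)
  · rw [mellin, ← setIntegral_congr_fun measurableSet_Ioi (fun y _ => e y),
      ← integral_integral_swap hI]
    -- After the exchange the y-integral is a gamma integral. The r-integral that remains is B(s/2,
    -- s/2)/(2L), and Γ(s)B(s/2, s/2) = Γ(s/2)².
    have h1 : ∀ r : ℝ, (∫ y in Set.Ioi (0 : ℝ), (y : ℂ) ^ (s - 1) *
        Complex.exp (-((π * twoCosh L r : ℝ) * y : ℂ))) =
        (π : ℂ) ^ (-s) * Complex.Gamma s * (twoCosh L r : ℂ) ^ (-s) := by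
      intro r
      have hc := twoCosh_pos L r
      rw [Complex.integral_cpow_mul_exp_neg_mul_Ioi hs (mul_pos pi_pos hc), one_div,
        ← Complex.ofReal_inv, ofReal_cpow_eq_exp (by positivity), ofReal_cpow_eq_exp hc,
        ofReal_cpow_eq_exp pi_pos, Real.log_inv, Real.log_mul pi_pos.ne' hc.ne']
      push_cast
      rw [mul_right_comm, ← Complex.exp_add]
      congr 2
      ring
    rw [integral_congr_ae (Filter.Eventually.of_forall h1), integral_const_mul,
      (integral_twoCosh_cpow hL hs).2]
    have h2 := Complex.Gamma_mul_Gamma_eq_betaIntegral hs2 hs2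
    rw [add_halves] at h2
    rw [pow_two, h2]
    ring

end HeckeCycle

namespace HeckeCycle

namespace HyperbolicLattice

open Real MeasureTheory Filter

variable (Λ : HyperbolicLattice)

/-! ## Theta integrals over closed geodesics -/

/-- The length of the closed geodesic. -/
def length : ℝ := 2 * Real.log Λ.ε

lemma length_pos : 0 < Λ.length := mul_pos two_pos (Real.log_pos Λ.one_lt)

lemma exp_length : rexp Λ.length = Λ.ε ^ 2 := by
  rw [length, two_mul, Real.exp_add, Real.exp_log Λ.ε_pos, pow_two]

/-- The theta series along the closed geodesic. -/
def geodesicTheta (p : ℕ) (t r : ℝ) : ℝ :=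
  Λ.theta p (t * rexp (Λ.length * r) / Λ.covol) (t * rexp (-(Λ.length * r)) / Λ.covol)

/-- The integral of the theta series over the closed geodesic. -/
def thetaIntegral (p : ℕ) (t : ℝ) : ℝ := ∫ r in (0 : ℝ)..1, Λ.geodesicTheta p t r

/-- At 1/t the product of the two parameters times covol² is (1/t)², whatever r is. So the theta
functional equation fixes the point r of the geodesic and inverts only t. -/
lemma geodesicTheta_inv {p : ℕ} (hp : p ≤ 1) {t : ℝ} (ht : 0 < t) (r : ℝ) :
    Λ.geodesicTheta p (1 / t) r = t ^ (1 + 2 * p) * Λ.geodesicTheta p t r := by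
  have hΔ := Λ.covol_pos
  have e1 : rexp (Λ.length * r) * rexp (-(Λ.length * r)) = 1 := by rw [← Real.exp_add]; simp
  unfold geodesicTheta
  rw [Λ.theta_functional_equation hp (D := (1 / t) ^ 2) (by positivity) (by positivity),
    Real.sqrt_sq (by positivity)]
  · have h1 : 1 / (1 / t * ((1 / t) ^ 2) ^ p) = t ^ (1 + 2 * p) := by
      rw [← pow_mul, ← pow_succ', one_div_pow, one_div_one_div, add_comm 1]
    rw [h1]
    congr 2 <;> field_simp
  · field_simp
    linear_combination -e1

lemma thetaIntegral_inv {p : ℕ} (hp : p ≤ 1) {t : ℝ} (ht : 0 < t) :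
    Λ.thetaIntegral p (1 / t) = t ^ (1 + 2 * p) * Λ.thetaIntegral p t := by
  unfold thetaIntegral
  simp_rw [Λ.geodesicTheta_inv hp ht]
  rw [intervalIntegral.integral_const_mul]

lemma continuousOn_theta (p : ℕ) :
    ContinuousOn (fun q : ℝ × ℝ => Λ.theta p q.1 q.2) (Set.Ioi 0 ×ˢ Set.Ioi 0) := by
  intro q hq
  obtain ⟨h1, h2⟩ := hq
  rw [Set.mem_Ioi] at h1 h2
  set c := min q.1 q.2 / 2 with hc
  have hm : 0 < min q.1 q.2 := lt_min h1 h2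
  have hc0 : 0 < c := half_pos hm
  have hcon : ContinuousOn (fun q : ℝ × ℝ => Λ.theta p q.1 q.2) (Set.Ioi c ×ˢ Set.Ioi c) := by
    refine continuousOn_tsum (fun v => by fun_prop)
      (Λ.summable_xy_pow_mul_exp (mul_pos pi_pos hc0) p) fun v q hq => ?_
    rw [norm_mul, norm_pow, Real.norm_eq_abs, Real.norm_of_nonneg (exp_pos _).le]
    exact mul_le_mul_of_nonneg_left (Λ.exp_diagonal_le (le_of_lt hq.1) (le_of_lt hq.2) v)
      (by positivity)
  refine (hcon.continuousAt ?_).continuousWithinAt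
  refine (isOpen_Ioi.prod isOpen_Ioi).mem_nhds ⟨?_, ?_⟩
  · have := min_le_left q.1 q.2
    rw [Set.mem_Ioi]; linarith
  · have := min_le_right q.1 q.2
    rw [Set.mem_Ioi]; linarith

lemma continuous_geodesicTheta (p : ℕ) :
    Continuous fun q : ℝ × ℝ => Λ.geodesicTheta p (rexp q.1) q.2 := by
  have hΔ := Λ.covol_pos
  refine (Λ.continuousOn_theta p).comp_continuous
    (f := fun q : ℝ × ℝ => (rexp q.1 * rexp (Λ.length * q.2) / Λ.covol,
      rexp q.1 * rexp (-(Λ.length * q.2)) / Λ.covol)) (by fun_prop) fun q => ⟨?_, ?_⟩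
  · rw [Set.mem_Ioi]; positivity
  · rw [Set.mem_Ioi]; positivity

lemma continuous_geodesicTheta_right (p : ℕ) {t : ℝ} (ht : 0 < t) :
    Continuous fun r => Λ.geodesicTheta p t r := by
  have h := (Λ.continuous_geodesicTheta p).comp (Continuous.prodMk_right (Real.log t))
  simpa [Function.comp_def, Real.exp_log ht] using h

lemma continuousOn_thetaIntegral (p : ℕ) : ContinuousOn (Λ.thetaIntegral p) (Set.Ioi 0) := by
  -- In the variable log t the integrand is continuous on the whole plane, as the theorem on
  -- parametric integrals requires.
  have h : Continuous fun w => Λ.thetaIntegral p (rexp w) :=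
    intervalIntegral.continuous_parametric_intervalIntegral_of_continuous'
      (f := fun w r => Λ.geodesicTheta p (rexp w) r) (Λ.continuous_geodesicTheta p) 0 1
  refine (h.comp_continuousOn (Real.continuousOn_log.mono fun t ht => ?_)).congr fun t ht => ?_
  · exact ne_of_gt ht
  · simp only [Function.comp_apply]
    rw [Real.exp_log ht]

/-- The summand of the theta series along the closed geodesic. -/
def geodesicTerm (p : ℕ) (v : Fin 2 → ℤ) (t r : ℝ) : ℝ :=
  (Λ.x v * Λ.y v) ^ p * rexp (-π * (t * rexp (Λ.length * r) / Λ.covol * Λ.x v ^ 2 +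
    t * rexp (-(Λ.length * r)) / Λ.covol * Λ.y v ^ 2))

lemma continuous_geodesicTerm (p : ℕ) (v : Fin 2 → ℤ) (t : ℝ) :
    Continuous (Λ.geodesicTerm p v t) := by
  unfold geodesicTerm
  fun_prop

/-- Since 0^0 = 1 and 0^1 = 0, the expression 0^p is the term of the zero vector for both values of
p that matter. The same convention describes the constant terms of `fePair`. -/
lemma geodesicTheta_sub (p : ℕ) {t : ℝ} (ht : 0 < t) (r : ℝ) :
    Λ.geodesicTheta p t r - 0 ^ p = ∑' v : {v : Fin 2 → ℤ // v ≠ 0}, Λ.geodesicTerm p v t r := by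
  have hΔ := Λ.covol_pos
  have hs := Λ.summable_theta p (α := t * rexp (Λ.length * r) / Λ.covol)
    (β := t * rexp (-(Λ.length * r)) / Λ.covol) (by positivity) (by positivity)
  have h := hs.tsum_subtype_add_tsum_subtype_compl {0}
  rw [tsum_singleton (0 : Fin 2 → ℤ)
    (f := fun v => (Λ.x v * Λ.y v) ^ p * rexp (-π * (t * rexp (Λ.length * r) / Λ.covol *
      Λ.x v ^ 2 + t * rexp (-(Λ.length * r)) / Λ.covol * Λ.y v ^ 2)))] at h
  rw [geodesicTheta, theta, ← h]
  simp only [x_zero, y_zero, mul_zero, ne_eq, OfNat.ofNat_ne_zero, not_false_eq_true, zero_pow,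
    add_zero, Real.exp_zero, mul_one, add_sub_cancel_left]
  rfl

/-- A lower bound of `e^{±Lr}/Δ` for `r ∈ [0, 1]`. -/
def lowerScale : ℝ := rexp (-Λ.length) / Λ.covol

lemma lowerScale_pos : 0 < Λ.lowerScale := div_pos (Real.exp_pos _) Λ.covol_pos

lemma norm_geodesicTerm_le (p : ℕ) (v : Fin 2 → ℤ) {t r : ℝ} (ht : 0 ≤ t)
    (hr : r ∈ Set.Icc (0 : ℝ) 1) : ‖Λ.geodesicTerm p v t r‖ ≤
      |Λ.x v * Λ.y v| ^ p * rexp (-(π * (t * Λ.lowerScale)) * (Λ.x v ^ 2 + Λ.y v ^ 2)) := by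
  have hL := Λ.length_pos
  have hΔ := Λ.covol_pos
  rw [geodesicTerm, norm_mul, norm_pow, Real.norm_eq_abs, Real.norm_of_nonneg (exp_pos _).le]
  refine mul_le_mul_of_nonneg_left (Λ.exp_diagonal_le ?_ ?_ v) (by positivity)
  · rw [lowerScale, mul_div_assoc]
    gcongr
    nlinarith [hr.1]
  · rw [lowerScale, mul_div_assoc]
    gcongr
    nlinarith [hr.2]

lemma thetaIntegral_sub (p : ℕ) {t : ℝ} (ht : 0 < t) : Λ.thetaIntegral p t - 0 ^ p =
    ∫ r in (0 : ℝ)..1, (Λ.geodesicTheta p t r - 0 ^ p) := by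
  rw [intervalIntegral.integral_sub
    ((Λ.continuous_geodesicTheta_right p ht).intervalIntegrable _ _) intervalIntegrable_const,
    thetaIntegral]
  simp

/-- Nonzero lattice vectors have x² + y² bounded below, so each term decays exponentially in t at a
common rate, uniformly over the segment 0 ≤ r ≤ 1. -/
lemma exists_thetaIntegral_sub_le (p : ℕ) : ∃ c C, 0 < c ∧ ∀ t, 1 ≤ t →
    ‖Λ.thetaIntegral p t - 0 ^ p‖ ≤ C * rexp (-c * t) := by
  obtain ⟨c₁, hc₁, h₁⟩ := Λ.exists_sqNorm_le
  have hb := Λ.lowerScale_pos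
  have hs := Λ.summable_xy_pow_mul_exp (mul_pos pi_pos hb) p
  -- Write t = 1 + (t - 1): the part t - 1 gives the decay e^{-c(t-1)} through x² + y² ≥ c₁, and the
  -- part 1 leaves the convergent series at t = 1. This explains the factor e^c below.
  set c := π * Λ.lowerScale * c₁ with hc
  refine ⟨c, rexp c * ∑' v, |Λ.x v * Λ.y v| ^ p *
    rexp (-(π * Λ.lowerScale) * (Λ.x v ^ 2 + Λ.y v ^ 2)), by positivity, fun t ht => ?_⟩
  have ht0 : 0 < t := one_pos.trans_le ht
  rw [Λ.thetaIntegral_sub p ht0]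
  have key : ∀ r ∈ Set.Icc (0 : ℝ) 1, ‖Λ.geodesicTheta p t r - 0 ^ p‖ ≤
      rexp c * (∑' v, |Λ.x v * Λ.y v| ^ p *
        rexp (-(π * Λ.lowerScale) * (Λ.x v ^ 2 + Λ.y v ^ 2))) * rexp (-c * t) := by
    intro r hr
    rw [Λ.geodesicTheta_sub p ht0]
    have hle : ∀ v : {v : Fin 2 → ℤ // v ≠ 0}, ‖Λ.geodesicTerm p v t r‖ ≤
        rexp c * rexp (-c * t) * (|Λ.x v * Λ.y v| ^ p *
          rexp (-(π * Λ.lowerScale) * (Λ.x v ^ 2 + Λ.y v ^ 2))) := by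
      rintro ⟨v, hv⟩
      refine (Λ.norm_geodesicTerm_le p v ht0.le hr).trans ?_
      rw [mul_left_comm (rexp c * rexp (-c * t)), ← Real.exp_add, ← Real.exp_add]
      refine mul_le_mul_of_nonneg_left (Real.exp_le_exp.mpr ?_) (by positivity)
      have h2 : c₁ ≤ Λ.x v ^ 2 + Λ.y v ^ 2 :=
        (le_mul_of_one_le_right hc₁.le (one_le_sqNorm hv)).trans (h₁ v)
      have h3 : 0 ≤ (π * Λ.lowerScale * (t - 1)) * (Λ.x v ^ 2 + Λ.y v ^ 2 - c₁) :=
        mul_nonneg (mul_nonneg (by positivity) (by linarith)) (by linarith)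
      rw [hc]
      nlinarith
    have hs' := (hs.subtype {v | v ≠ 0}).mul_left (rexp c * rexp (-c * t))
    refine (tsum_of_norm_bounded hs'.hasSum hle).trans ?_
    rw [tsum_mul_left, mul_right_comm]
    gcongr
    exact hs.tsum_subtype_le _ _ (fun v => mul_nonneg (pow_nonneg (abs_nonneg _) _) (exp_pos _).le)
  have h := intervalIntegral.norm_integral_le_of_norm_le_const (a := (0 : ℝ)) (b := 1)
    (f := fun r => Λ.geodesicTheta p t r - 0 ^ p) (fun r hr => key r ?_)
  · simpa using h
  · rw [Set.uIoc_of_le zero_le_one] at hr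
    exact ⟨hr.1.le, hr.2⟩

lemma isBigO_thetaIntegral (p : ℕ) (r : ℝ) :
    (fun t => (Λ.thetaIntegral p t : ℂ) - 0 ^ p) =O[atTop] (· ^ r) := by
  obtain ⟨c, C, hc, h⟩ := Λ.exists_thetaIntegral_sub_le p
  have h1 : (fun t => (Λ.thetaIntegral p t : ℂ) - 0 ^ p) =O[atTop] fun t => rexp (-c * t) := by
    refine Asymptotics.IsBigO.of_bound C ?_
    filter_upwards [eventually_ge_atTop 1] with t ht
    have := h t ht
    rw [Real.norm_of_nonneg (exp_pos _).le]
    refine le_trans (le_of_eq ?_) this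
    rw [← Complex.norm_real]
    push_cast
    rfl
  exact h1.trans (isLittleO_exp_neg_mul_rpow_atTop hc r).isBigO

/-- The functional equation of the theta integral. -/
def fePair {p : ℕ} (hp : p ≤ 1) : WeakFEPair ℂ where
  f t := Λ.thetaIntegral p t
  g t := Λ.thetaIntegral p t
  k := 1 + 2 * p
  ε := 1
  f₀ := 0 ^ p
  g₀ := 0 ^ p
  hf_int := (Complex.continuous_ofReal.comp_continuousOn
    (Λ.continuousOn_thetaIntegral p)).locallyIntegrableOn measurableSet_Ioi
  hg_int := (Complex.continuous_ofReal.comp_continuousOn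
    (Λ.continuousOn_thetaIntegral p)).locallyIntegrableOn measurableSet_Ioi
  hk := by positivity
  hε := one_ne_zero
  h_feq t ht := by
    rw [Λ.thetaIntegral_inv hp ht, one_mul, smul_eq_mul, Complex.ofReal_mul]
    congr 2
    rw [← Real.rpow_natCast]
    push_cast
    rfl
  hf_top := Λ.isBigO_thetaIntegral p
  hg_top := Λ.isBigO_thetaIntegral p

end HyperbolicLattice
end HeckeCycle

namespace HeckeCycle

open Real MeasureTheory Filter

/-- Because e^{-u} ≤ 1/u, it is enough that the reciprocal of e^{Lr} + e^{-Lr} is integrable. -/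
lemma integrable_exp_neg_twoCosh {L : ℝ} (hL : 0 < L) {y : ℝ} (hy : 0 < y) :
    Integrable fun r : ℝ => rexp (-(π * twoCosh L r * y)) := by
  have h := (integral_twoCosh_cpow hL (s := 1) (by simp)).1.norm
  have hc := continuous_twoCosh L
  refine (h.const_mul (π * y)⁻¹).mono' (by fun_prop) (Eventually.of_forall fun r => ?_)
  have hr := twoCosh_pos L r
  have h1 : 0 < π * twoCosh L r * y := by positivity
  rw [Real.norm_of_nonneg (exp_pos _).le, Complex.norm_cpow_eq_rpow_re_of_pos hr,
    Complex.neg_re, Complex.one_re, Real.rpow_neg_one, ← mul_inv, Real.exp_neg]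
  gcongr
  have := Real.add_one_le_exp (π * twoCosh L r * y)
  linarith

namespace HyperbolicLattice

variable (Λ : HyperbolicLattice)

/-- The automorphism multiplies x² by ε² = e^L and y² by e^{-L}, which is a unit shift of r; the
product xy is unchanged. -/
lemma geodesicTerm_vecEquiv (p : ℕ) (j : ℤ) (v : Fin 2 → ℤ) (t r : ℝ) :
    Λ.geodesicTerm p (vecEquiv (Λ.γ ^ j) v) t r = Λ.geodesicTerm p v t (r + j) := by
  have hε := Λ.ε_pos
  have e1 : rexp (Λ.length * (r + j)) = rexp (Λ.length * r) * (Λ.ε ^ j) ^ 2 := by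
    rw [mul_add, Real.exp_add, Real.exp_mul Λ.length j, Real.rpow_intCast, exp_length,
      ← zpow_natCast, ← zpow_natCast, zpow_comm]
  have e2 : rexp (-(Λ.length * (r + j))) = rexp (-(Λ.length * r)) * (Λ.ε ^ (-j)) ^ 2 := by
    rw [Real.exp_neg, e1, mul_inv, ← Real.exp_neg, zpow_neg, inv_pow]
  have e3 : Λ.ε ^ j * Λ.ε ^ (-j) = 1 := by rw [← zpow_add₀ hε.ne']; simp
  unfold geodesicTerm
  rw [x_vecEquiv_zpow, y_vecEquiv_zpow, e1, e2]
  congr 2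
  · linear_combination (Λ.x v * Λ.y v) * e3
  · ring

/-- Shift r by r₀ with e^{Lr₀} = |x|/|y|. This balances the two exponentials: both acquire the
coefficient |xy|. -/
lemma integral_geodesicTerm (p : ℕ) {v : Fin 2 → ℤ} (hv : v ≠ 0) {t : ℝ} (ht : 0 < t) :
    Integrable (Λ.geodesicTerm p v t) ∧ ∫ r, Λ.geodesicTerm p v t r =
      (Λ.x v * Λ.y v) ^ p * bessel Λ.length (|Λ.x v * Λ.y v| / Λ.covol * t) := by
  have hL := Λ.length_pos
  have hΔ := Λ.covol_pos
  have hx := abs_pos.mpr (Λ.x_ne_zero hv)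
  have hy := abs_pos.mpr (Λ.y_ne_zero hv)
  set r₀ := Real.log (|Λ.x v| / |Λ.y v|) / Λ.length with hr₀
  have e0 : rexp (Λ.length * r₀) = |Λ.x v| / |Λ.y v| := by
    rw [hr₀, mul_div_cancel₀ _ hL.ne', Real.exp_log (by positivity)]
  have hpos : 0 < |Λ.x v * Λ.y v| / Λ.covol * t := by rw [abs_mul]; positivity
  have e : Λ.geodesicTerm p v t = fun r => (Λ.x v * Λ.y v) ^ p *
      rexp (-(π * twoCosh Λ.length (r + r₀) * (|Λ.x v * Λ.y v| / Λ.covol * t))) := by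
    funext r
    unfold geodesicTerm twoCosh
    congr 2
    rw [mul_add Λ.length r r₀, neg_add, Real.exp_add, Real.exp_add, Real.exp_neg (Λ.length * r₀), e0, abs_mul,
      ← sq_abs (Λ.x v), ← sq_abs (Λ.y v)]
    field_simp
  have hi := integrable_exp_neg_twoCosh hL hpos
  rw [e]
  refine ⟨(hi.comp_add_right r₀).const_mul _, ?_⟩
  rw [integral_const_mul, integral_add_right_eq_self
    (fun r => rexp (-(π * twoCosh Λ.length r * (|Λ.x v * Λ.y v| / Λ.covol * t))))]
  rfl

/-- Unfolding: the nonzero vectors are grouped into orbits, and the unit shifts of r coming from one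
orbit join the integrals over [0, 1] into one integral over the line. -/
theorem hasSum_thetaIntegral (p : ℕ) {t : ℝ} (ht : 0 < t) :
    HasSum (fun d : Λ.fundDomain => (Λ.x d * Λ.y d) ^ p *
      bessel Λ.length (|Λ.x d * Λ.y d| / Λ.covol * t)) (Λ.thetaIntegral p t - 0 ^ p) := by
  have hb := Λ.lowerScale_pos
  have h1 : HasSum (fun v : {v : Fin 2 → ℤ // v ≠ 0} => ∫ r in (0 : ℝ)..1, Λ.geodesicTerm p v t r)
      (Λ.thetaIntegral p t - 0 ^ p) := by
    rw [Λ.thetaIntegral_sub p ht]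
    simp_rw [Λ.geodesicTheta_sub p ht, intervalIntegral.integral_of_le zero_le_one]
    refine hasSum_integral_of_summable_integral_norm
      (fun v => (Λ.continuous_geodesicTerm p v t).integrableOn_Ioc) ?_
    refine Summable.of_nonneg_of_le (fun v => integral_nonneg fun r => norm_nonneg _) (fun v => ?_)
      ((Λ.summable_xy_pow_mul_exp (mul_pos pi_pos (mul_pos ht hb)) p).subtype {v | v ≠ 0})
    refine (setIntegral_mono_on ((Λ.continuous_geodesicTerm p v t).norm.integrableOn_Ioc)
      (integrableOn_const (by simp)) measurableSet_Ioc fun r hr =>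
        Λ.norm_geodesicTerm_le p v ht.le ⟨hr.1.le, hr.2⟩).trans ?_
    simp
  have h2 := Λ.translateEquiv.hasSum_iff.mpr h1
  have h3 : ∀ d : Λ.fundDomain, HasSum (fun j : ℤ => ∫ r in (0 : ℝ)..1,
      Λ.geodesicTerm p (Λ.translateEquiv (j, d)) t r) ((Λ.x d * Λ.y d) ^ p *
        bessel Λ.length (|Λ.x d * Λ.y d| / Λ.covol * t)) := by
    intro d
    obtain ⟨hi, hv⟩ := Λ.integral_geodesicTerm p d.2.1 ht
    have h := hi.hasSum_intervalIntegral_comp_add_int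
    rw [hv] at h
    simp_rw [translateEquiv_apply, geodesicTerm_vecEquiv]
    exact h
  have h4 := (Equiv.prodComm _ _).hasSum_iff.mpr h2
  exact h4.prod_fiberwise h3

/-! ## The lattice zeta functions -/

/-- On the fundamental domain |x| and |y| are comparable, so their product controls the sum of their
squares. -/
lemma exists_sqNorm_le_of_mem : ∃ c, 0 < c ∧ ∀ d ∈ Λ.fundDomain,
    c * sqNorm d ≤ |Λ.x d * Λ.y d| := by
  obtain ⟨c, hc, h⟩ := Λ.exists_sqNorm_le
  have hε := Λ.ε_pos
  refine ⟨c / (Λ.ε ^ 4 + 1), by positivity, fun d hd => ?_⟩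
  obtain ⟨-, h1, h2⟩ := hd
  rw [div_mul_eq_mul_div, div_le_iff₀ (by positivity), abs_mul]
  refine (h d).trans ?_
  have h3 : |Λ.y d| ^ 2 ≤ |Λ.x d| * |Λ.y d| := by
    rw [pow_two]; exact mul_le_mul_of_nonneg_right h1 (abs_nonneg _)
  have h4 : |Λ.x d| ^ 2 ≤ Λ.ε ^ 4 * |Λ.y d| ^ 2 := by
    calc |Λ.x d| ^ 2 ≤ (Λ.ε ^ 2 * |Λ.y d|) ^ 2 := by gcongr
      _ = _ := by ring
  rw [← sq_abs (Λ.x d), ← sq_abs (Λ.y d)]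
  have h5 : Λ.ε ^ 4 * |Λ.y d| ^ 2 ≤ Λ.ε ^ 4 * (|Λ.x d| * |Λ.y d|) := by gcongr
  linarith

lemma xy_pos_of_mem {d : Fin 2 → ℤ} (hd : d ∈ Λ.fundDomain) : 0 < |Λ.x d * Λ.y d| :=
  abs_pos.mpr (mul_ne_zero (Λ.x_ne_zero hd.1) (Λ.y_ne_zero hd.1))

lemma norm_sq_le_sqNorm (v : Fin 2 → ℤ) : ‖v‖ ^ 2 ≤ sqNorm v := by
  have h : ∀ i, ‖v i‖ ≤ √(sqNorm v) := by
    intro i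
    refine Real.le_sqrt_of_sq_le ?_
    rw [Int.norm_eq_abs, sq_abs]
    unfold sqNorm
    fin_cases i
    · simp; positivity
    · simp; positivity
  have h2 := (pi_norm_le_iff_of_nonneg (Real.sqrt_nonneg _)).mpr h
  calc ‖v‖ ^ 2 ≤ √(sqNorm v) ^ 2 := by gcongr
    _ = _ := Real.sq_sqrt (sqNorm_nonneg v)

/-- On the fundamental domain |xy| is at least a multiple of ‖v‖², and ∑ ‖v‖^(-2w) over ℤ² converges
for 2w > 2. -/
lemma summable_fundDomain {w : ℝ} (hw : 1 < w) :
    Summable fun d : Λ.fundDomain => |Λ.x d * Λ.y d| ^ (-w) := by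
  obtain ⟨c, hc, h⟩ := Λ.exists_sqNorm_le_of_mem
  have hs := EisensteinSeries.summable_one_div_norm_rpow (k := 2 * w) (by linarith)
  refine Summable.of_nonneg_of_le (fun d => by positivity) (fun d => ?_)
    ((hs.subtype Λ.fundDomain).mul_left (c ^ (-w)))
  have hn : 0 < ‖(d : Fin 2 → ℤ)‖ := norm_pos_iff.mpr d.2.1
  have e : ‖(d : Fin 2 → ℤ)‖ ^ (-(2 * w)) = (‖(d : Fin 2 → ℤ)‖ ^ 2) ^ (-w) := by
    rw [← Real.rpow_natCast, ← Real.rpow_mul hn.le]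
    congr 1
    push_cast; ring
  simp only [Function.comp_apply]
  rw [e, ← Real.mul_rpow hc.le (by positivity)]
  refine Real.rpow_le_rpow_of_nonpos (by positivity) ?_ (by linarith)
  exact (mul_le_mul_of_nonneg_left (norm_sq_le_sqNorm _) hc.le).trans (h d d.2)

/-- The gamma factor `π^{-s} Γ(s/2)² / 2L`. -/
def gammaFactor (s : ℂ) : ℂ :=
  (π : ℂ) ^ (-s) * Complex.Gamma (s / 2) ^ 2 / (2 * Λ.length)

/-- The unfolded theta integral is transformed term by term. Absolute convergence holds because the
scaling of the Bessel transform turns the norms into a constant times |xy|^(-Re w). -/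
theorem hasSum_mellin {p : ℕ} {w : ℂ} (hw : 1 < w.re) :
    HasSum (fun d : Λ.fundDomain => ((Λ.x d * Λ.y d : ℝ) : ℂ) ^ p *
      (((|Λ.x d * Λ.y d| / Λ.covol : ℝ) : ℂ) ^ (-(w + p)) * Λ.gammaFactor (w + p)))
      (mellin (fun t => (Λ.thetaIntegral p t : ℂ) - 0 ^ p) (w + p)) := by
  have hL := Λ.length_pos
  have hΔ := Λ.covol_pos
  have hs : 0 < (w + p).re := by
    rw [Complex.add_re, Complex.natCast_re]
    have : (0 : ℝ) ≤ p := p.cast_nonneg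
    linarith
  set s : ℂ := w + p with hsdef
  obtain ⟨hconv, hval⟩ := hasMellin_bessel hL hs
  have hc : ∀ d : Λ.fundDomain, 0 < |Λ.x d * Λ.y d| / Λ.covol := fun d =>
    div_pos (Λ.xy_pos_of_mem d.2) hΔ
  set f : Λ.fundDomain → ℝ → ℂ := fun d t => (t : ℂ) ^ (s - 1) • (((Λ.x d * Λ.y d : ℝ) : ℂ) ^ p *
    (bessel Λ.length (|Λ.x d * Λ.y d| / Λ.covol * t) : ℂ)) with hf
  have hint : ∀ d, IntegrableOn (f d) (Set.Ioi 0) := fun d =>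
    (((MellinConvergent.comp_mul_left (hc d)).mpr hconv).const_smul
      (((Λ.x d * Λ.y d : ℝ) : ℂ) ^ p))
  -- The weight |xy|^p cancels the shift by p in the exponent, which leaves Re w and not Re w + p.
  have hnorm : ∀ d, ∫ t in Set.Ioi (0 : ℝ), ‖f d t‖ = |Λ.x d * Λ.y d| ^ (-w.re) *
      (Λ.covol ^ s.re * ∫ t in Set.Ioi (0 : ℝ), t ^ (s.re - 1) * bessel Λ.length t) := by
    intro d
    have hd := Λ.xy_pos_of_mem d.2
    set c := |Λ.x d * Λ.y d| / Λ.covol with hcd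
    have hc0 : 0 < c := hc d
    have e : ∀ t ∈ Set.Ioi (0 : ℝ), ‖f d t‖ = (|Λ.x d * Λ.y d| ^ p * c ^ (1 - s.re)) *
        ((c * t) ^ (s.re - 1) * bessel Λ.length (c * t)) := by
      intro t ht
      have ht' : 0 < t := ht
      rw [hf]
      simp only
      rw [norm_smul, Complex.norm_cpow_eq_rpow_re_of_pos ht', norm_mul, norm_pow,
        Complex.norm_real, Complex.norm_real, Real.norm_of_nonneg (bessel_nonneg _ _),
        Complex.sub_re, Complex.one_re, Real.mul_rpow hc0.le ht'.le, Real.norm_eq_abs]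
      have : c ^ (1 - s.re) * c ^ (s.re - 1) = 1 := by
        rw [← Real.rpow_add hc0]; simp
      linear_combination (-(t ^ (s.re - 1) * |Λ.x d * Λ.y d| ^ p *
        bessel Λ.length (c * t))) * this
    rw [setIntegral_congr_fun measurableSet_Ioi e, integral_const_mul,
      integral_comp_mul_left_Ioi (fun t => t ^ (s.re - 1) * bessel Λ.length t) 0 hc0, mul_zero,
      smul_eq_mul, ← mul_assoc, ← mul_assoc]
    congr 1
    rw [mul_assoc, ← Real.rpow_neg_one, ← Real.rpow_add hc0, hcd,
      Real.div_rpow hd.le hΔ.le, ← Real.rpow_natCast, mul_div_assoc', ← Real.rpow_add hd,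
      div_eq_mul_inv, ← Real.rpow_neg hΔ.le]
    congr 2
    · rw [hsdef, Complex.add_re, Complex.natCast_re]; ring
    · ring
  have hsum : Summable fun d => ∫ t in Set.Ioi (0 : ℝ), ‖f d t‖ := by
    simp_rw [hnorm]
    exact (Λ.summable_fundDomain hw).mul_right _
  have h := hasSum_integral_of_summable_integral_norm hint hsum
  have hlhs : ∀ d, ∫ t in Set.Ioi (0 : ℝ), f d t = ((Λ.x d * Λ.y d : ℝ) : ℂ) ^ p *
      (((|Λ.x d * Λ.y d| / Λ.covol : ℝ) : ℂ) ^ (-s) * Λ.gammaFactor s) := by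
    intro d
    have h1 := mellin_comp_mul_left (fun y => (bessel Λ.length y : ℂ)) s (hc d)
    have h2 := mellin_const_smul (fun t => (bessel Λ.length (|Λ.x d * Λ.y d| / Λ.covol * t) : ℂ)) s
      (((Λ.x d * Λ.y d : ℝ) : ℂ) ^ p)
    rw [h1, hval, smul_eq_mul, smul_eq_mul] at h2
    exact h2
  simp_rw [hlhs] at h
  refine (congrArg (HasSum _) (Eq.symm ?_)).mp h
  rw [mellin]
  refine setIntegral_congr_fun measurableSet_Ioi fun t ht => ?_
  have h5 := Complex.hasSum_ofReal.mpr (Λ.hasSum_thetaIntegral p ht)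
  simp only [hf, smul_eq_mul]
  rw [tsum_mul_left]
  congr 1
  push_cast at h5 ⊢
  exact h5.tsum_eq.symm

/-- For p = 0 the condition Re w > 1 is the half plane where the completed function is the Mellin
transform of the series without its constant term. For p = 1 there is no constant term, and the
transform converges everywhere. -/
theorem hasSum_fePair {p : ℕ} (hp : p ≤ 1) {w : ℂ} (hw : 1 < w.re) :
    HasSum (fun d : Λ.fundDomain => ((Λ.x d * Λ.y d : ℝ) : ℂ) ^ p *
      (((|Λ.x d * Λ.y d| / Λ.covol : ℝ) : ℂ) ^ (-(w + p)) * Λ.gammaFactor (w + p)))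
      ((Λ.fePair hp).Λ (w + p)) := by
  have h := Λ.hasSum_mellin (p := p) hw
  have e : (Λ.fePair hp).Λ (w + p) =
      mellin (fun t => (Λ.thetaIntegral p t : ℂ) - 0 ^ p) (w + p) := by
    interval_cases p
    · have hk : (Λ.fePair hp).k < (w + (0 : ℕ)).re := by
        change (1 + 2 * ((0 : ℕ) : ℝ)) < _
        simpa using hw
      exact ((Λ.fePair hp).hasMellin hk).2.symm
    · have hst : IsStrongFEPair (Λ.fePair hp) := ⟨by simp [fePair], by simp [fePair]⟩
      rw [← (hst.hasMellin _).2]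
      simp [fePair]
  rw [e]
  exact h

end HyperbolicLattice
end HeckeCycle

/-! ### Continuation of the lattice zeta functions and their values at 1 - k -/

namespace HeckeCycle

open Real

/-- The reflection formula moves the inverse gamma factor to the right half plane; its sine is taken
at a half-integral multiple of π and has square 1. The two gamma values then differ in argument by
1/2, and duplication applies. -/
lemma sq_Gamma_mul_sq_inv_Gamma {k p : ℕ} (hp : p ≤ 1) (hk : 0 < k) (hkp : Even (k + p)) :
    Complex.Gamma (((k : ℂ) + p) / 2) ^ 2 * (Complex.Gamma ((1 - k + p) / 2))⁻¹ ^ 2 =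
      4 * (π : ℂ)⁻¹ * ((2 : ℂ) ^ (2 * k))⁻¹ * Complex.Gamma k ^ 2 := by
  have hπ : (π : ℂ) ≠ 0 := by exact_mod_cast pi_ne_zero
  have hdup := Complex.Gamma_mul_Gamma_add_half ((k : ℂ) / 2)
  rw [mul_div_cancel₀ _ two_ne_zero] at hdup
  have hkre : 0 < ((k : ℂ) / 2).re := by
    rw [Complex.div_ofNat_re, Complex.natCast_re]
    positivity
  have hre : 0 < ((k : ℂ) / 2 + 1 / 2).re := by
    rw [Complex.add_re]
    have : ((1 : ℂ) / 2).re = 1 / 2 := by simp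
    rw [this]
    positivity
  have hG1 := Complex.Gamma_ne_zero_of_re_pos hkre
  have hG2 := Complex.Gamma_ne_zero_of_re_pos hre
  have hsin : ∀ m : ℕ, Complex.sin (π * (m + 1 / 2)) ^ 2 = 1 := by
    intro m
    have h := Complex.sin_sq_add_cos_sq (π * (m + 1 / 2))
    have h0 : Complex.cos (π * (m + 1 / 2)) = 0 := by
      rw [Complex.cos_eq_zero_iff]
      exact ⟨m, by push_cast; ring⟩
    rw [h0] at h
    simpa using h
  have hpow : ((2 : ℂ) ^ (1 - (k : ℂ))) ^ 2 = 4 * ((2 : ℂ) ^ (2 * k))⁻¹ := by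
    rw [Complex.cpow_sub _ _ two_ne_zero, Complex.cpow_one, Complex.cpow_natCast, div_pow, pow_mul',
      div_eq_mul_inv]
    norm_num
  have hsq : ((√π : ℝ) : ℂ) ^ 2 = π := by
    rw [← Complex.ofReal_pow, Real.sq_sqrt pi_pos.le]
  have hdup2 : (Complex.Gamma (k / 2) * Complex.Gamma (k / 2 + 1 / 2)) ^ 2 =
      4 * π * ((2 : ℂ) ^ (2 * k))⁻¹ * Complex.Gamma k ^ 2 := by
    rw [hdup, mul_pow, mul_pow, hpow, hsq]
    ring
  interval_cases p
  · obtain ⟨m, hm⟩ := hkp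
    have hm' : (k : ℂ) = 2 * m := by
      have : (k : ℂ) + 0 = m + m := by exact_mod_cast hm
      linear_combination this
    have hrefl := Complex.Gamma_mul_Gamma_one_sub ((k : ℂ) / 2 + 1 / 2)
    have e1 : (1 - ((k : ℂ) / 2 + 1 / 2)) = (1 - k + (0 : ℕ)) / 2 := by push_cast; ring
    have e2 : ((k : ℂ) + (0 : ℕ)) / 2 = k / 2 := by push_cast; ring
    have e3 : (k : ℂ) / 2 + 1 / 2 = m + 1 / 2 := by rw [hm']; ring
    rw [e1] at hrefl
    have hr2 : (Complex.Gamma ((k : ℂ) / 2 + 1 / 2) *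
        Complex.Gamma ((1 - k + (0 : ℕ)) / 2)) ^ 2 = π ^ 2 := by
      rw [hrefl, div_pow, e3, hsin, div_one]
    have hne : Complex.Gamma ((1 - (k : ℂ) + (0 : ℕ)) / 2) ≠ 0 := by
      intro h
      rw [h, mul_zero, zero_pow two_ne_zero] at hr2
      exact pow_ne_zero 2 hπ hr2.symm
    rw [e2]
    have : (Complex.Gamma ((1 - (k : ℂ) + (0 : ℕ)) / 2))⁻¹ ^ 2 =
        Complex.Gamma ((k : ℂ) / 2 + 1 / 2) ^ 2 / π ^ 2 := by
      rw [← hr2, mul_pow, inv_pow, div_mul_cancel_left₀]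
      intro h
      rw [mul_pow, h, zero_mul] at hr2
      exact pow_ne_zero 2 hπ hr2.symm
    rw [this, mul_div_assoc', ← mul_pow, hdup2]
    field_simp
  · obtain ⟨m, hm⟩ := hkp
    have hm1 : 1 ≤ m := by omega
    have hm' : (k : ℂ) = 2 * m - 1 := by
      have : (k : ℂ) + 1 = m + m := by exact_mod_cast hm
      linear_combination this
    have hrefl := Complex.Gamma_mul_Gamma_one_sub ((k : ℂ) / 2)
    have e1 : (1 - ((k : ℂ) / 2)) = (1 - k + (1 : ℕ)) / 2 := by push_cast; ring
    have e2 : ((k : ℂ) + (1 : ℕ)) / 2 = k / 2 + 1 / 2 := by push_cast; ring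
    have e3 : (k : ℂ) / 2 = (m - 1 : ℕ) + 1 / 2 := by rw [hm']; push_cast [hm1]; ring
    rw [e1] at hrefl
    have hr2 : (Complex.Gamma ((k : ℂ) / 2) *
        Complex.Gamma ((1 - k + (1 : ℕ)) / 2)) ^ 2 = π ^ 2 := by
      rw [hrefl, div_pow, e3, hsin, div_one]
    have hne : Complex.Gamma ((1 - (k : ℂ) + (1 : ℕ)) / 2) ≠ 0 := by
      intro h
      rw [h, mul_zero, zero_pow two_ne_zero] at hr2
      exact pow_ne_zero 2 hπ hr2.symm
    rw [e2]
    have : (Complex.Gamma ((1 - (k : ℂ) + (1 : ℕ)) / 2))⁻¹ ^ 2 =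
        Complex.Gamma ((k : ℂ) / 2) ^ 2 / π ^ 2 := by
      rw [← hr2, mul_pow, inv_pow, div_mul_cancel_left₀]
      intro h
      rw [mul_pow, h, zero_mul] at hr2
      exact pow_ne_zero 2 hπ hr2.symm
    rw [this, mul_div_assoc', ← mul_pow, mul_comm (Complex.Gamma (k / 2 + 1 / 2)), hdup2]
    field_simp

namespace HyperbolicLattice

variable (Λ : HyperbolicLattice)

/-- The meromorphic continuation of `∑ (xy)^p |xy|^{-(w+p)}` over the nonzero lattice vectors modulo
the automorphism. -/
def latticeZeta {p : ℕ} (hp : p ≤ 1) (w : ℂ) : ℂ :=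
  2 * Λ.length * ((π / Λ.covol : ℝ) : ℂ) ^ (w + p) *
    ((Λ.fePair hp).Λ₀ (w + p) * (Complex.Gamma ((w + p) / 2))⁻¹ ^ 2 -
      0 ^ p * ((Complex.Gamma ((w + p) / 2 + 1))⁻¹ * (Complex.Gamma ((w + p) / 2))⁻¹ / 2) -
      0 ^ p * (Complex.Gamma ((w + p) / 2))⁻¹ ^ 2 * (1 - w)⁻¹)

/-- With s = w + p, the identity Γ(s/2 + 1) = (s/2)Γ(s/2) turns Γ(s/2)⁻²/s into the regular term of
the definition. The pole of the completed function at s = 0 is thereby removed, and the case s = 0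
is excluded only because 1/s occurs on the right. -/
lemma latticeZeta_eq {p : ℕ} (hp : p ≤ 1) {w : ℂ} (hs : w + p ≠ 0) :
    Λ.latticeZeta hp w = 2 * Λ.length * ((π / Λ.covol : ℝ) : ℂ) ^ (w + p) *
      ((Λ.fePair hp).Λ (w + p) * (Complex.Gamma ((w + p) / 2))⁻¹ ^ 2) := by
  rw [latticeZeta]
  congr 1
  have hΛ : (Λ.fePair hp).Λ (w + p) = (Λ.fePair hp).Λ₀ (w + p) - (1 / (w + p)) * 0 ^ p -
      1 / (((1 + 2 * p : ℝ) : ℂ) - (w + p)) * 0 ^ p := rfl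
  have h1 := Complex.one_div_Gamma_eq_self_mul_one_div_Gamma_add_one ((w + p) / 2)
  rw [hΛ]
  interval_cases p
  · have e : ((1 + 2 * (0 : ℕ) : ℝ) : ℂ) - (w + (0 : ℕ)) = 1 - w := by push_cast; ring
    rw [e]
    set s := w + ((0 : ℕ) : ℂ)
    have e2 : (Complex.Gamma (s / 2 + 1))⁻¹ = 2 / s * (Complex.Gamma (s / 2))⁻¹ := by
      rw [h1]; field_simp
    rw [e2]
    ring
  · ring

lemma differentiable_inv_Gamma_comp (p : ℕ) (c : ℂ) :
    Differentiable ℂ fun w : ℂ => (Complex.Gamma ((w + p) / 2 + c))⁻¹ :=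
  Complex.differentiable_one_div_Gamma.comp
    (f := fun w : ℂ => (w + p) / 2 + c) (by fun_prop)

/-- Separates the one possible pole, at w = 1, from an entire function; both parts use that the
reciprocal gamma function is entire. -/
lemma latticeZeta_eq_sub {p : ℕ} (hp : p ≤ 1) : ∃ f g : ℂ → ℂ, Differentiable ℂ f ∧
    Differentiable ℂ g ∧ Λ.latticeZeta hp = fun w => f w - g w * (1 - w)⁻¹ := by
  have hpos : 0 < π / Λ.covol := div_pos pi_pos Λ.covol_pos
  have h0 : Differentiable ℂ fun w : ℂ => ((π / Λ.covol : ℝ) : ℂ) ^ (w + p) := by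
    refine Differentiable.const_cpow (by fun_prop) (Or.inl ?_)
    exact_mod_cast hpos.ne'
  have h1 : Differentiable ℂ fun w : ℂ => (Λ.fePair hp).Λ₀ (w + p) :=
    (Λ.fePair hp).differentiable_Λ₀.comp (by fun_prop)
  have h2 := differentiable_inv_Gamma_comp p 0
  simp only [add_zero] at h2
  have h3 := differentiable_inv_Gamma_comp p 1
  refine ⟨fun w => 2 * Λ.length * ((π / Λ.covol : ℝ) : ℂ) ^ (w + p) *
    ((Λ.fePair hp).Λ₀ (w + p) * (Complex.Gamma ((w + p) / 2))⁻¹ ^ 2 -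
      0 ^ p * ((Complex.Gamma ((w + p) / 2 + 1))⁻¹ * (Complex.Gamma ((w + p) / 2))⁻¹ / 2)),
    fun w => 2 * Λ.length * ((π / Λ.covol : ℝ) : ℂ) ^ (w + p) *
      (0 ^ p * (Complex.Gamma ((w + p) / 2))⁻¹ ^ 2), ?_, ?_, ?_⟩
  · exact (h0.const_mul _).mul ((h1.mul (h2.pow 2)).sub (((h3.mul h2).div_const 2).const_mul _))
  · exact (h0.const_mul _).mul ((h2.pow 2).const_mul _)
  · funext w
    rw [latticeZeta]
    ring

lemma differentiableOn_latticeZeta {p : ℕ} (hp : p ≤ 1) :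
    DifferentiableOn ℂ (Λ.latticeZeta hp) {1}ᶜ := by
  obtain ⟨f, g, hf, hg, e⟩ := Λ.latticeZeta_eq_sub hp
  rw [e]
  refine hf.differentiableOn.sub (hg.differentiableOn.mul ?_)
  refine DifferentiableOn.inv (by fun_prop) fun w hw => ?_
  exact sub_ne_zero.mpr (Ne.symm hw)

lemma meromorphicAt_latticeZeta {p : ℕ} (hp : p ≤ 1) :
    MeromorphicAt (Λ.latticeZeta hp) 1 := by
  obtain ⟨f, g, hf, hg, e⟩ := Λ.latticeZeta_eq_sub hp
  rw [e]
  have h1 : Differentiable ℂ fun w : ℂ => 1 - w := by fun_prop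
  exact (hf.analyticAt 1).meromorphicAt.sub
    ((hg.analyticAt 1).meromorphicAt.mul (h1.analyticAt 1).meromorphicAt.inv)

/-- The inverse gamma factor and the powers of π and of the covolume in the definition undo those of
the Mellin transform. -/
theorem hasSum_latticeZeta {p : ℕ} (hp : p ≤ 1) {w : ℂ} (hw : 1 < w.re) :
    HasSum (fun d : Λ.fundDomain => ((Λ.x d * Λ.y d : ℝ) : ℂ) ^ p *
      ((|Λ.x d * Λ.y d| : ℝ) : ℂ) ^ (-(w + p))) (Λ.latticeZeta hp w) := by
  have hL := Λ.length_pos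
  have hΔ := Λ.covol_pos
  have hs : 0 < (w + p).re := by
    rw [Complex.add_re, Complex.natCast_re]
    have : (0 : ℝ) ≤ p := p.cast_nonneg
    linarith
  have hs0 : w + p ≠ 0 := fun h => by simp [h] at hs
  have hs2 : 0 < ((w + p) / 2).re := by
    rw [Complex.div_ofNat_re]; positivity
  have hG := Complex.Gamma_ne_zero_of_re_pos hs2
  have hLc : (Λ.length : ℂ) ≠ 0 := by exact_mod_cast hL.ne'
  rw [Λ.latticeZeta_eq hp hs0]
  have h := ((Λ.hasSum_fePair hp hw).mul_right ((Complex.Gamma ((w + p) / 2))⁻¹ ^ 2)).mul_left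
    (2 * Λ.length * ((π / Λ.covol : ℝ) : ℂ) ^ (w + p))
  refine (congrArg (fun f => HasSum f _) (funext fun d => ?_)).mp h
  have hd := Λ.xy_pos_of_mem d.2
  set s := w + (p : ℂ)
  have e : ((|Λ.x d * Λ.y d| : ℝ) : ℂ) ^ (-s) = ((π / Λ.covol : ℝ) : ℂ) ^ s *
      (((|Λ.x d * Λ.y d| / Λ.covol : ℝ) : ℂ) ^ (-s) * (π : ℂ) ^ (-s)) := by
    rw [ofReal_cpow_eq_exp hd, ofReal_cpow_eq_exp (div_pos pi_pos hΔ),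
      ofReal_cpow_eq_exp (div_pos hd hΔ), ofReal_cpow_eq_exp pi_pos, ← Complex.exp_add,
      ← Complex.exp_add, Real.log_div pi_ne_zero hΔ.ne', Real.log_div hd.ne' hΔ.ne']
    congr 1
    push_cast
    ring
  rw [e, gammaFactor]
  field_simp

/-- Here (w + p)/2 is a nonpositive integer, and each term of the definition contains the reciprocal
gamma function at that point. The convention Γ = 0 at its poles gives the correct value 0 of the
reciprocal. -/
lemma latticeZeta_one_sub_of_odd {p : ℕ} (hp : p ≤ 1) {k : ℕ} (hk : 2 ≤ k) (hkp : ¬Even (k + p)) :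
    Λ.latticeZeta hp (1 - k) = 0 := by
  obtain ⟨m, hm⟩ := Nat.not_even_iff_odd.mp hkp
  have e : ((1 - k + p : ℂ)) / 2 = -((m - p : ℕ) : ℂ) := by
    have h1 : (k : ℂ) + p = 2 * m + 1 := by exact_mod_cast hm
    rw [Nat.cast_sub (by omega)]
    linear_combination (-1 / 2) * h1
  rw [latticeZeta, e, Complex.Gamma_neg_nat_eq_zero]
  simp

/-- The functional equation s ↔ 1 + 2p - s takes k + p to 1 - k + p. The pair is its own dual with
sign 1, so the ratio of the two values is the ratio of gamma factors times powers of π and the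
covolume. -/
lemma latticeZeta_one_sub_of_even {p : ℕ} (hp : p ≤ 1) {k : ℕ} (hk : 2 ≤ k) (hkp : Even (k + p)) :
    Λ.latticeZeta hp (1 - k) = 4 * (Λ.covol : ℂ) ^ (2 * k - 1) / (2 * π) ^ (2 * k) *
      Complex.Gamma k ^ 2 * Λ.latticeZeta hp k := by
  have hΔ := Λ.covol_pos
  have hπ : (π : ℂ) ≠ 0 := by exact_mod_cast pi_ne_zero
  have hΔc : (Λ.covol : ℂ) ≠ 0 := by exact_mod_cast hΔ.ne'
  have hpos : ((π / Λ.covol : ℝ) : ℂ) ≠ 0 := by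
    exact_mod_cast (div_pos pi_pos hΔ).ne'
  -- The exceptional point s = 0 would mean k = 1 + p, hence k + p odd.
  have h1 : (1 - (k : ℂ)) + p ≠ 0 := by
    intro h
    have h2 : (k : ℂ) = ((1 + p : ℕ) : ℂ) := by push_cast; linear_combination -h
    have h3 : k = 1 + p := by exact_mod_cast h2
    obtain ⟨m, hm⟩ := hkp
    omega
  have h2 : (k : ℂ) + p ≠ 0 := by
    have : ((k + p : ℕ) : ℂ) ≠ 0 := by exact_mod_cast (by omega : k + p ≠ 0)
    simpa using this
  have hG : Complex.Gamma (((k : ℂ) + p) / 2) ≠ 0 := by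
    apply Complex.Gamma_ne_zero_of_re_pos
    rw [Complex.div_ofNat_re, Complex.add_re, Complex.natCast_re, Complex.natCast_re]
    have : (0 : ℝ) < k := by exact_mod_cast (by omega : 0 < k)
    positivity
  have hfe := (Λ.fePair hp).functional_equation (k + p)
  have e1 : (((Λ.fePair hp).k : ℝ) : ℂ) - (k + p) = 1 - k + p := by
    change ((1 + 2 * (p : ℝ) : ℝ) : ℂ) - (k + p) = 1 - k + p
    push_cast; ring
  have e2 : (Λ.fePair hp).ε • (Λ.fePair hp).symm.Λ (k + p) = (Λ.fePair hp).Λ (k + p) := by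
    have h3 : (Λ.fePair hp).symm = Λ.fePair hp := by
      unfold WeakFEPair.symm fePair
      simp
    rw [h3]
    exact one_smul _ _
  rw [e1, e2] at hfe
  rw [Λ.latticeZeta_eq hp h1, Λ.latticeZeta_eq hp h2, hfe]
  have hg := sq_Gamma_mul_sq_inv_Gamma hp (by omega) hkp
  have e3 : (Complex.Gamma ((1 - (k : ℂ) + p) / 2))⁻¹ ^ 2 = 4 * (π : ℂ)⁻¹ * ((2 : ℂ) ^ (2 * k))⁻¹ *
      Complex.Gamma k ^ 2 * (Complex.Gamma (((k : ℂ) + p) / 2))⁻¹ ^ 2 := by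
    rw [← hg]; field_simp
  have e4 : ((π / Λ.covol : ℝ) : ℂ) ^ (1 - (k : ℂ) + p) = ((π / Λ.covol : ℝ) : ℂ) ^ ((k : ℂ) + p) *
      ((π / Λ.covol : ℂ) ^ (2 * k - 1))⁻¹ := by
    have h4 : (1 - (k : ℂ) + p) = (k + p) - ((2 * k - 1 : ℕ) : ℂ) := by
      rw [Nat.cast_sub (by omega)]; push_cast; ring
    rw [h4, Complex.cpow_sub _ _ hpos, Complex.cpow_natCast, div_eq_mul_inv]
    push_cast
    rfl
  have e5 : (π : ℂ) ^ (2 * k) = π ^ (2 * k - 1) * π := by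
    rw [← pow_succ]; congr 1; omega
  rw [e3, e4, div_pow, mul_pow, e5]
  field_simp

/-- The sum of the lattice zeta functions at `1 - k`, in terms of the sum over `(xy)^{-k}`. -/
theorem latticeZeta_one_sub {k : ℕ} (hk : 2 ≤ k) {S : ℂ}
    (hS : HasSum (fun d : Λ.fundDomain => (((Λ.x d * Λ.y d : ℝ) : ℂ) ^ k)⁻¹) S) :
    Λ.latticeZeta zero_le_one (1 - k) + Λ.latticeZeta le_rfl (1 - k) =
      4 * (Λ.covol : ℂ) ^ (2 * k - 1) / (2 * π) ^ (2 * k) * Complex.Gamma k ^ 2 * S := by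
  -- An even power does not see the absolute value, so (xy)^p |xy|^(-(k+p)) = (xy)^(-k).
  have key : ∀ {p : ℕ} (hp : p ≤ 1), Even (k + p) → Λ.latticeZeta hp k = S := by
    intro p hp hkp
    refine (Λ.hasSum_latticeZeta hp (w := k) ?_).unique ?_
    · rw [Complex.natCast_re]; exact_mod_cast hk
    · refine (congrArg (fun f => HasSum f S) (funext fun d => ?_)).mp hS
      have hd := Λ.xy_pos_of_mem d.2
      have hd' : ((Λ.x d * Λ.y d : ℝ) : ℂ) ≠ 0 := by exact_mod_cast abs_pos.mp hd
      rw [Complex.cpow_neg, ← Nat.cast_add, Complex.cpow_natCast, ← Complex.ofReal_pow |Λ.x d * Λ.y d|,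
        hkp.pow_abs, Complex.ofReal_pow, pow_add, mul_inv, mul_left_comm,
        mul_inv_cancel₀ (pow_ne_zero p hd'), mul_one]
  rcases Nat.even_or_odd k with h | h
  · rw [Λ.latticeZeta_one_sub_of_odd le_rfl hk (by simpa [Nat.even_add_one] using h),
      Λ.latticeZeta_one_sub_of_even zero_le_one hk (by simpa using h),
      key zero_le_one (by simpa using h), add_zero]
  · rw [Λ.latticeZeta_one_sub_of_odd zero_le_one hk (by simpa using h),
      Λ.latticeZeta_one_sub_of_even le_rfl hk h.add_one,
      key le_rfl h.add_one, zero_add]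

end HyperbolicLattice
end HeckeCycle

/-! ### Termwise integration of the Eisenstein series and unfolding along the closed geodesic -/

namespace HeckeCycle

open Real MeasureTheory Filter Topology EisensteinSeries

lemma hol_eisSummand_mul (k : ℤ) (v : Fin 2 → ℤ) {h : ℂ → ℂ} (hh : Differentiable ℂ h) :
    Hol fun z => eisSummand k v z * h z := by
  have h1 := (eisSummand_extension_differentiableOn k v).mul hh.differentiableOn
  refine h1.congr fun z hz => ?_
  simp [UpperHalfPlane.ofComplex_apply_of_im_pos hz]

lemma segment_continuousOn {g : ℍ → ℂ} (hg : Hol g) (α β : ℍ) :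
    ContinuousOn (fun t : ℝ => g (UpperHalfPlane.ofComplex (α + t * (β - α))) * ((β : ℂ) - α))
      (Set.uIcc 0 1) := by
  refine ContinuousOn.mul ?_ continuousOn_const
  refine hg.continuousOn.comp (f := fun t : ℝ => (α : ℂ) + t * (β - α)) (by fun_prop) ?_
  intro t ht
  rw [Set.uIcc_of_le zero_le_one] at ht
  exact segment_im_pos α β ht.1 ht.2

/-- Places the path of integration in a region where the summands of the Eisenstein series have a
common summable bound. -/
lemma segment_mem_verticalStrip (α β : ℍ) {t : ℝ} (h0 : 0 ≤ t) (h1 : t ≤ 1) :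
    UpperHalfPlane.ofComplex ((α : ℂ) + t * (β - α)) ∈
      UpperHalfPlane.verticalStrip (|α.re| + |β.re|) (min α.im β.im) := by
  rw [UpperHalfPlane.ofComplex_apply_of_im_pos (segment_im_pos α β h0 h1),
    UpperHalfPlane.mem_verticalStrip_iff]
  change |((α : ℂ) + t * (β - α)).re| ≤ _ ∧ _ ≤ ((α : ℂ) + t * (β - α)).im
  have e1 : ((α : ℂ) + t * (β - α)).re = (1 - t) * α.re + t * β.re := by simp; ring
  have e2 : ((α : ℂ) + t * (β - α)).im = (1 - t) * α.im + t * β.im := by simp; ring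
  rw [e1, e2]
  constructor
  · refine (abs_add_le _ _).trans ?_
    rw [abs_mul, abs_mul, abs_of_nonneg h0, abs_of_nonneg (sub_nonneg.mpr h1)]
    nlinarith [abs_nonneg α.re, abs_nonneg β.re]
  · have := min_le_left α.im β.im
    have := min_le_right α.im β.im
    nlinarith

/-- The sum over the lattice `ℤz + ℤ` can be integrated termwise. -/
lemma hasSum_lineIntegral_eisSummand {k : ℕ} (hk : 3 ≤ k) {h : ℂ → ℂ} (hh : Differentiable ℂ h)
    (α β : ℍ) :
    HasSum (fun v : Fin 2 → ℤ => lineIntegral (fun z => eisSummand k v z * h z) α β)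
      (lineIntegral (fun z => (∑' v : Fin 2 → ℤ, eisSummand k v z) * h z) α β) := by
  obtain ⟨C, hC⟩ := (isCompact_uIcc (a := (0 : ℝ)) (b := 1)).exists_bound_of_continuousOn
    (f := fun t : ℝ => h (α + t * (β - α)) * ((β : ℂ) - α))
    ((hh.continuous.comp (by fun_prop)).mul continuous_const).continuousOn
  have hC0 : 0 ≤ C := (norm_nonneg _).trans (hC 0 Set.left_mem_uIcc)
  have hB : 0 < min α.im β.im := lt_min α.im_pos β.im_pos
  set r0 := r ⟨⟨|α.re| + |β.re|, min α.im β.im⟩, hB⟩ with hr0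
  have hmem : ∀ t ∈ Set.uIoc (0 : ℝ) 1, 0 ≤ t ∧ t ≤ 1 := by
    intro t ht
    rw [Set.uIoc_of_le zero_le_one] at ht
    exact ⟨ht.1.le, ht.2⟩
  have hbs : Summable fun v : Fin 2 → ℤ => r0 ^ (-(k : ℝ)) * ‖v‖ ^ (-(k : ℝ)) * C :=
    ((summable_one_div_norm_rpow (k := (k : ℝ)) (by exact_mod_cast hk)).mul_left _).mul_right _
  refine intervalIntegral.hasSum_integral_of_dominated_convergence
    (fun v _ => r0 ^ (-(k : ℝ)) * ‖v‖ ^ (-(k : ℝ)) * C) (fun v => ?_) (fun v => ?_) ?_ ?_ ?_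
  · exact ((segment_continuousOn (hol_eisSummand_mul k v hh) α β).mono
      Set.uIoc_subset_uIcc).aestronglyMeasurable measurableSet_uIoc
  · refine ae_of_all _ fun t ht => ?_
    obtain ⟨h0, h1⟩ := hmem t ht
    have hz := segment_mem_verticalStrip α β h0 h1
    rw [UpperHalfPlane.ofComplex_apply_of_im_pos (segment_im_pos α β h0 h1)] at hz ⊢
    have b1 := summand_bound_of_mem_verticalStrip (k := (k : ℝ)) (Nat.cast_nonneg k) v hB hz
    have b2 := hC t (Set.uIoc_subset_uIcc ht)
    rw [mul_assoc, norm_mul]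
    refine mul_le_mul ?_ b2 (norm_nonneg _) ?_
    · refine le_trans (le_of_eq ?_) b1
      rw [eisSummand, norm_zpow, ← Real.rpow_intCast]
      push_cast
      rfl
    · have := r_pos ⟨⟨|α.re| + |β.re|, min α.im β.im⟩, hB⟩
      positivity
  · exact ae_of_all _ fun t _ => hbs
  · exact intervalIntegrable_const
  · refine ae_of_all _ fun t _ => ?_
    have := (summable_norm_eisSummand (k := k) (by exact_mod_cast hk)
      (UpperHalfPlane.ofComplex (α + t * (β - α)))).of_norm.hasSum
    exact (this.mul_right _).mul_right _

/-- Telescoping on each half line. Summability is assumed, so the limits of partial sums suffice to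
find the value. -/
lemma hasSum_int_sub {f : ℤ → ℂ} {l m : ℂ} (hs : Summable fun j => f (j + 1) - f j)
    (hl : Tendsto (fun n : ℕ => f n) atTop (𝓝 l))
    (hm : Tendsto (fun n : ℕ => f (-n)) atTop (𝓝 m)) :
    HasSum (fun j => f (j + 1) - f j) (l - m) := by
  have h1 : HasSum (fun n : ℕ => f ((n : ℤ) + 1) - f n) (l - f 0) := by
    have hs1 : Summable fun n : ℕ => f ((n : ℤ) + 1) - f n :=
      hs.comp_injective Nat.cast_injective
    have ht := hs1.hasSum.tendsto_sum_nat
    have ht' : Tendsto (fun N => ∑ n ∈ Finset.range N, (f ((n : ℤ) + 1) - f n)) atTop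
        (𝓝 (l - f 0)) := by
      refine (hl.sub_const (f 0)).congr fun N => ?_
      have := Finset.sum_range_sub (fun n : ℕ => f n) N
      push_cast at this
      exact this.symm
    rw [← tendsto_nhds_unique ht ht']
    exact hs1.hasSum
  have h2 : HasSum (fun n : ℕ => f (-((n : ℤ) + 1) + 1) - f (-((n : ℤ) + 1))) (f 0 - m) := by
    have hs1 : Summable fun n : ℕ => f (-((n : ℤ) + 1) + 1) - f (-((n : ℤ) + 1)) :=
      hs.comp_injective (i := fun n : ℕ => -((n : ℤ) + 1)) fun a b h => by
        simpa using h
    have ht := hs1.hasSum.tendsto_sum_nat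
    have ht' : Tendsto (fun N => ∑ n ∈ Finset.range N,
        (f (-((n : ℤ) + 1) + 1) - f (-((n : ℤ) + 1)))) atTop (𝓝 (f 0 - m)) := by
      refine (hm.const_sub (f 0)).congr fun N => ?_
      have := Finset.sum_range_sub' (fun n : ℕ => f (-n)) N
      push_cast at this
      rw [neg_zero] at this
      rw [← this]
      refine Finset.sum_congr rfl fun n _ => ?_
      rw [show -((n : ℤ) + 1) + 1 = -n by ring]
    rw [← tendsto_nhds_unique ht ht']
    exact hs1.hasSum
  have h3 := HasSum.of_nat_of_neg_add_one (f := fun j => f (j + 1) - f j) h1 h2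
  rwa [sub_add_sub_cancel] at h3

/-- A primitive of `u ↦ (u(1 - u))^n`. -/
lemma exists_betaPrimitive (n : ℕ) : ∃ P : ℂ → ℂ,
    (∀ u, HasDerivAt P ((u * (1 - u)) ^ n) u) ∧
      P 1 - P 0 = Complex.betaIntegral (n + 1 : ℕ) (n + 1 : ℕ) := by
  obtain ⟨P, hP⟩ := convex_univ.exists_forall_hasDerivWithinAt
    (f := fun u : ℂ => (u * (1 - u)) ^ n)
    (by fun_prop)
  have hP' : ∀ u, HasDerivAt P ((u * (1 - u)) ^ n) u := fun u => by
    simpa using hP u (Set.mem_univ u)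
  refine ⟨P, hP', ?_⟩
  have hd : ∀ t ∈ Set.uIcc (0 : ℝ) 1,
      HasDerivAt (fun t : ℝ => P t) (((t : ℂ) * (1 - t)) ^ n) t := fun t _ =>
    (hP' t).comp_ofReal
  have := intervalIntegral.integral_eq_sub_of_hasDerivAt hd
    (Continuous.intervalIntegrable (by fun_prop) _ _)
  rw [Complex.ofReal_one, Complex.ofReal_zero] at this
  rw [← this, Complex.betaIntegral]
  refine intervalIntegral.integral_congr fun t _ => ?_
  simp [mul_pow]

namespace HyperbolicLattice

variable (Λ : HyperbolicLattice)

/-- The quadratic form `(a₀ - a₁ z)(b₁ z - b₀)`. -/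
def quad (z : ℂ) : ℂ := (Λ.a 0 - Λ.a 1 * z) * (Λ.b 1 * z - Λ.b 0)

lemma differentiable_quad : Differentiable ℂ Λ.quad := by
  unfold quad; fun_prop

/-- The function `x(v)(b₁ z - b₀) / (covol * (v₀ z + v₁))`. -/
def ratio (v : Fin 2 → ℤ) (z : ℂ) : ℂ :=
  Λ.x v * (Λ.b 1 * z - Λ.b 0) / (Λ.covol * (v 0 * z + v 1))

lemma covol_ne_zero : (Λ.covol : ℂ) ≠ 0 := by exact_mod_cast Λ.covol_pos.ne'

/-- Cramer's rule for the lattice basis. It shows that 1 minus `ratio` has the numerator y(v)(a₀ -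
a₁z) over the same denominator. -/
lemma x_mul_add_y_mul (v : Fin 2 → ℤ) (z : ℂ) :
    Λ.x v * (Λ.b 1 * z - Λ.b 0) + Λ.y v * (Λ.a 0 - Λ.a 1 * z) = Λ.covol * (v 0 * z + v 1) := by
  simp only [x, y, covol]
  push_cast
  ring

lemma linear_ne_zero {v : Fin 2 → ℤ} (hv : v ≠ 0) (z : ℍ) : (v 0 * (z : ℂ) + v 1) ≠ 0 := by
  have h : (fun i => (v i : ℝ)) ≠ 0 := by
    intro h
    apply hv
    ext i
    have := congrFun h i
    simpa using this
  have := UpperHalfPlane.linear_ne_zero z h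
  simpa using this

/-- The derivative of a fractional linear map is its determinant over the square of the denominator;
the determinant here is covol·x(v)·y(v). -/
lemma hasDerivAt_ratio {v : Fin 2 → ℤ} (hv : v ≠ 0) (z : ℍ) :
    HasDerivAt (Λ.ratio v) (((Λ.x v * Λ.y v : ℝ) : ℂ) / (Λ.covol * (v 0 * (z : ℂ) + v 1) ^ 2)) z := by
  have h0 := linear_ne_zero hv z
  have hc := Λ.covol_ne_zero
  have h1 : HasDerivAt (fun z : ℂ => Λ.x v * (Λ.b 1 * z - Λ.b 0)) (Λ.x v * (Λ.b 1 * 1) : ℂ) (z : ℂ) :=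
    (((hasDerivAt_id (z : ℂ)).const_mul (Λ.b 1 : ℂ)).sub_const _).const_mul _
  have h2 : HasDerivAt (fun z : ℂ => Λ.covol * (v 0 * z + v 1)) (Λ.covol * (v 0 * 1) : ℂ) (z : ℂ) :=
    (((hasDerivAt_id (z : ℂ)).const_mul (v 0 : ℂ)).add_const _).const_mul _
  have h3 := h1.div h2 (mul_ne_zero hc h0)
  refine h3.congr_deriv ?_
  rw [← mul_right_inj' (mul_ne_zero (pow_ne_zero 2 hc) (pow_ne_zero 2 h0))]
  have e := Λ.x_mul_add_y_mul v z
  have : (Λ.y v : ℂ) = v 0 * Λ.b 0 + v 1 * Λ.b 1 := by simp [y]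
  field_simp
  push_cast
  rw [this]
  ring

/-- For u = `ratio` one has u(1 - u) = xy·Q/(Δ(v₀z + v₁))² and du = xy/(Δ(v₀z + v₁)²) dz, where Q is
`quad` and Δ the covolume. So (u(1 - u))^n du is the Eisenstein summand times Q^n dz, up to the
constant in front. -/
lemma hasDerivAt_primitive {n : ℕ} {P : ℂ → ℂ} (hP : ∀ u, HasDerivAt P ((u * (1 - u)) ^ n) u)
    {v : Fin 2 → ℤ} (hv : v ≠ 0) (z : ℍ) :
    HasDerivAt (fun z => (Λ.covol : ℂ) ^ (2 * n + 1) * (((Λ.x v * Λ.y v : ℝ) : ℂ) ^ (n + 1))⁻¹ *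
      P (Λ.ratio v z)) (eisSummand (2 * (n + 1) : ℕ) v z * Λ.quad z ^ n) z := by
  have h := (((hP (Λ.ratio v z)).comp (z : ℂ) (Λ.hasDerivAt_ratio hv z)).const_mul
    ((Λ.covol : ℂ) ^ (2 * n + 1) * (((Λ.x v * Λ.y v : ℝ) : ℂ) ^ (n + 1))⁻¹))
  refine h.congr_deriv ?_
  have h0 := linear_ne_zero hv z
  have hc := Λ.covol_ne_zero
  have hxy : ((Λ.x v * Λ.y v : ℝ) : ℂ) ≠ 0 := by
    exact_mod_cast mul_ne_zero (Λ.x_ne_zero hv) (Λ.y_ne_zero hv)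
  have e := Λ.x_mul_add_y_mul v z
  have e1 : Λ.ratio v z * (1 - Λ.ratio v z) = ((Λ.x v * Λ.y v : ℝ) : ℂ) * Λ.quad z /
      (Λ.covol * (v 0 * (z : ℂ) + v 1)) ^ 2 := by
    have : 1 - Λ.ratio v z = Λ.y v * (Λ.a 0 - Λ.a 1 * z) / (Λ.covol * (v 0 * (z : ℂ) + v 1)) := by
      rw [ratio, eq_div_iff (mul_ne_zero hc h0), sub_mul, div_mul_cancel₀ _ (mul_ne_zero hc h0), ← e]
      ring
    rw [this, ratio, quad, div_mul_div_comm]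
    push_cast
    ring
  rw [e1, eisSummand, zpow_neg, zpow_natCast]
  set X := ((Λ.x v * Λ.y v : ℝ) : ℂ)
  set w := (v 0 * (z : ℂ) + v 1)
  rw [show 2 * (n + 1) = 2 * n + 2 by ring, pow_add w, pow_add _ (2 * n) 1, pow_one, pow_succ X, div_pow,
    mul_pow X, ← pow_mul, mul_pow _ w (2 * n)]
  field_simp

/-- Moving the point is the same as moving the vector: γ multiplies b₁z - b₀ by ε/(cz + d), where
(c, d) is its second row, the x-coordinate of the translated vector also gains ε, and the factors cz
+ d cancel. -/
lemma ratio_smul (v : Fin 2 → ℤ) (z : ℍ) :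
    Λ.ratio v (Λ.γ • z : ℍ) = Λ.ratio (vecEquiv Λ.γ v) z := by
  have hz : (((Λ.γ • z : ℍ)) : ℂ) = (((Λ.γ 0 0 : ℤ) : ℂ) * z + (Λ.γ 0 1 : ℤ)) /
      (((Λ.γ 1 0 : ℤ) : ℂ) * z + (Λ.γ 1 1 : ℤ)) := by
    simpa using UpperHalfPlane.coe_specialLinearGroup_apply Λ.γ z
  have hden : (((Λ.γ 1 0 : ℤ) : ℂ) * z + (Λ.γ 1 1 : ℤ)) ≠ 0 := by
    simpa [UpperHalfPlane.denom] using
      UpperHalfPlane.denom_ne_zero (Matrix.SpecialLinearGroup.mapGL ℝ Λ.γ) z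
  have hdet : ((Λ.γ 0 0 : ℤ) : ℝ) * (Λ.γ 1 1 : ℤ) - (Λ.γ 0 1 : ℤ) * (Λ.γ 1 0 : ℤ) = 1 := by
    have h := Λ.γ.det_coe
    rw [Matrix.det_fin_two] at h
    exact_mod_cast h
  have g0 := Λ.γ_b 0
  have g1 := Λ.γ_b 1
  have hε := Λ.ε_pos.ne'
  -- This and the next identity say that the inverse matrix has b as eigenvector with eigenvalue ε.
  have i0 : (Λ.γ 1 1 : ℝ) * Λ.b 0 - Λ.γ 0 1 * Λ.b 1 = Λ.ε * Λ.b 0 := by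
    have : Λ.b 0 = Λ.ε * (Λ.ε⁻¹ * Λ.b 0) := by field_simp
    have h1 : Λ.b 1 = Λ.ε * (Λ.ε⁻¹ * Λ.b 1) := by field_simp
    rw [← g0] at this
    rw [← g1] at h1
    linear_combination (Λ.γ 1 1 : ℝ) * this - (Λ.γ 0 1 : ℝ) * h1 + Λ.ε * Λ.b 0 * hdet
  have i1 : (Λ.γ 0 0 : ℝ) * Λ.b 1 - Λ.γ 1 0 * Λ.b 0 = Λ.ε * Λ.b 1 := by
    have : Λ.b 0 = Λ.ε * (Λ.ε⁻¹ * Λ.b 0) := by field_simp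
    have h1 : Λ.b 1 = Λ.ε * (Λ.ε⁻¹ * Λ.b 1) := by field_simp
    rw [← g0] at this
    rw [← g1] at h1
    linear_combination (Λ.γ 0 0 : ℝ) * h1 - (Λ.γ 1 0 : ℝ) * this + Λ.ε * Λ.b 1 * hdet
  have i0' := congrArg (fun r : ℝ => (r : ℂ)) i0
  have i1' := congrArg (fun r : ℝ => (r : ℂ)) i1
  push_cast at i0' i1'
  rw [ratio, ratio, hz, x_vecEquiv, vecEquiv_apply, vecEquiv_apply]
  set D := (((Λ.γ 1 0 : ℤ) : ℂ) * z + (Λ.γ 1 1 : ℤ))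
  have e1 : (Λ.b 1 : ℂ) * ((((Λ.γ 0 0 : ℤ) : ℂ) * z + (Λ.γ 0 1 : ℤ)) / D) - Λ.b 0 =
      Λ.ε * (Λ.b 1 * z - Λ.b 0) / D := by
    rw [eq_div_iff hden, sub_mul, mul_assoc, div_mul_cancel₀ _ hden]
    linear_combination (z : ℂ) * i1' - i0'
  have e2 : (v 0 : ℂ) * ((((Λ.γ 0 0 : ℤ) : ℂ) * z + (Λ.γ 0 1 : ℤ)) / D) + v 1 =
      (((v 0 * Λ.γ 0 0 + v 1 * Λ.γ 1 0 : ℤ) : ℂ) * z +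
        (v 0 * Λ.γ 0 1 + v 1 * Λ.γ 1 1 : ℤ)) / D := by
    rw [eq_div_iff hden, add_mul, mul_assoc, div_mul_cancel₀ _ hden]
    push_cast
    ring
  rw [e1, e2, mul_div_assoc', mul_div_assoc', div_div_div_cancel_right₀ hden]
  push_cast
  ring

lemma real_sub_mul_ne_zero {p q : ℝ} (h : ¬(p = 0 ∧ q = 0)) (z : ℍ) : (p * (z : ℂ) - q) ≠ 0 := by
  intro hz
  have him := congrArg Complex.im hz
  have hre := congrArg Complex.re hz
  simp at him hre
  rcases him with h' | h'
  · exact h ⟨h', by rw [h', zero_mul] at hre; linarith⟩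
  · exact z.im_pos.ne' h'

/-- Along the orbit the value is ε^j p/(ε^j p + ε^(-j) q), where p and q are nonzero because the
vector avoids both axes and z is not real. -/
lemma tendsto_ratio {v : Fin 2 → ℤ} (hv : v ≠ 0) (z : ℍ) :
    Tendsto (fun n : ℕ => Λ.ratio (vecEquiv (Λ.γ ^ (n : ℤ)) v) z) atTop (𝓝 1) ∧
    Tendsto (fun n : ℕ => Λ.ratio (vecEquiv (Λ.γ ^ (-(n : ℤ))) v) z) atTop (𝓝 0) := by
  have hcov := Λ.covol_pos
  have hb : ((Λ.b 1 : ℂ) * z - Λ.b 0) ≠ 0 := real_sub_mul_ne_zero (by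
    rintro ⟨h1, h2⟩
    simp [covol, h1, h2] at hcov) z
  have ha : ((Λ.a 0 : ℂ) - Λ.a 1 * z) ≠ 0 := by
    rw [← neg_sub]
    exact neg_ne_zero.mpr (real_sub_mul_ne_zero (by
      rintro ⟨h1, h2⟩
      simp [covol, h1, h2] at hcov) z)
  have hx : (Λ.x v : ℂ) ≠ 0 := by exact_mod_cast Λ.x_ne_zero hv
  have hy : (Λ.y v : ℂ) ≠ 0 := by exact_mod_cast Λ.y_ne_zero hv
  set p := (Λ.x v : ℂ) * (Λ.b 1 * z - Λ.b 0) with hp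
  set q := (Λ.y v : ℂ) * (Λ.a 0 - Λ.a 1 * z) with hq
  have hp0 : p ≠ 0 := mul_ne_zero hx hb
  have hq0 : q ≠ 0 := mul_ne_zero hy ha
  have hr : ∀ j : ℤ, Λ.ratio (vecEquiv (Λ.γ ^ j) v) z =
      ((Λ.ε : ℂ) ^ j * p) / ((Λ.ε : ℂ) ^ j * p + (Λ.ε : ℂ) ^ (-j) * q) := by
    intro j
    rw [ratio, ← x_mul_add_y_mul, x_vecEquiv_zpow, y_vecEquiv_zpow, hp, hq]
    push_cast
    simp only [mul_assoc]
  have hε : (Λ.ε : ℂ) ≠ 0 := by exact_mod_cast Λ.ε_pos.ne'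
  have ht : Tendsto (fun n : ℕ => (((Λ.ε : ℂ)⁻¹) ^ 2) ^ n) atTop (𝓝 0) := by
    refine tendsto_pow_atTop_nhds_zero_of_norm_lt_one ?_
    rw [norm_pow, norm_inv, Complex.norm_real, Real.norm_of_nonneg Λ.ε_pos.le]
    exact pow_lt_one₀ (inv_nonneg.mpr Λ.ε_pos.le) (inv_lt_one_of_one_lt₀ Λ.one_lt) two_ne_zero
  constructor
  · have h := (tendsto_const_nhds (x := p)).div ((ht.mul_const q).const_add p)
      (by simpa using hp0)
    rw [zero_mul, add_zero, div_self hp0] at h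
    refine h.congr fun n => ?_
    rw [hr, zpow_neg, zpow_natCast, Pi.div_apply, ← mul_div_mul_left _ _ (pow_ne_zero n hε)]
    congr 1
    rw [mul_add, ← pow_mul, mul_comm 2 n, pow_mul, sq, inv_pow]
    field_simp
  · have h := (ht.mul_const p).div ((ht.mul_const p).add_const q) (by simpa using hq0)
    rw [zero_mul, zero_add, zero_div] at h
    refine h.congr fun n => ?_
    rw [hr, neg_neg, zpow_neg, zpow_natCast, Pi.div_apply,
      ← mul_div_mul_left _ _ (pow_ne_zero n hε)]
    have e : (Λ.ε : ℂ) ^ n * (((Λ.ε : ℂ)⁻¹) ^ 2) ^ n = ((Λ.ε : ℂ) ^ n)⁻¹ := by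
      rw [← pow_mul, mul_comm 2 n, pow_mul, sq, inv_pow]
      field_simp
    rw [mul_add, ← mul_assoc, e]

/-- Unfolding of the integral of the lattice sum along a fundamental segment of the automorphism. -/
theorem hasSum_lineIntegral {n : ℕ} (hn : 1 ≤ n) (z : ℍ) :
    HasSum (fun d : Λ.fundDomain => (Λ.covol : ℂ) ^ (2 * n + 1) *
        (((Λ.x d * Λ.y d : ℝ) : ℂ) ^ (n + 1))⁻¹ * Complex.betaIntegral (n + 1 : ℕ) (n + 1 : ℕ))
      (lineIntegral (fun z => (∑' v : Fin 2 → ℤ, eisSummand (2 * (n + 1) : ℕ) v z) * Λ.quad z ^ n)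
        z (Λ.γ • z)) := by
  obtain ⟨P, hP, hP1⟩ := exists_betaPrimitive n
  have hdiff : Differentiable ℂ fun z => Λ.quad z ^ n := Λ.differentiable_quad.pow n
  have h := hasSum_lineIntegral_eisSummand (k := 2 * (n + 1)) (by omega) hdiff z (Λ.γ • z)
  set I : (Fin 2 → ℤ) → ℂ := fun v =>
    lineIntegral (fun z => eisSummand (2 * (n + 1) : ℕ) v z * Λ.quad z ^ n) z (Λ.γ • z) with hI
  -- The zero vector may stay in the lattice sum because a negative power of 0 is 0 by convention.
  have hI0 : I 0 = 0 := by
    simp only [hI, lineIntegral, eisSummand]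
    have : ((0 : ℂ)) ^ (-((2 * (n + 1) : ℕ) : ℤ)) = 0 := zero_zpow _ (by omega)
    simp only [Pi.zero_apply, Int.cast_zero, zero_mul, zero_add, this,
      intervalIntegral.integral_zero]
  have hI1 : ∀ v ≠ 0, I v = (Λ.covol : ℂ) ^ (2 * n + 1) *
      (((Λ.x v * Λ.y v : ℝ) : ℂ) ^ (n + 1))⁻¹ *
        (P (Λ.ratio (vecEquiv Λ.γ v) z) - P (Λ.ratio v z)) := by
    intro v hv
    simp only [hI]
    rw [lineIntegral_eq (hol_eisSummand_mul _ v hdiff) (Λ.hasDerivAt_primitive hP hv), ratio_smul]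
    ring
  have h' : HasSum (fun v : {v : Fin 2 → ℤ // v ≠ 0} => I v) (lineIntegral (fun z =>
      (∑' v : Fin 2 → ℤ, eisSummand (2 * (n + 1) : ℕ) v z) * Λ.quad z ^ n) z (Λ.γ • z)) := by
    refine (hasSum_subtype_iff_of_support_subset (s := {v : Fin 2 → ℤ | v ≠ 0}) ?_).mpr h
    intro v hv hv0
    exact hv (by rw [hv0, hI0])
  have h2 := (Equiv.prodComm _ _ |>.trans Λ.translateEquiv).hasSum_iff.mpr h'
  -- On one orbit xy is constant and the integrals are differences of the primitive at consecutive
  -- vectors. The telescoped sum is the constant times P(1) - P(0).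
  refine h2.prod_fiberwise fun d => ?_
  have hd : (d : Fin 2 → ℤ) ≠ 0 := d.2.1
  have hε : Λ.ε ≠ 0 := Λ.ε_pos.ne'
  set c := (Λ.covol : ℂ) ^ (2 * n + 1) * (((Λ.x d * Λ.y d : ℝ) : ℂ) ^ (n + 1))⁻¹ with hc
  have hterm : ∀ j : ℤ, ((fun v : {v : Fin 2 → ℤ // v ≠ 0} => I v) ∘
      (Equiv.prodComm _ _ |>.trans Λ.translateEquiv)) (d, j) =
      c * P (Λ.ratio (vecEquiv (Λ.γ ^ (j + 1)) d) z) - c * P (Λ.ratio (vecEquiv (Λ.γ ^ j) d) z) := by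
    intro j
    change I (vecEquiv (Λ.γ ^ j) d) = _
    rw [hI1 _ (vecEquiv_ne_zero _ hd), x_vecEquiv_zpow, y_vecEquiv_zpow, zpow_add_one,
      vecEquiv_mul, ← mul_sub]
    rw [show Λ.ε ^ j * Λ.x d * (Λ.ε ^ (-j) * Λ.y d) = Λ.x d * Λ.y d by
      rw [zpow_neg]; field_simp]
  have hs := h2.summable.comp_injective (i := fun j : ℤ => (d, j)) fun a b h => by simpa using h
  simp only [Function.comp_def] at hs hterm
  simp only [hterm, Function.comp_def] at hs ⊢
  obtain ⟨t1, t2⟩ := Λ.tendsto_ratio hd z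
  have hPc : Continuous P := continuous_iff_continuousAt.mpr fun u => (hP u).continuousAt
  have := hasSum_int_sub (f := fun j => c * P (Λ.ratio (vecEquiv (Λ.γ ^ j) d) z)) hs
    (((hPc.tendsto 1).comp t1).const_mul c) (((hPc.tendsto 0).comp t2).const_mul c)
  rw [← mul_sub, hP1] at this
  exact this

end HyperbolicLattice
end HeckeCycle

/-! ### The Eisenstein pairing as a sum over the lattice of an ideal -/

namespace HeckeCycle

open EisensteinSeries

/-- Pairing with (X₁ - zX₂)^n evaluates a form at (-z, -1). The computation is made on coefficients
with primitives of f(z)z^ν, so that no exchange of sum and integral is needed. -/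
lemma formPairing_periodForm {n : ℕ} (f : ModularForm 𝒮ℒ ((n + 2 : ℕ) : ℤ)) (α β : ℍ)
    (Q : Form ℤ n) :
    formPairing n (periodForm f α β) Q =
      lineIntegral (fun z => f z * MvPolynomial.aeval ![-(z : ℂ), -1] Q.poly) α β := by
  have hH : ∀ ν : ℕ, Hol fun z => f z * (z : ℂ) ^ ν := fun ν =>
    hol_mul f (F := fun z => z ^ ν) (by fun_prop)
  choose G hG using fun ν => (hH ν).exists_primitive
  have hQ : ∀ z : ℂ, MvPolynomial.aeval ![-z, -1] Q.poly = ∑ ν ∈ Finset.range (n + 1),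
      ((Q.poly.coeff (expo ν (n - ν)) : ℤ) : ℂ) * (-1) ^ n * z ^ ν := by
    intro z
    rw [Q.poly_eq_sum, map_sum]
    refine Finset.sum_congr rfl fun ν hν => ?_
    rw [← Q.poly_eq_sum, MvPolynomial.aeval_monomial]
    have hν' : ν ≤ n := by have := Finset.mem_range.mp hν; omega
    have h3 : (expo ν (n - ν)).prod (fun i k => (![-z, -1] : Fin 2 → ℂ) i ^ k) =
        (-z) ^ ν * (-1) ^ (n - ν) := by
      simp [expo, Finsupp.prod_add_index', pow_add, Finsupp.prod_single_index]
    rw [h3, neg_pow z, eq_intCast]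
    have h4 : (-1 : ℂ) ^ n = (-1) ^ ν * (-1) ^ (n - ν) := by
      rw [← pow_add, Nat.add_sub_cancel' hν']
    rw [h4]
    ring
  have hK : ∀ z : ℍ, HasDerivAt (fun z : ℂ => ∑ ν ∈ Finset.range (n + 1),
      (((Q.poly.coeff (expo ν (n - ν)) : ℤ) : ℂ) * (-1) ^ n) * G ν z)
      (f z * MvPolynomial.aeval ![-(z : ℂ), -1] Q.poly) z := by
    intro z
    have h := HasDerivAt.fun_sum (u := Finset.range (n + 1)) (x := (z : ℂ))
      (A := fun ν (z : ℂ) => (((Q.poly.coeff (expo ν (n - ν)) : ℤ) : ℂ) * (-1) ^ n) * G ν z)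
      (A' := fun ν => (((Q.poly.coeff (expo ν (n - ν)) : ℤ) : ℂ) * (-1) ^ n) * (f z * (z : ℂ) ^ ν))
      fun ν _ => (hG ν z).const_mul _
    refine h.congr_deriv (Eq.symm ?_)
    rw [hQ, Finset.mul_sum]
    refine Finset.sum_congr rfl fun ν _ => ?_
    ring
  have hH' : Hol fun z => f z * MvPolynomial.aeval ![-(z : ℂ), -1] Q.poly :=
    hol_mul f (F := fun z => MvPolynomial.aeval ![-z, -1] Q.poly) (by
      simp only [hQ]
      fun_prop)
  rw [lineIntegral_eq hH' hK, ← Finset.sum_sub_distrib, formPairing_apply]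
  refine Finset.sum_congr rfl fun ν hν => ?_
  have hν' : ν ≤ n := by have := Finset.mem_range.mp hν; omega
  have h1 : (periodForm f α β).poly.coeff (expo (n - ν) ν) =
      (n.choose ν : ℂ) * (-1) ^ ν * lineIntegral (fun z => f z * (z : ℂ) ^ ν) α β := by
    rw [periodForm, Form.poly_mk, MvPolynomial.coeff_sum, Finset.sum_eq_single ν]
    · rw [MvPolynomial.coeff_monomial, if_pos rfl]
    · intro b _ hb
      rw [MvPolynomial.coeff_monomial, if_neg (fun h => hb (expo_inj.mp h).2)]
    · intro h
      exact absurd hν h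
  have h : (n.choose ν : ℂ) ≠ 0 := by exact_mod_cast (Nat.choose_pos hν').ne'
  have h4 : (-1 : ℂ) ^ n = (-1) ^ ν * (-1) ^ (n - ν) := by
    rw [← pow_add, Nat.add_sub_cancel' hν']
  have h5 : ((-1 : ℂ) ^ (n - ν)) * (-1) ^ (n - ν) = 1 := by
    rw [← mul_pow]; simp
  have h6 : ((-1 : ℂ) ^ (n - ν)) ≠ 0 := pow_ne_zero _ (by norm_num)
  rw [h1, lineIntegral_eq (hH ν) (hG ν), h4]
  field_simp
  linear_combination (-((G ν β - G ν α) * ((Q.poly.coeff (expo ν (n - ν)) : ℤ) : ℂ))) * h5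

lemma pairing_eichlerShimura {n : ℕ} (f : ModularForm 𝒮ℒ ((n + 2 : ℕ) : ℤ)) (γ : SL(2, ℤ))
    (Q : Form ℤ n) (hQ : formRep ℤ n γ Q = Q) (τ : ℍ) :
    pairing n (eichlerShimura f) (hyperbolicClass (formRep ℤ n) γ Q hQ τ) =
      lineIntegral (fun z => f z * MvPolynomial.aeval ![-(z : ℂ), -1] Q.poly) τ (γ • τ) := by
  rw [← formPairing_periodForm, ← msPeriod_path]
  rfl

/-- The series with constant term 1 is half the sum over coprime pairs; the greatest common divisor
of a general pair contributes the factor ζ(k). -/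
lemma E_apply {k : ℕ} (hk : 3 ≤ k) (z : ℍ) :
    ModularForm.E hk z = (2 * riemannZeta k)⁻¹ * ∑' v : Fin 2 → ℤ, eisSummand k v z := by
  have hz : riemannZeta k ≠ 0 := riemannZeta_ne_zero_of_one_lt_re (by
    rw [Complex.natCast_re]; exact_mod_cast (by omega : 1 < k))
  rw [tsum_eisSummand_eq_riemannZeta_mul_eisensteinSeries hk]
  have : ModularForm.E hk z = (1 / 2 : ℂ) * eisensteinSeries (N := 1) 0 k z := rfl
  rw [this]
  field_simp

lemma lineIntegral_const_mul (c : ℂ) (g : ℍ → ℂ) (α β : ℍ) :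
    lineIntegral (fun z => c * g z) α β = c * lineIntegral g α β := by
  simp only [lineIntegral, mul_assoc, intervalIntegral.integral_const_mul]

namespace CycleData

variable {F : Type*} [Field F] [NumberField F] (hF : Module.finrank ℚ F = 2) {ι ι' : F →+* ℝ}
  (hι : ι ≠ ι') {O : Subring F} [Module.Finite ℤ O] [IsFractionRing O F] {A : NarrowClassGroup O}
  (d : CycleData ι ι' O A)

/-- Multiplication by the unit scales the oriented covolume by εε', while its matrix has determinant
1; the covolume is not zero. -/
lemma mul_conj_unit : ι (d.unit : O) * ι' (d.unit : O) = 1 := by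
  set α₁ : F := (d.basis 0 : F) with hα₁
  set α₂ : F := (d.basis 1 : F) with hα₂
  set ε : F := ((d.unit : O) : F) with hε
  have a1 := congrArg ι d.matrix_mul_zero
  have a2 := congrArg ι d.matrix_mul_one
  have b1 := congrArg ι' d.matrix_mul_zero
  have b2 := congrArg ι' d.matrix_mul_one
  simp only [map_add, map_mul, map_intCast, ← hα₁, ← hα₂, ← hε] at a1 a2 b1 b2
  have hdet : ((d.matrix 0 0 : ℤ) : ℝ) * (d.matrix 1 1 : ℤ) -
      (d.matrix 0 1 : ℤ) * (d.matrix 1 0 : ℤ) = 1 := by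
    have h := d.matrix.det_coe
    rw [Matrix.det_fin_two] at h
    exact_mod_cast h
  have hΔ := d.orientation
  rw [← hα₁, ← hα₂] at hΔ
  have h : (ι ε * ι' ε - 1) * (ι α₁ * ι' α₂ - ι' α₁ * ι α₂) = 0 := by
    linear_combination (ι α₁ * ι' α₂ - ι' α₁ * ι α₂) * hdet - (ι' ε * ι' α₂) * a1 -
      (((d.matrix 0 0 : ℤ) : ℝ) * ι α₁ + (d.matrix 0 1 : ℤ) * ι α₂) * b2 +
      (ι' ε * ι' α₁) * a2 +
      (((d.matrix 1 0 : ℤ) : ℝ) * ι α₁ + (d.matrix 1 1 : ℤ) * ι α₂) * b1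
  have := (mul_eq_zero.mp h).resolve_right hΔ.ne'
  linarith

/-- The element of the ideal with given coordinates. -/
def vec (v : Fin 2 → ℤ) : F := v 0 * (d.basis 0 : F) + v 1 * (d.basis 1 : F)

lemma vec_eq (v : Fin 2 → ℤ) : d.vec v = (d.basis.equivFun.symm v : F) := by
  rw [Module.Basis.equivFun_symm_apply, Fin.sum_univ_two]
  simp [vec]

lemma vec_ne_zero {v : Fin 2 → ℤ} (hv : v ≠ 0) : d.vec v ≠ 0 := by
  rw [vec_eq]
  intro h
  apply hv
  exact (LinearEquiv.map_eq_zero_iff _).mp (Subtype.ext h)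

/-- The lattice in `ℝ²` of the embedded ideal, with its automorphism by the unit. -/
def lattice : HyperbolicLattice where
  a i := ι (d.basis i)
  b i := ι' (d.basis i)
  covol_pos' := by
    have := d.orientation
    linarith
  x_ne_zero' v hv := by
    have := (map_ne_zero ι).mpr (d.vec_ne_zero hv)
    simpa [vec] using this
  y_ne_zero' v hv := by
    have := (map_ne_zero ι').mpr (d.vec_ne_zero hv)
    simpa [vec] using this
  ε := ι (d.unit : O)
  one_lt := d.one_lt_unit
  γ := d.matrix
  γ_a := by
    have a1 := congrArg ι d.matrix_mul_zero
    have a2 := congrArg ι d.matrix_mul_one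
    simp only [map_add, map_mul, map_intCast] at a1 a2
    exact Fin.forall_fin_two.mpr ⟨a1, a2⟩
  γ_b := by
    have b1 := congrArg ι' d.matrix_mul_zero
    have b2 := congrArg ι' d.matrix_mul_one
    simp only [map_add, map_mul, map_intCast] at b1 b2
    rw [inv_eq_of_mul_eq_one_right d.mul_conj_unit]
    exact Fin.forall_fin_two.mpr ⟨b1, b2⟩

lemma lattice_x (v : Fin 2 → ℤ) : d.lattice.x v = ι (d.vec v) := by
  simp [HyperbolicLattice.x, vec, lattice]

lemma lattice_y (v : Fin 2 → ℤ) : d.lattice.y v = ι' (d.vec v) := by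
  simp [HyperbolicLattice.y, vec, lattice]

lemma aeval_form (z : ℂ) : MvPolynomial.aeval ![-z, -1] (d.form hF hι).poly =
    ((idealNorm O d.ideal : ℚ) : ℂ)⁻¹ * d.lattice.quad z := by
  have h := MvPolynomial.aeval_map_algebraMap ℝ (![-z, -1] : Fin 2 → ℂ) (d.form hF hι).poly
  rw [← h, algebraMap_int_eq, form, map_normForm, realNormForm]
  simp [HyperbolicLattice.quad, lattice]
  ring

/-- The pairing with the Eisenstein class, as a sum over the lattice modulo the automorphism. -/
theorem hasSum_pairing {k : ℕ} (hk : 2 ≤ k) (hn : 2 ≤ 2 * (k - 1)) :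
    HasSum (fun v : d.lattice.fundDomain => (2 * riemannZeta (2 * k))⁻¹ *
        (((idealNorm O d.ideal : ℚ) : ℂ)⁻¹) ^ (k - 1) * (d.lattice.covol : ℂ) ^ (2 * k - 1) *
        (((d.lattice.x v * d.lattice.y v : ℝ) : ℂ) ^ k)⁻¹ * Complex.betaIntegral k k)
      (pairing (2 * (k - 1)) (Eis (2 * (k - 1)) hn) (d.cycle hF hι k)) := by
  obtain ⟨m, rfl⟩ : ∃ m, k = m + 1 := ⟨k - 1, by omega⟩
  rw [cycle, Eis, pairing_eichlerShimura]
  have h := (d.lattice.hasSum_lineIntegral (n := m) (by omega) d.basePoint).mul_left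
    ((2 * riemannZeta (2 * (m + 1 : ℕ)))⁻¹ * (((idealNorm O d.ideal : ℚ) : ℂ)⁻¹) ^ m)
  rw [← lineIntegral_const_mul] at h
  have hE : ∀ z : ℍ, ModularForm.E (k := 2 * (m + 1 - 1) + 2) (by omega) z *
      MvPolynomial.aeval ![-(z : ℂ), -1] ((d.form hF hι).pow (m + 1 - 1)).poly =
      (2 * riemannZeta (2 * (m + 1 : ℕ)))⁻¹ * (((idealNorm O d.ideal : ℚ) : ℂ)⁻¹) ^ m *
        ((∑' v : Fin 2 → ℤ, eisSummand (2 * (m + 1) : ℕ) v z) * d.lattice.quad z ^ m) := by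
    intro z
    have e : ((2 * (m + 1 - 1) + 2 : ℕ) : ℂ) = 2 * (m + 1 : ℕ) := by push_cast [Nat.add_sub_cancel]; ring
    have hp : ((d.form hF hι).pow (m + 1 - 1)).poly = (d.form hF hι).poly ^ m := rfl
    rw [E_apply, e, hp, map_pow, aeval_form, mul_pow]
    change _ * (∑' v : Fin 2 → ℤ, eisSummand (2 * (m + 1) : ℕ) v z) * (_ ^ m * _ ^ m) = _
    ring
  rw [funext hE]
  refine (congrArg (fun f => HasSum f _) (funext fun v => ?_)).mp h
  rw [show 2 * (m + 1) - 1 = 2 * m + 1 by omega, Nat.add_sub_cancel]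
  ring

end CycleData
end HeckeCycle

/-! ### Indices and norms of invertible ideals of an order -/

namespace HeckeCycle

/-- Over the finite ring R/I, which has finitely many maximal ideals, an invertible module is free
of rank one. This replaces unique factorization, which fails in orders that are not maximal. -/
lemma nonempty_quotient_equiv {R : Type*} [CommRing R] (I : Ideal R) [Finite (R ⧸ I)]
    (M : Type*) [AddCommGroup M] [Module R M] [Module.Invertible R M] :
    Nonempty ((M ⧸ (I • ⊤ : Submodule R M)) ≃ (R ⧸ I)) := by
  have : Finite (MaximalSpectrum (R ⧸ I)) :=
    Finite.of_injective (fun P => P.asIdeal) fun P Q h => MaximalSpectrum.ext h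
  obtain ⟨e⟩ := Module.Invertible.free_iff_linearEquiv.mp
    (inferInstance : Module.Free (R ⧸ I) ((R ⧸ I) ⊗[R] M))
  exact ⟨(TensorProduct.quotTensorEquivQuotSMul M I).symm.toEquiv.trans e.toEquiv⟩

section

variable {F : Type*} [Field F] [NumberField F] (O : Subring F) [Module.Finite ℤ O]
  [IsFractionRing O F]

lemma mulOrder_one : mulOrder O 1 = O.toAddSubgroup := by
  ext z; simp [mulOrder]

lemma mulOrder_eq_span (x : F) : mulOrder O x = (Submodule.span O {x}).toAddSubgroup := by
  ext z
  rw [Submodule.mem_toAddSubgroup, Submodule.mem_span_singleton]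
  constructor
  · rintro ⟨w, hw, rfl⟩
    exact ⟨⟨w, hw⟩, mul_comm _ _⟩
  · rintro ⟨w, rfl⟩
    exact ⟨w, w.2, mul_comm _ _⟩

lemma mulOrder_le {L : Submodule O F} {x : F} (hx : x ∈ L) : mulOrder O x ≤ L.toAddSubgroup := by
  rw [mulOrder_eq_span]
  exact (Submodule.span_singleton_le_iff_mem x L).mpr hx

lemma algebraNorm_ne_zero {x : F} (hx : x ≠ 0) : Algebra.norm ℚ x ≠ 0 :=
  Algebra.norm_ne_zero_iff.mpr hx

lemma relIndex_mulOrder_ne_zero {x : F} (hx : x ∈ O) (h0 : x ≠ 0) :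
    (mulOrder O x).relIndex O.toAddSubgroup ≠ 0 := by
  have hi := mulOrder_relIndex O h0 one_ne_zero ⟨x, hx, by rw [one_mul]⟩
  rw [mulOrder_one, div_one] at hi
  intro h
  rw [h, Nat.cast_zero] at hi
  exact (abs_ne_zero.mpr (algebraNorm_ne_zero h0)) hi.symm

/-- The norm of an element of an ideal in terms of the index. -/
lemma abs_norm_div_idealNorm (𝔞 : FractionalIdeal O⁰ F) {α : F} (hα : α ∈ (𝔞 : Submodule O F))
    (h0 : α ≠ 0) :
    (mulOrder O α).relIndex (𝔞 : Submodule O F).toAddSubgroup ≠ 0 ∧ idealNorm O 𝔞 ≠ 0 ∧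
    |Algebra.norm ℚ α| / idealNorm O 𝔞 =
      (mulOrder O α).relIndex (𝔞 : Submodule O F).toAddSubgroup := by
  set L := (𝔞 : Submodule O F).toAddSubgroup with hL
  have hαL : mulOrder O α ≤ L := mulOrder_le O hα
  -- A denominator d moves the ideal into O, where the index of dαO is the absolute norm of dα and
  -- hence not zero.
  obtain ⟨d, hd, hdL⟩ := 𝔞.isFractional
  have hs : (mulOrder O α).relIndex L ≠ 0 := by
    have hd0 : (d : F) ≠ 0 := by
      intro h
      exact nonZeroDivisors.ne_zero hd (Subtype.ext h)
    have hinj : Function.Injective (AddMonoidHom.mulLeft (d : F)) := mul_right_injective₀ hd0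
    rw [← AddSubgroup.relIndex_map_map_of_injective _ _ hinj]
    have e : (mulOrder O α).map (AddMonoidHom.mulLeft (d : F)) = mulOrder O (d * α) := by
      ext z; simp [mulOrder, mul_assoc]
    have hle : mulOrder O (d * α) ≤ L.map (AddMonoidHom.mulLeft (d : F)) :=
      e ▸ AddSubgroup.map_mono hαL
    have hle' : L.map (AddMonoidHom.mulLeft (d : F)) ≤ O.toAddSubgroup := by
      rintro _ ⟨w, hw, rfl⟩
      obtain ⟨v, hv⟩ := hdL w hw
      have : (v : F) = d * w := hv
      change (d : F) * w ∈ O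
      rw [← this]
      exact v.2
    have hi0 := relIndex_mulOrder_ne_zero O (hle' ⟨α, hα, rfl⟩ : (d : F) * α ∈ O)
      (mul_ne_zero hd0 h0)
    rw [e]
    intro h
    apply hi0
    rw [← AddSubgroup.relIndex_mul_relIndex _ _ _ hle hle', h, zero_mul]
  -- The ideal and O need not contain one another. With α = p/q, all indices are compared through
  -- pO, which lies in both.
  obtain ⟨p, q, hq, hpq⟩ := IsFractionRing.div_surjective (A := O) α
  have hq0 : (q : F) ≠ 0 := by
    intro h
    exact nonZeroDivisors.ne_zero hq (Subtype.ext h)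
  have hp : (p : F) = α * q := by
    rw [← hpq]
    change (p : F) = (p : F) / q * q
    rw [div_mul_cancel₀ _ hq0]
  have hp0 : (p : F) ≠ 0 := hp ▸ mul_ne_zero h0 hq0
  have hpα : mulOrder O (p : F) ≤ mulOrder O α := by
    rw [hp]
    rintro _ ⟨w, hw, rfl⟩
    exact ⟨q * w, O.mul_mem q.2 hw, by simp [mul_assoc]⟩
  have hpO : mulOrder O (p : F) ≤ O.toAddSubgroup := by
    rintro _ ⟨w, hw, rfl⟩
    exact O.mul_mem p.2 hw
  have i1 := mulOrder_relIndex O hp0 one_ne_zero ⟨(p : F), p.2, by rw [one_mul]⟩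
  have i2 := mulOrder_relIndex O hp0 h0 ⟨(q : F), q.2, hp⟩
  rw [mulOrder_one, div_one] at i1
  have e2 : (p : F) / α = q := by rw [hp]; field_simp
  rw [e2] at i2
  have hc1 : mulOrder O (p : F) ≤ L ⊓ O.toAddSubgroup := le_inf (hpα.trans hαL) hpO
  have j1 := AddSubgroup.relIndex_mul_relIndex _ _ _ hc1 inf_le_right
  have j2 := AddSubgroup.relIndex_mul_relIndex _ _ _ hc1 inf_le_left
  have j3 := AddSubgroup.relIndex_mul_relIndex _ _ _ hpα hαL
  rw [AddSubgroup.inf_relIndex_right] at j1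
  rw [AddSubgroup.inf_relIndex_left, ← j3] at j2
  set s := (mulOrder O α).relIndex L
  set y := (mulOrder O (p : F)).relIndex (L ⊓ O.toAddSubgroup)
  set u := L.relIndex O.toAddSubgroup
  set w := O.toAddSubgroup.relIndex L
  have k1 : (y : ℚ) * u = |Algebra.norm ℚ (p : F)| := by rw [← i1]; exact_mod_cast j1
  have k2 : (y : ℚ) * w = |Algebra.norm ℚ (q : F)| * s := by rw [← i2]; exact_mod_cast j2
  have hNq : |Algebra.norm ℚ (q : F)| ≠ 0 := abs_ne_zero.mpr (algebraNorm_ne_zero hq0)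
  have hsQ : (s : ℚ) ≠ 0 := by exact_mod_cast hs
  have hyw : (y : ℚ) * w ≠ 0 := k2 ▸ mul_ne_zero hNq hsQ
  have hy0 : (y : ℚ) ≠ 0 := left_ne_zero_of_mul hyw
  have hw0 : (w : ℚ) ≠ 0 := right_ne_zero_of_mul hyw
  have k3 : (y : ℚ) * u = |Algebra.norm ℚ α| * |Algebra.norm ℚ (q : F)| := by
    rw [k1, hp, map_mul, abs_mul]
  have hu0 : (u : ℚ) ≠ 0 := by
    refine right_ne_zero_of_mul (a := (y : ℚ)) ?_
    rw [k3]
    exact mul_ne_zero (abs_ne_zero.mpr (algebraNorm_ne_zero h0)) hNq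
  refine ⟨hs, div_ne_zero hu0 hw0, ?_⟩
  change |Algebra.norm ℚ α| / ((u : ℚ) / w) = s
  rw [div_div_eq_mul_div, div_eq_iff hu0]
  apply mul_left_cancel₀ (mul_ne_zero hNq hy0)
  linear_combination (|Algebra.norm ℚ (q : F)| * |Algebra.norm ℚ α|) * k2 -
    (s : ℚ) * |Algebra.norm ℚ (q : F)| * k3

lemma exists_mem_ne_zero (𝔞 : (FractionalIdeal O⁰ F)ˣ) :
    ∃ α ∈ ((𝔞 : FractionalIdeal O⁰ F) : Submodule O F), α ≠ 0 := by
  by_contra! h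
  apply 𝔞.ne_zero
  rw [FractionalIdeal.eq_zero_iff]
  exact h

lemma idealNorm_pos (𝔞 : (FractionalIdeal O⁰ F)ˣ) : 0 < idealNorm O 𝔞 := by
  obtain ⟨α, hα, h0⟩ := exists_mem_ne_zero O 𝔞
  refine lt_of_le_of_ne ?_ (abs_norm_div_idealNorm O 𝔞 hα h0).2.1.symm
  unfold idealNorm
  positivity

lemma relIndex_eq_card_quotient {R M : Type*} [CommRing R] [AddCommGroup M] [Module R M]
    (N : Submodule R M) (N' : Submodule R N) :
    (N'.map N.subtype).toAddSubgroup.relIndex N.toAddSubgroup = Nat.card (N ⧸ N') := by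
  have h := N'.toAddSubgroup.index_eq_card
  rw [AddSubgroup.relIndex]
  have e : (N'.map N.subtype).toAddSubgroup.addSubgroupOf N.toAddSubgroup = N'.toAddSubgroup := by
    ext x
    rw [AddSubgroup.mem_addSubgroupOf]
    constructor
    · rintro ⟨y, hy, h⟩
      have : y = x := Subtype.ext h
      exact this ▸ hy
    · intro hx
      exact ⟨x, hx, rfl⟩
  exact (congrArg AddSubgroup.index e).trans h

/-- Multiplication by an invertible ideal preserves the index of an integral ideal. -/
lemma relIndex_mul (𝔞 𝔟 : (FractionalIdeal O⁰ F)ˣ) (hb : (𝔟 : FractionalIdeal O⁰ F) ≤ 1) :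
    ((𝔟 * 𝔞 : FractionalIdeal O⁰ F) : Submodule O F).toAddSubgroup.relIndex
      ((𝔞 : FractionalIdeal O⁰ F) : Submodule O F).toAddSubgroup =
    ((𝔟 : FractionalIdeal O⁰ F) : Submodule O F).toAddSubgroup.relIndex O.toAddSubgroup := by
  obtain ⟨I, hI⟩ := FractionalIdeal.le_one_iff_exists_coeIdeal.mp hb
  obtain ⟨β, hβ, hβ0⟩ := exists_mem_ne_zero O 𝔟
  -- The index of 𝔟𝔠 in 𝔠 is the order of 𝔠/I𝔠, with I the ideal 𝔟 inside O. It is used for 𝔠 = O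
  -- and for 𝔠 = 𝔞, where both quotients have the size of O/I.
  have hcard : ∀ 𝔠 : (FractionalIdeal O⁰ F)ˣ,
      ((𝔟 * 𝔠 : FractionalIdeal O⁰ F) : Submodule O F).toAddSubgroup.relIndex
        ((𝔠 : FractionalIdeal O⁰ F) : Submodule O F).toAddSubgroup =
      Nat.card (((𝔠 : FractionalIdeal O⁰ F) : Submodule O F) ⧸
        (I • ⊤ : Submodule O ((𝔠 : FractionalIdeal O⁰ F) : Submodule O F))) := by
    intro 𝔠
    rw [← relIndex_eq_card_quotient, Submodule.map_smul'', Submodule.map_top,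
      Submodule.range_subtype, FractionalIdeal.coe_mul, ← hI]
    congr 2
    apply le_antisymm
    · rw [Submodule.mul_le]
      rintro _ ⟨r, hr, rfl⟩ n hn
      rw [Algebra.linearMap_apply, ← Algebra.smul_def]
      exact Submodule.smul_mem_smul hr hn
    · rw [Submodule.smul_le]
      intro r hr n hn
      rw [Algebra.smul_def]
      exact Submodule.mul_mem_mul ⟨r, hr, rfl⟩ hn
  have h1 := hcard 1
  have hone : ((1 : FractionalIdeal O⁰ F) : Submodule O F).toAddSubgroup = O.toAddSubgroup := by
    ext z
    rw [Submodule.mem_toAddSubgroup, FractionalIdeal.mem_coe, FractionalIdeal.mem_one_iff]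
    exact ⟨by rintro ⟨w, rfl⟩; exact w.2, fun h => ⟨⟨z, h⟩, rfl⟩⟩
  have hinv : ∀ 𝔠 : (FractionalIdeal O⁰ F)ˣ,
      Module.Invertible O ((𝔠 : FractionalIdeal O⁰ F) : Submodule O F) := fun 𝔠 =>
    inferInstanceAs (Module.Invertible O
      ((Units.map (FractionalIdeal.coeSubmoduleHom O⁰ F).toMonoidHom 𝔠 : (Submodule O F)ˣ) :
        Submodule O F))
  -- A nonzero β in 𝔟 gives βO ⊆ 𝔟 ⊆ O with βO of finite index.
  have hfin : Finite (O ⧸ I) := by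
    have hβO : β ∈ O := by
      have := hb hβ
      rw [FractionalIdeal.mem_one_iff] at this
      obtain ⟨w, rfl⟩ := this
      exact w.2
    have hne : ((𝔟 : FractionalIdeal O⁰ F) : Submodule O F).toAddSubgroup.relIndex
        O.toAddSubgroup ≠ 0 := by
      intro h
      exact relIndex_mulOrder_ne_zero O hβO hβ0
        (AddSubgroup.relIndex_eq_zero_of_le_left (mulOrder_le O hβ) h)
    have e : I.toAddSubgroup = ((𝔟 : FractionalIdeal O⁰ F) : Submodule O F).toAddSubgroup.comap
        O.subtype.toAddMonoidHom := by
      rw [← hI]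
      ext z
      constructor
      · intro hz
        exact ⟨z, hz, rfl⟩
      · rintro ⟨w, hw, h⟩
        have : w = z := Subtype.ext h
        exact this ▸ hw
    have : I.toAddSubgroup.index ≠ 0 := by
      rw [e]
      exact hne
    have : I.toAddSubgroup.FiniteIndex := ⟨this⟩
    exact (inferInstance : Finite (O ⧸ I.toAddSubgroup))
  obtain ⟨e1⟩ := @nonempty_quotient_equiv _ _ I _ _ _ _ (hinv 1)
  obtain ⟨e2⟩ := @nonempty_quotient_equiv _ _ I _ _ _ _ (hinv 𝔞)
  rw [Nat.card_congr e1, Units.val_one, mul_one, hone, ← Nat.card_congr e2, ← hcard] at h1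
  exact h1.symm

/-- Since 𝔟𝔞 = uO lies in 𝔞, the quotient on the right is the index of 𝔟𝔞 in 𝔞, which is that of 𝔟
in O. -/
lemma idealNorm_eq_div (𝔞 𝔟 : (FractionalIdeal O⁰ F)ˣ) (hb : (𝔟 : FractionalIdeal O⁰ F) ≤ 1)
    {u : F} (hu : u ≠ 0)
    (h : (𝔟 * 𝔞 : FractionalIdeal O⁰ F) = FractionalIdeal.spanSingleton O⁰ u) :
    idealNorm O 𝔟 = |Algebra.norm ℚ u| / idealNorm O 𝔞 := by
  have hmem : u ∈ ((𝔞 : FractionalIdeal O⁰ F) : Submodule O F) := by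
    have h1 : (𝔟 * 𝔞 : FractionalIdeal O⁰ F) ≤ 1 * 𝔞 := mul_le_mul_left hb _
    rw [one_mul, h] at h1
    exact h1 (FractionalIdeal.mem_spanSingleton_self _ _)
  rw [(abs_norm_div_idealNorm O 𝔞 hmem hu).2.2, mulOrder_eq_span,
    ← FractionalIdeal.coe_spanSingleton O⁰ u, ← h, relIndex_mul O 𝔞 𝔟 hb, idealNorm]
  have : O.toAddSubgroup.relIndex ((𝔟 : FractionalIdeal O⁰ F) : Submodule O F).toAddSubgroup = 1 := by
    rw [AddSubgroup.relIndex_eq_one]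
    intro z hz
    have := hb hz
    rw [FractionalIdeal.mem_one_iff] at this
    obtain ⟨w, rfl⟩ := this
    exact w.2
  rw [this, Nat.cast_one, div_one]

end

end HeckeCycle

/-! ### Integral ideals in the inverse class as totally positive vectors -/

namespace HeckeCycle

namespace HyperbolicLattice

variable (Λ : HyperbolicLattice)

/-- The totally positive vectors in the fundamental domain. -/
def positiveDomain : Set (Fin 2 → ℤ) := {v | v ∈ Λ.fundDomain ∧ 0 < Λ.x v ∧ 0 < Λ.y v}

lemma neg_mem_fundDomain {v : Fin 2 → ℤ} : -v ∈ Λ.fundDomain ↔ v ∈ Λ.fundDomain := by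
  simp [fundDomain]

/-- Adding the series for p = 0 and p = 1 doubles the terms with xy > 0 and cancels those with xy <
0. The vectors with xy > 0 come in pairs ±v of which one is totally positive, hence the division by
4. -/
lemma hasSum_positiveDomain {w : ℂ} (hw : 1 < w.re) :
    HasSum (fun v : Λ.positiveDomain => ((Λ.x v * Λ.y v : ℝ) : ℂ) ^ (-w))
      ((Λ.latticeZeta zero_le_one w + Λ.latticeZeta le_rfl w) / 4) := by
  have h := (Λ.hasSum_latticeZeta zero_le_one hw).add (Λ.hasSum_latticeZeta le_rfl hw)
  set s := Λ.latticeZeta zero_le_one w + Λ.latticeZeta le_rfl w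
  set g : (Fin 2 → ℤ) → ℂ := fun v =>
    ((Λ.x v * Λ.y v : ℝ) : ℂ) ^ 0 * ((|Λ.x v * Λ.y v| : ℝ) : ℂ) ^ (-(w + (0 : ℕ))) +
    ((Λ.x v * Λ.y v : ℝ) : ℂ) ^ 1 * ((|Λ.x v * Λ.y v| : ℝ) : ℂ) ^ (-(w + (1 : ℕ))) with hg
  have h1 : HasSum (Λ.fundDomain.indicator g) s := hasSum_subtype_iff_indicator.mp h
  have hpos : ∀ v, 0 < Λ.x v * Λ.y v → g v = 2 * ((Λ.x v * Λ.y v : ℝ) : ℂ) ^ (-w) := by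
    intro v hv
    have hv' : ((Λ.x v * Λ.y v : ℝ) : ℂ) ≠ 0 := by exact_mod_cast hv.ne'
    simp only [hg]
    rw [abs_of_pos hv, neg_add w ((1 : ℕ) : ℂ), Complex.cpow_add _ _ hv', Complex.cpow_neg _ ((1 : ℕ) : ℂ),
      Complex.cpow_natCast, pow_one, pow_zero, Nat.cast_zero, add_zero]
    field_simp
    norm_num
  have hneg : ∀ v, Λ.x v * Λ.y v < 0 → g v = 0 := by
    intro v hv
    have hv' : ((|Λ.x v * Λ.y v| : ℝ) : ℂ) ≠ 0 := by exact_mod_cast abs_ne_zero.mpr hv.ne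
    have e : ((Λ.x v * Λ.y v : ℝ) : ℂ) = -((|Λ.x v * Λ.y v| : ℝ) : ℂ) := by
      rw [abs_of_neg hv]; simp
    simp only [hg]
    rw [e, neg_add w ((1 : ℕ) : ℂ), Complex.cpow_add _ _ hv', Complex.cpow_neg _ ((1 : ℕ) : ℂ),
      Complex.cpow_natCast, pow_one, pow_one, pow_zero, Nat.cast_zero, add_zero]
    field_simp
    norm_num
  have hdec : ∀ v, Λ.fundDomain.indicator g v =
      Λ.positiveDomain.indicator g v + Λ.positiveDomain.indicator g (-v) := by
    intro v
    by_cases hv : v ∈ Λ.fundDomain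
    · have hx := Λ.x_ne_zero hv.1
      have hy := Λ.y_ne_zero hv.1
      have gneg : g (-v) = g v := by simp [hg]
      have hm : v ∈ Λ.positiveDomain ↔ 0 < Λ.x v ∧ 0 < Λ.y v := by simp [positiveDomain, hv]
      have hm' : -v ∈ Λ.positiveDomain ↔ Λ.x v < 0 ∧ Λ.y v < 0 := by
        simp [positiveDomain, neg_mem_fundDomain, hv]
      rw [Set.indicator_of_mem hv]
      rcases hx.lt_or_gt with h1 | h1 <;> rcases hy.lt_or_gt with h2 | h2
      · rw [Set.indicator_of_notMem (by rw [hm]; exact fun h => absurd h.1 h1.not_gt),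
          Set.indicator_of_mem (hm'.mpr ⟨h1, h2⟩), gneg, zero_add]
      · rw [Set.indicator_of_notMem (by rw [hm]; exact fun h => absurd h.1 h1.not_gt),
          Set.indicator_of_notMem (by rw [hm']; exact fun h => absurd h.2 h2.not_gt),
          hneg v (mul_neg_of_neg_of_pos h1 h2), zero_add]
      · rw [Set.indicator_of_notMem (by rw [hm]; exact fun h => absurd h.2 h2.not_gt),
          Set.indicator_of_notMem (by rw [hm']; exact fun h => absurd h.1 h1.not_gt),
          hneg v (mul_neg_of_pos_of_neg h1 h2), zero_add]
      · rw [Set.indicator_of_mem (hm.mpr ⟨h1, h2⟩),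
          Set.indicator_of_notMem (by rw [hm']; exact fun h => absurd h.1 h1.not_gt), add_zero]
    · rw [Set.indicator_of_notMem hv, Set.indicator_of_notMem (fun h => hv h.1),
        Set.indicator_of_notMem (fun h => hv (Λ.neg_mem_fundDomain.mp h.1)), add_zero]
  have hs : Summable (Λ.positiveDomain.indicator g) := by
    have := h1.summable.indicator Λ.positiveDomain
    rwa [Set.indicator_indicator, Set.inter_eq_left.mpr fun v hv => hv.1] at this
  have h2 := hs.hasSum
  have h3 := (Equiv.neg (Fin 2 → ℤ)).hasSum_iff.mpr h2
  have h4 := h2.add h3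
  rw [show (fun v => Λ.positiveDomain.indicator g v +
    (Λ.positiveDomain.indicator g ∘ Equiv.neg (Fin 2 → ℤ)) v) = Λ.fundDomain.indicator g from
    funext fun v => (hdec v).symm] at h4
  have h5 := h4.unique h1
  have h6 := (hasSum_subtype_iff_indicator.mpr h2).mul_left (1 / 2)
  rw [show s / 4 = 1 / 2 * ∑' v, Λ.positiveDomain.indicator g v by rw [← h5]; ring]
  refine (congrArg (fun f => HasSum f _) (funext fun v => ?_)).mp h6
  rw [Function.comp_apply, hpos v (mul_pos v.2.2.1 v.2.2.2)]
  ring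

end HyperbolicLattice

section

variable {F : Type*} [Field F] [NumberField F]

/-- A field of degree two has exactly two embeddings in ℂ. Total positivity is thus a condition on ι
and ι' alone. -/
lemma eq_or_eq_of_embedding (hF : Module.finrank ℚ F = 2) {ι ι' : F →+* ℝ} (hι : ι ≠ ι')
    (φ : F →+* ℝ) : φ = ι ∨ φ = ι' := by
  classical
  let σ : (F →+* ℝ) → (F →ₐ[ℚ] ℂ) := fun φ => (Complex.ofRealHom.comp φ).toRatAlgHom
  have hσ : Function.Injective σ := by
    intro φ ψ h
    ext y
    exact Complex.ofReal_injective (DFunLike.congr_fun h y)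
  have hcard : Fintype.card (F →ₐ[ℚ] ℂ) = 2 := by rw [AlgHom.card, hF]
  have huniv : (Finset.univ : Finset (F →ₐ[ℚ] ℂ)) = {σ ι, σ ι'} := by
    symm
    apply Finset.eq_univ_of_card
    rw [hcard, Finset.card_pair (hσ.ne hι)]
  have := Finset.mem_univ (σ φ)
  rw [huniv, Finset.mem_insert, Finset.mem_singleton] at this
  exact this.imp (fun h => hσ h) fun h => hσ h

lemma mem_totallyPositive (hF : Module.finrank ℚ F = 2) {ι ι' : F →+* ℝ} (hι : ι ≠ ι') {u : Fˣ} :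
    u ∈ totallyPositive F ↔ 0 < ι u ∧ 0 < ι' u := by
  refine ⟨fun h => ⟨h ι, h ι'⟩, fun h φ => ?_⟩
  rcases eq_or_eq_of_embedding hF hι φ with rfl | rfl
  exacts [h.1, h.2]

end

namespace CycleData

variable {F : Type*} [Field F] [NumberField F] {ι ι' : F →+* ℝ} {O : Subring F} [Module.Finite ℤ O] [IsFractionRing O F] {A : NarrowClassGroup O}
  (d : CycleData ι ι' O A)

lemma vec_injective : Function.Injective d.vec := by
  intro v w h
  rw [vec_eq, vec_eq] at h
  exact d.basis.equivFun.symm.injective (Subtype.ext h)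

lemma vec_mem (v : Fin 2 → ℤ) : d.vec v ∈ ((d.ideal : FractionalIdeal O⁰ F) : Submodule O F) := by
  rw [vec_eq]
  exact Subtype.property _

lemma exists_vec_eq {u : F} (hu : u ∈ ((d.ideal : FractionalIdeal O⁰ F) : Submodule O F)) :
    ∃ v, d.vec v = u :=
  ⟨d.basis.equivFun ⟨u, hu⟩, by rw [vec_eq, LinearEquiv.symm_apply_apply]⟩

lemma map_unit_zpow (φ : F →+* ℝ) (j : ℤ) :
    φ ((d.unit ^ j : Oˣ) : O) = φ (d.unit : O) ^ j := by
  have := congrArg Units.val (map_zpow (Units.map (φ.comp O.subtype).toMonoidHom) d.unit j)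
  rw [Units.val_zpow_eq_zpow_val] at this
  exact this

lemma vec_vecEquiv_zpow (j : ℤ) (v : Fin 2 → ℤ) :
    d.vec (HyperbolicLattice.vecEquiv (d.matrix ^ j) v) = ((d.unit ^ j : Oˣ) : O) * d.vec v := by
  apply ι.injective
  have h := d.lattice.x_vecEquiv_zpow j v
  rw [lattice_x, lattice_x] at h
  rw [map_mul, map_unit_zpow]
  exact h

/-- The integral ideal `v𝔞⁻¹`. -/
def toIdeal {v : Fin 2 → ℤ} (hv : v ≠ 0) : (FractionalIdeal O⁰ F)ˣ :=
  toPrincipalIdeal O F (Units.mk0 (d.vec v) (d.vec_ne_zero hv)) * d.ideal⁻¹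

lemma toIdeal_mul {v : Fin 2 → ℤ} (hv : v ≠ 0) :
    (d.toIdeal hv * d.ideal : FractionalIdeal O⁰ F) =
      FractionalIdeal.spanSingleton O⁰ (d.vec v) := by
  rw [← Units.val_mul, toIdeal, inv_mul_cancel_right, coe_toPrincipalIdeal, Units.val_mk0]

lemma toIdeal_le_one {v : Fin 2 → ℤ} (hv : v ≠ 0) : (d.toIdeal hv : FractionalIdeal O⁰ F) ≤ 1 := by
  rw [toIdeal, Units.val_mul, coe_toPrincipalIdeal, Units.val_mk0, ← d.ideal.mul_inv]
  refine mul_le_mul_left ?_ _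
  rw [FractionalIdeal.spanSingleton_le_iff_mem]
  exact d.vec_mem v

lemma mk_toIdeal (hF : Module.finrank ℚ F = 2) (hι : ι ≠ ι') {v : Fin 2 → ℤ} (hv : v ∈ d.lattice.positiveDomain) :
    (QuotientGroup.mk (d.toIdeal hv.1.1) : NarrowClassGroup O) = A⁻¹ := by
  have h : (QuotientGroup.mk (toPrincipalIdeal O F (Units.mk0 (d.vec v) (d.vec_ne_zero hv.1.1))) :
      NarrowClassGroup O) = 1 := by
    refine (QuotientGroup.eq_one_iff _).mpr ⟨_, (mem_totallyPositive hF hι).mpr ?_, rfl⟩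
    rw [Units.val_mk0, ← lattice_x, ← lattice_y]
    exact hv.2
  rw [toIdeal, QuotientGroup.mk_mul, QuotientGroup.mk_inv, d.ideal_mem, h]
  exact one_mul (A⁻¹ : NarrowClassGroup O)

/-- The integral ideals in the inverse class correspond to the totally positive vectors in the
fundamental domain. -/
lemma bijective_toIdeal (hF : Module.finrank ℚ F = 2) (hι : ι ≠ ι') : Function.Bijective
    (fun v : d.lattice.positiveDomain => (⟨d.toIdeal v.2.1.1, d.toIdeal_le_one _,
      d.mk_toIdeal hF hι v.2⟩ :
      {𝔟 : (FractionalIdeal O⁰ F)ˣ // (𝔟 : FractionalIdeal O⁰ F) ≤ 1 ∧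
        (QuotientGroup.mk 𝔟 : NarrowClassGroup O) = A⁻¹})) := by
  constructor
  -- Two vectors with the same ideal differ by a unit, which is totally positive because both
  -- vectors are. It is a power of ε₀, and the fundamental domain contains one vector of each orbit.
  · rintro ⟨v, hv, hvx, hvy⟩ ⟨w, hw, hwx, hwy⟩ h
    have h1 : d.toIdeal hv.1 = d.toIdeal hw.1 := congrArg Subtype.val h
    have h2 := d.toIdeal_mul hv.1
    rw [h1, toIdeal_mul, eq_comm, FractionalIdeal.spanSingleton_eq_spanSingleton] at h2
    obtain ⟨η, hη⟩ := h2
    have hη' : ((η : O) : F) * d.vec v = d.vec w := hη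
    have hpos : η ∈ positiveUnits O := by
      refine (mem_totallyPositive hF hι).mpr ⟨?_, ?_⟩
      · have e := congrArg ι hη'
        rw [map_mul, ← lattice_x, ← lattice_x] at e
        rw [← e, mul_pos_iff_of_pos_right hvx] at hwx
        exact hwx
      · have e := congrArg ι' hη'
        rw [map_mul, ← lattice_y, ← lattice_y] at e
        rw [← e, mul_pos_iff_of_pos_right hvy] at hwy
        exact hwy
    rw [← d.unit_generates] at hpos
    obtain ⟨j, rfl⟩ := hpos
    rw [← vec_vecEquiv_zpow] at hη'
    have h3 := d.vec_injective hη'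
    have h4 : d.lattice.translateEquiv (j, ⟨v, hv⟩) = d.lattice.translateEquiv (0, ⟨w, hw⟩) := by
      apply Subtype.ext
      rw [d.lattice.translateEquiv_apply, d.lattice.translateEquiv_apply, zpow_zero,
        HyperbolicLattice.vecEquiv_one]
      exact h3
    have h5 : (⟨v, hv⟩ : d.lattice.fundDomain) = ⟨w, hw⟩ :=
      congrArg Prod.snd (d.lattice.translateEquiv.injective h4)
    exact Subtype.ext (congrArg (fun u : d.lattice.fundDomain => (u : Fin 2 → ℤ)) h5)
  -- The product 𝔟𝔞 has a totally positive generator, which lies in 𝔞. A power of ε₀ moves it into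
  -- the fundamental domain and keeps both signs, since both conjugates of ε₀ are positive.
  · rintro ⟨𝔟, hb, hA⟩
    have h1 : (QuotientGroup.mk (𝔟 * d.ideal) : NarrowClassGroup O) = 1 := by
      rw [QuotientGroup.mk_mul, hA, d.ideal_mem, inv_mul_cancel]
    obtain ⟨u, hu, hu'⟩ := (QuotientGroup.eq_one_iff _).mp h1
    have hu1 := (mem_totallyPositive hF hι).mp hu
    have hspan : FractionalIdeal.spanSingleton O⁰ (u : F) = 𝔟 * d.ideal := by
      rw [← Units.val_mul, ← hu', coe_toPrincipalIdeal]
    have hmem : (u : F) ∈ ((d.ideal : FractionalIdeal O⁰ F) : Submodule O F) := by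
      have h1 : (𝔟 * d.ideal : FractionalIdeal O⁰ F) ≤ 1 * d.ideal := mul_le_mul_left hb _
      rw [one_mul, ← hspan] at h1
      exact h1 (FractionalIdeal.mem_spanSingleton_self _ _)
    obtain ⟨v0, hv0⟩ := d.exists_vec_eq hmem
    have hv0' : v0 ≠ 0 := by
      rintro rfl
      exact u.ne_zero (by rw [← hv0]; simp [vec])
    obtain ⟨⟨j, v, hv⟩, hjv⟩ := d.lattice.translateEquiv.surjective ⟨v0, hv0'⟩
    have hjv' : HyperbolicLattice.vecEquiv (d.matrix ^ j) v = v0 := congrArg Subtype.val hjv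
    have e : (u : F) = ((d.unit ^ j : Oˣ) : O) * d.vec v := by
      rw [← vec_vecEquiv_zpow, hjv', hv0]
    have hεx : 0 < ι (d.unit : O) := one_pos.trans d.one_lt_unit
    have hεy : 0 < ι' (d.unit : O) := by
      rw [← mul_pos_iff_of_pos_left hεx, d.mul_conj_unit]
      exact one_pos
    rw [e, map_mul, map_mul, map_unit_zpow, map_unit_zpow, ← lattice_x, ← lattice_y,
      mul_pos_iff_of_pos_left (zpow_pos hεx j), mul_pos_iff_of_pos_left (zpow_pos hεy j)] at hu1
    refine ⟨⟨v, hv, hu1⟩, Subtype.ext ?_⟩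
    apply mul_right_cancel (b := d.ideal)
    apply Units.ext
    rw [Units.val_mul, Units.val_mul, toIdeal_mul, ← hspan,
      FractionalIdeal.spanSingleton_eq_spanSingleton]
    exact ⟨d.unit ^ j, e.symm⟩

lemma idealNorm_toIdeal (hF : Module.finrank ℚ F = 2) (hι : ι ≠ ι') {v : Fin 2 → ℤ} (hv : v ∈ d.lattice.positiveDomain) :
    ((idealNorm O (d.toIdeal hv.1.1) : ℚ) : ℝ) =
      d.lattice.x v * d.lattice.y v / (idealNorm O d.ideal : ℚ) := by
  rw [idealNorm_eq_div O d.ideal _ (d.toIdeal_le_one _) (d.vec_ne_zero hv.1.1) (d.toIdeal_mul _)]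
  push_cast
  rw [norm_eq_mul_conj hF hι, ← lattice_x, ← lattice_y,
    abs_of_pos (mul_pos hv.2.1 hv.2.2)]

/-- The meromorphic continuation of the partial zeta function of the inverse class. -/
def partialZeta (w : ℂ) : ℂ :=
  ((idealNorm O d.ideal : ℚ) : ℂ) ^ w *
    ((d.lattice.latticeZeta zero_le_one w + d.lattice.latticeZeta le_rfl w) / 4)

/-- The Dirichlet series is reindexed by totally positive vectors, with the norm xy/N𝔞; the analytic
properties are inherited from the two lattice zeta functions. -/
theorem isPartialZeta (hF : Module.finrank ℚ F = 2) (hι : ι ≠ ι') : IsPartialZeta O A⁻¹ d.partialZeta := by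
  have hN : 0 < ((idealNorm O d.ideal : ℚ) : ℝ) := by exact_mod_cast idealNorm_pos O d.ideal
  have hN' : ((idealNorm O d.ideal : ℚ) : ℂ) ≠ 0 := by exact_mod_cast (idealNorm_pos O d.ideal).ne'
  have hd : Differentiable ℂ fun w : ℂ => ((idealNorm O d.ideal : ℚ) : ℂ) ^ w := fun w =>
    differentiableAt_id.const_cpow (Or.inl hN')
  refine ⟨fun w hw => ?_, ?_, ?_⟩
  · rw [← (Equiv.ofBijective _ (d.bijective_toIdeal hF hι)).hasSum_iff]
    refine (congrArg (fun f => HasSum f _) (funext fun v => ?_)).mp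
      ((d.lattice.hasSum_positiveDomain hw).mul_left (((idealNorm O d.ideal : ℚ) : ℂ) ^ w))
    have hxy := mul_pos v.2.2.1 v.2.2.2
    have h := d.idealNorm_toIdeal hF hι v.2
    have h' : ((idealNorm O (d.toIdeal v.2.1.1) : ℚ) : ℂ) =
        ((d.lattice.x v * d.lattice.y v / (idealNorm O d.ideal : ℚ) : ℝ) : ℂ) := by
      rw [← h]; simp
    rw [Function.comp_apply, Equiv.ofBijective_apply]
    rw [h', ← Complex.ofReal_ratCast, ofReal_cpow_eq_exp (div_pos hxy hN), ofReal_cpow_eq_exp hxy,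
      ofReal_cpow_eq_exp hN, ← Complex.exp_add, Real.log_div hxy.ne' hN.ne']
    congr 1
    push_cast
    ring
  · exact hd.differentiableOn.mul (((d.lattice.differentiableOn_latticeZeta _).add
      (d.lattice.differentiableOn_latticeZeta _)).div_const 4)
  · exact (hd.analyticAt 1).meromorphicAt.mul (((d.lattice.meromorphicAt_latticeZeta _).add
      (d.lattice.meromorphicAt_latticeZeta _)).div (MeromorphicAt.const 4 1))

end CycleData

end HeckeCycle

/-! ### Comparison of the pairing with the zeta value -/

namespace HeckeCycle

open Real

/-- The functional equation at 2k; its cosine is cos(πk) = (-1)^k, the source of the sign in the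
final formula. -/
lemma riemannZeta_one_sub_two_mul {k : ℕ} (hk : 2 ≤ k) :
    riemannZeta (1 - 2 * k) =
      2 * ((2 * π : ℂ) ^ (2 * k))⁻¹ * Complex.Gamma (2 * k) * (-1) ^ k * riemannZeta (2 * k) := by
  have h1 : ∀ n : ℕ, (2 * k : ℂ) ≠ -n := by
    intro n h
    have : (2 * k + n : ℂ) = 0 := by rw [h]; ring
    have : 2 * k + n = 0 := by exact_mod_cast this
    omega
  have h2 : (2 * k : ℂ) ≠ 1 := by
    intro h
    have : 2 * k = 1 := by exact_mod_cast h
    omega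
  rw [riemannZeta_one_sub h1 h2]
  have e1 : (2 * π : ℂ) ^ (-(2 * k : ℂ)) = ((2 * π : ℂ) ^ (2 * k))⁻¹ := by
    rw [Complex.cpow_neg, ← Complex.cpow_natCast]
    push_cast
    rfl
  have e2 : Complex.cos (π * (2 * k) / 2) = (-1) ^ k := by
    rw [show (π : ℂ) * (2 * k) / 2 = k * π by ring, ← Complex.ofReal_natCast,
      ← Complex.ofReal_mul, ← Complex.ofReal_cos, Real.cos_nat_mul_pi]
    push_cast
    rfl
  rw [e1, e2]

namespace CycleData

variable {F : Type*} [Field F] [NumberField F] {ι ι' : F →+* ℝ} {O : Subring F}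
  [Module.Finite ℤ O] [IsFractionRing O F] {A : NarrowClassGroup O} (d : CycleData ι ι' O A)

/-- With S = ∑ (xy)^(-k), the pairing is N𝔞^(1-k) Δ^(2k-1) B(k, k) S/(2ζ(2k)) and the zeta value is
N𝔞^(1-k) Δ^(2k-1) Γ(k)² S/(2π)^(2k). Division by ζ(1 - 2k) removes the powers of 2π, and B(k, k) =
Γ(k)²/Γ(2k) matches the rest. -/
theorem pairing_eq (hF : Module.finrank ℚ F = 2) (hι : ι ≠ ι') {k : ℕ} (hk : 2 ≤ k)
    (hn : 2 ≤ 2 * (k - 1)) :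
    pairing (2 * (k - 1)) (Eis (2 * (k - 1)) hn) (d.cycle hF hι k) =
      (-1) ^ k * (d.partialZeta (1 - k) / riemannZeta (1 - 2 * k)) := by
  have hk1 : (1 : ℝ) < k := by exact_mod_cast hk
  obtain ⟨S, hS⟩ : ∃ S, HasSum (fun v : d.lattice.fundDomain =>
      (((d.lattice.x v * d.lattice.y v : ℝ) : ℂ) ^ k)⁻¹) S := by
    refine (Summable.of_norm ((d.lattice.summable_fundDomain hk1).congr fun v => ?_))
    rw [norm_inv, norm_pow, Complex.norm_real, Real.rpow_neg (abs_nonneg _), Real.rpow_natCast,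
      Real.norm_eq_abs]
  have h1 := d.hasSum_pairing hF hι hk hn
  have h2 := (hS.mul_left ((2 * riemannZeta (2 * k))⁻¹ *
        (((idealNorm O d.ideal : ℚ) : ℂ)⁻¹) ^ (k - 1) *
          (d.lattice.covol : ℂ) ^ (2 * k - 1))).mul_right (Complex.betaIntegral k k)
  rw [h1.unique h2, partialZeta, d.lattice.latticeZeta_one_sub hk hS,
    riemannZeta_one_sub_two_mul hk]
  have hN : ((idealNorm O d.ideal : ℚ) : ℂ) ≠ 0 := by exact_mod_cast (idealNorm_pos O d.ideal).ne'
  have hNk : ((idealNorm O d.ideal : ℚ) : ℂ) ^ (1 - k : ℂ) =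
      (((idealNorm O d.ideal : ℚ) : ℂ)⁻¹) ^ (k - 1) := by
    rw [show (1 - k : ℂ) = -((k - 1 : ℕ) : ℂ) by push_cast [show 1 ≤ k by omega]; ring,
      Complex.cpow_neg, Complex.cpow_natCast, inv_pow]
  have hk0 : 0 < (k : ℂ).re := by rw [Complex.natCast_re]; linarith
  have hB := Complex.Gamma_mul_Gamma_eq_betaIntegral hk0 hk0
  rw [← two_mul] at hB
  have hΓ : Complex.Gamma (2 * k) ≠ 0 := by
    apply Complex.Gamma_ne_zero_of_re_pos
    have : ((2 * k : ℕ) : ℂ).re = (2 * k : ℕ) := Complex.natCast_re _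
    push_cast at this
    rw [this]
    positivity
  have hζ : riemannZeta (2 * k) ≠ 0 := by
    apply riemannZeta_ne_zero_of_one_lt_re
    have : ((2 * k : ℕ) : ℂ).re = (2 * k : ℕ) := Complex.natCast_re _
    push_cast at this
    rw [this]
    linarith
  have hπ : (π : ℂ) ≠ 0 := by exact_mod_cast pi_ne_zero
  have hB' : Complex.betaIntegral k k = Complex.Gamma k ^ 2 / Complex.Gamma (2 * k) := by
    rw [eq_div_iff hΓ, sq, hB]; ring
  have hm : ((-1 : ℂ)) ^ k ≠ 0 := pow_ne_zero _ (by norm_num)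
  rw [hNk, hB']
  field_simp

end CycleData

end HeckeCycle

/-! ### Existence of the data of a cycle, and uniqueness of the continuation -/

namespace HeckeCycle

section

variable {F : Type*} [Field F] [NumberField F] {ι ι' : F →+* ℝ} (O : Subring F) [Module.Finite ℤ O] [IsFractionRing O F]

/-- The divisibility of norms of elements of an ideal, applied to O itself, which has norm 1. -/
lemma exists_int_mul_conj (hF : Module.finrank ℚ F = 2) (hι : ι ≠ ι') (z : O) :
    ∃ m : ℤ, ι z * ι' z = m := by
  have hmem : (z : F) ∈ ((1 : FractionalIdeal O⁰ F) : Submodule O F) :=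
    FractionalIdeal.coe_mem_one O⁰ z
  obtain ⟨m, hm⟩ := norm_div_idealNorm O 1 hmem
  have hone : ((1 : FractionalIdeal O⁰ F) : Submodule O F).toAddSubgroup = O.toAddSubgroup := by
    ext z
    rw [Submodule.mem_toAddSubgroup, FractionalIdeal.mem_coe, FractionalIdeal.mem_one_iff]
    exact ⟨by rintro ⟨w, rfl⟩; exact w.2, fun h => ⟨⟨z, h⟩, rfl⟩⟩
  rw [idealNorm, hone, AddSubgroup.relIndex_self, Nat.cast_one, div_one, div_one] at hm
  exact ⟨m, by rw [← norm_eq_mul_conj hF hι, hm]; simp⟩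

/-- The trace is recovered from norms by (z + 1)(z' + 1) = zz' + z + z' + 1. -/
lemma exists_int_add_conj (hF : Module.finrank ℚ F = 2) (hι : ι ≠ ι') (z : O) :
    ∃ m : ℤ, ι z + ι' z = m := by
  obtain ⟨m, hm⟩ := exists_int_mul_conj O hF hι z
  obtain ⟨m', hm'⟩ := exists_int_mul_conj O hF hι (z + 1)
  refine ⟨m' - m - 1, ?_⟩
  push_cast at hm' ⊢
  rw [← hm, ← hm', map_add, map_add, map_one, map_one]
  ring

lemma mem_positiveUnits (hF : Module.finrank ℚ F = 2) (hι : ι ≠ ι') {η : Oˣ} :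
    η ∈ positiveUnits O ↔ 0 < ι (η : O) ∧ 0 < ι' (η : O) :=
  mem_totallyPositive hF hι

lemma map_unit_mul_inv (φ : F →+* ℝ) (η : Oˣ) : φ (η : O) * φ ((η⁻¹ : Oˣ) : O) = 1 := by
  rw [← map_mul, ← Subring.coe_mul, Units.mul_inv, Subring.coe_one, map_one]

/-- The norm is a positive integer, and the norm of the inverse unit is its inverse in ℤ. -/
lemma mul_conj_positiveUnit (hF : Module.finrank ℚ F = 2) (hι : ι ≠ ι') {η : Oˣ}
    (hη : η ∈ positiveUnits O) : ι (η : O) * ι' (η : O) = 1 := by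
  obtain ⟨m, hm⟩ := exists_int_mul_conj O hF hι (η : O)
  obtain ⟨m', hm'⟩ := exists_int_mul_conj O hF hι ((η⁻¹ : Oˣ) : O)
  obtain ⟨h1, h2⟩ := (mem_positiveUnits O hF hι).mp hη
  have hprod : m * m' = 1 := by
    have : (m : ℝ) * m' = 1 := by
      rw [← hm, ← hm']
      calc _ = (ι (η : O) * ι ((η⁻¹ : Oˣ) : O)) * (ι' (η : O) * ι' ((η⁻¹ : Oˣ) : O)) := by ring
        _ = 1 := by rw [map_unit_mul_inv, map_unit_mul_inv, one_mul]
    exact_mod_cast this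
  have hpos : 0 < m := by
    have : (0 : ℝ) < m := hm ▸ mul_pos h1 h2
    exact_mod_cast this
  have : m = 1 := Int.eq_one_of_mul_eq_one_right hpos.le hprod
  rw [hm, this, Int.cast_one]

/-- Embeddings that agree on O agree on its fraction field F. -/
lemma exists_conj_ne (hι : ι ≠ ι') : ∃ z : O, ι z ≠ ι' z := by
  by_contra! h
  apply hι
  ext z
  obtain ⟨p, q, hq, rfl⟩ := IsFractionRing.div_surjective (A := O) z
  rw [map_div₀, map_div₀]
  exact congrArg₂ _ (h p) (h q)

/-- There is a nontrivial totally positive unit. -/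
lemma exists_positiveUnit (hF : Module.finrank ℚ F = 2) (hι : ι ≠ ι') :
    ∃ η ∈ positiveUnits O, 1 < ι (η : O) := by
  obtain ⟨p, hp⟩ := exists_conj_ne O hι
  obtain ⟨n, hn⟩ := exists_int_mul_conj O hF hι p
  obtain ⟨t, ht⟩ := exists_int_add_conj O hF hι p
  set s := ι p - ι' p with hs
  have hs0 : s ≠ 0 := sub_ne_zero.mpr hp
  -- The discriminant of the characteristic polynomial of p. The element δ = 2p - t of O satisfies
  -- δ² = D, and its two conjugates are s and -s.
  set D : ℤ := t ^ 2 - 4 * n with hD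
  have hDs : (D : ℝ) = s ^ 2 := by
    rw [hD]; push_cast; rw [← hn, ← ht, hs]; ring
  have hD0 : 0 < D := by
    have : (0 : ℝ) < D := by rw [hDs]; positivity
    exact_mod_cast this
  set δ : O := p + p - t with hδ
  have hιδ : ι δ = s := by
    rw [hδ, hs]; push_cast
    rw [map_sub, map_add, map_intCast, ← ht]; ring
  have hιδ' : ι' δ = -s := by
    rw [hδ, hs]; push_cast
    rw [map_sub, map_add, map_intCast, ← ht]; ring
  have hδ2 : δ ^ 2 = D := by
    apply Subtype.ext
    apply ι.injective
    push_cast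
    rw [map_pow, hιδ, map_intCast, hDs]
  -- Otherwise δ would be a rational integer, equal to its own conjugate, which forces s = 0.
  have hsq : ¬ IsSquare D := by
    rintro ⟨m, hm⟩
    have h1 : (δ - m) * (δ + m) = 0 := by
      have : ((D : ℤ) : O) = m * m := by rw [hm]; push_cast; rfl
      linear_combination hδ2 + this
    rcases mul_eq_zero.mp h1 with h | h
    · have h2 : (δ : F) = ((m : ℤ) : F) := by
        have := sub_eq_zero.mp h
        rw [this]; simp
      rw [h2, map_intCast] at hιδ hιδ'
      apply hs0; linarith
    · have h2 : (δ : F) = ((-m : ℤ) : F) := by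
        have := eq_neg_of_add_eq_zero_left h
        rw [this]; simp
      rw [h2, map_intCast] at hιδ hιδ'
      apply hs0; linarith
  -- A solution of Pell's equation gives the unit x + yδ of norm 1, of which the square is totally
  -- positive. It is nontrivial because y ≠ 0.
  obtain ⟨x, y, hxy, hy⟩ := Pell.exists_of_not_isSquare hD0 hsq
  have hxyO : ((x : ℤ) : O) ^ 2 - D * y ^ 2 = 1 := by exact_mod_cast congrArg (Int.cast : ℤ → O) hxy
  let E : Oˣ := ⟨x + y * δ, x - y * δ, by linear_combination hxyO - y ^ 2 * hδ2,
    by linear_combination hxyO - y ^ 2 * hδ2⟩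
  have hE : ι (E : O) = x + y * s := by
    change ι ((x + y * δ : O) : F) = _
    push_cast
    rw [map_add, map_mul, map_intCast, map_intCast, hιδ]
  have hE' : ι' (E : O) = x - y * s := by
    change ι' ((x + y * δ : O) : F) = _
    push_cast
    rw [map_add, map_mul, map_intCast, map_intCast, hιδ']
    ring
  have hprod : ι (E : O) * ι' (E : O) = 1 := by
    rw [hE, hE']
    have : (x : ℝ) ^ 2 - D * y ^ 2 = 1 := by exact_mod_cast hxy
    rw [hDs] at this
    linear_combination this
  have hιE : ι (E : O) ≠ 0 := left_ne_zero_of_mul (hprod ▸ one_ne_zero)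
  have hι'E : ι' (E : O) ≠ 0 := right_ne_zero_of_mul (hprod ▸ one_ne_zero)
  have hsq2 : ∀ φ : F →+* ℝ, φ ((E ^ 2 : Oˣ) : O) = φ (E : O) ^ 2 := by
    intro φ
    rw [Units.val_pow_eq_pow_val, Subring.coe_pow, map_pow]
  have hpos : E ^ 2 ∈ positiveUnits O := by
    rw [mem_positiveUnits O hF hι, hsq2, hsq2]
    exact ⟨by positivity, by positivity⟩
  have hne : ι ((E ^ 2 : Oˣ) : O) ≠ 1 := by
    rw [hsq2]
    intro h
    have h1 : ι (E : O) = ι' (E : O) := by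
      apply mul_left_cancel₀ hιE
      rw [hprod, ← sq, h]
    rw [hE, hE'] at h1
    have h2 : (y : ℝ) * s = 0 := by linarith
    rcases mul_eq_zero.mp h2 with h | h
    · exact hy (by exact_mod_cast h)
    · exact hs0 h
  rcases hne.lt_or_gt with h | h
  · refine ⟨(E ^ 2)⁻¹, inv_mem hpos, ?_⟩
    have h1 := map_unit_mul_inv O ι (E ^ 2)
    have h0 := ((mem_positiveUnits O hF hι).mp hpos).1
    rw [eq_one_div_of_mul_eq_one_right h1]
    exact one_lt_one_div h0 h
  · exact ⟨E ^ 2, hpos, h⟩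

/-- The group of totally positive units is infinite cyclic. -/
lemma exists_generator (hF : Module.finrank ℚ F = 2) (hι : ι ≠ ι') :
    ∃ ε : Oˣ, Subgroup.zpowers ε = positiveUnits O ∧ 1 < ι (ε : O) := by
  classical
  have htr : ∀ η ∈ positiveUnits O, ∃ n : ℕ, ι (η : O) + ι' (η : O) = n := by
    intro η hη
    obtain ⟨m, hm⟩ := exists_int_add_conj O hF hι (η : O)
    obtain ⟨h1, h2⟩ := (mem_positiveUnits O hF hι).mp hη
    have : 0 ≤ m := by
      have : (0 : ℝ) ≤ m := by rw [← hm]; positivity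
      exact_mod_cast this
    obtain ⟨n, rfl⟩ := Int.eq_ofNat_of_zero_le this
    exact ⟨n, by rw [hm]; simp⟩
  -- The trace is a natural number on totally positive units, so it attains a minimum on those
  -- greater than 1. The unit of minimal trace is the candidate for the generator.
  have hex : ∃ n : ℕ, ∃ η ∈ positiveUnits O, 1 < ι (η : O) ∧ ι (η : O) + ι' (η : O) = n := by
    obtain ⟨η, hη, h1⟩ := exists_positiveUnit O hF hι
    obtain ⟨n, hn⟩ := htr η hη
    exact ⟨n, η, hη, h1, hn⟩
  obtain ⟨ε, hε, h1, hn⟩ := Nat.find_spec hex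
  have hmin : ∀ η ∈ positiveUnits O, 1 < ι (η : O) → ι (ε : O) ≤ ι (η : O) := by
    intro η hη hη1
    by_contra! hlt
    obtain ⟨m, hm⟩ := htr η hη
    have hle := Nat.find_min' hex ⟨η, hη, hη1, hm⟩
    have hle' : ι (ε : O) + ι' (ε : O) ≤ ι (η : O) + ι' (η : O) := by
      rw [hn, hm]; exact_mod_cast hle
    have e1 := mul_conj_positiveUnit O hF hι hε
    have e2 := mul_conj_positiveUnit O hF hι hη
    set a := ι (ε : O)
    set b := ι (η : O)
    rw [eq_one_div_of_mul_eq_one_right e1, eq_one_div_of_mul_eq_one_right e2] at hle'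
    have hb : 0 < b := by linarith
    have ha : 0 < a := by linarith
    -- The trace is a + 1/a, which increases strictly for a > 1; hence least trace means least unit.
    have : a + 1 / a - (b + 1 / b) = (a - b) * (a * b - 1) / (a * b) := by field_simp; ring
    have h3 : 0 < (a - b) * (a * b - 1) / (a * b) := by
      have : 1 < a * b := by nlinarith
      have := sub_pos.mpr this
      have := sub_pos.mpr hlt
      positivity
    linarith
  refine ⟨ε, le_antisymm ?_ ?_, h1⟩
  · rw [Subgroup.zpowers_le]
    exact hε
  · intro η hη
    have hη0 := ((mem_positiveUnits O hF hι).mp hη).1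
    -- Division with remainder: ηε^(-j) lies in [1, ε), where minimality leaves only 1.
    obtain ⟨j, hj1, hj2⟩ := exists_mem_Ico_zpow hη0 h1
    have hz : ∀ i : ℤ, ι ((ε ^ i : Oˣ) : O) = ι (ε : O) ^ i := by
      intro i
      have := congrArg Units.val (map_zpow (Units.map (ι.comp O.subtype).toMonoidHom) ε i)
      rw [Units.val_zpow_eq_zpow_val] at this
      exact this
    set θ := η * ε ^ (-j) with hθ
    have hθm : θ ∈ positiveUnits O := mul_mem hη (zpow_mem hε _)
    have hιθ : ι (θ : O) = ι (η : O) * ι (ε : O) ^ (-j) := by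
      rw [hθ, Units.val_mul, Subring.coe_mul, map_mul, hz]
    have hεj : 0 < ι (ε : O) ^ j := zpow_pos (one_pos.trans h1) j
    have hge : 1 ≤ ι (θ : O) := by
      rw [hιθ, zpow_neg, ← div_eq_mul_inv, le_div_iff₀ hεj, one_mul]
      exact hj1
    have hlt : ι (θ : O) < ι (ε : O) := by
      rw [hιθ, zpow_neg, ← div_eq_mul_inv, div_lt_iff₀ hεj, ← zpow_one_add₀ (one_pos.trans h1).ne',
        add_comm]
      exact hj2
    have heq : ι (θ : O) = 1 := by
      by_contra hne
      exact absurd (hmin θ hθm (lt_of_le_of_ne hge (Ne.symm hne))) hlt.not_ge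
    have hθ1 : θ = 1 := by
      apply Units.ext
      apply Subtype.ext
      apply ι.injective
      rw [heq]
      simp
    rw [hθ, zpow_neg, mul_inv_eq_one] at hθ1
    exact ⟨j, hθ1.symm⟩

/-- An invertible ideal is free of rank two over `ℤ`. -/
lemma nonempty_basis (hF : Module.finrank ℚ F = 2) (𝔞 : (FractionalIdeal O⁰ F)ˣ) :
    Nonempty (Module.Basis (Fin 2) ℤ ((𝔞 : FractionalIdeal O⁰ F) : Submodule O F)) := by
  have hfg : ((𝔞 : FractionalIdeal O⁰ F) : Submodule O F).FG := FractionalIdeal.fg_unit 𝔞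
  have : Module.Finite O ((𝔞 : FractionalIdeal O⁰ F) : Submodule O F) :=
    Module.Finite.iff_fg.mpr hfg
  have : Module.Finite ℤ ((𝔞 : FractionalIdeal O⁰ F) : Submodule O F) := Module.Finite.trans O _
  have : Module.Free ℤ O := Module.free_of_finite_type_torsion_free'
  have : Module.Free ℤ ((𝔞 : FractionalIdeal O⁰ F) : Submodule O F) :=
    Module.free_of_finite_type_torsion_free'
  have hO : Module.finrank ℤ O = 2 := by
    have b := (Module.finBasis ℤ O).localizationLocalization ℚ ℤ⁰ F
    rw [← hF, Module.finrank_eq_card_basis b, Fintype.card_fin]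
  obtain ⟨α, hα, h0⟩ := exists_mem_ne_zero O 𝔞
  -- Multiplication by a nonzero element of the ideal embeds O in it; below, multiplication by a
  -- common denominator embeds the ideal in O.
  have h1 : 2 ≤ Module.finrank ℤ ((𝔞 : FractionalIdeal O⁰ F) : Submodule O F) := by
    rw [← hO]
    refine LinearMap.finrank_le_finrank_of_injective
      (f := ((LinearMap.toSpanSingleton O ((𝔞 : FractionalIdeal O⁰ F) : Submodule O F)
        ⟨α, hα⟩).restrictScalars ℤ)) ?_
    intro r s h
    have h' : (r : F) * α = s * α := congrArg Subtype.val h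
    exact Subtype.ext (mul_right_cancel₀ h0 h')
  have h2 : Module.finrank ℤ ((𝔞 : FractionalIdeal O⁰ F) : Submodule O F) ≤ 2 := by
    obtain ⟨d, hd, hdL⟩ := (𝔞 : FractionalIdeal O⁰ F).isFractional
    have hd0 : (d : F) ≠ 0 := by
      intro h
      exact nonZeroDivisors.ne_zero hd (Subtype.ext h)
    choose f hf using fun z : ((𝔞 : FractionalIdeal O⁰ F) : Submodule O F) => hdL z z.2
    have hf' : ∀ z, (f z : F) = d * z := hf
    rw [← hO]
    refine LinearMap.finrank_le_finrank_of_injective (f := AddMonoidHom.toIntLinearMap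
      { toFun := f
        map_zero' := Subtype.ext (by rw [hf']; simp)
        map_add' := fun z w => Subtype.ext (by
          rw [hf', Subring.coe_add, hf', hf', Submodule.coe_add, mul_add]) }) ?_
    intro z w h
    have h' : (f z : F) = f w := congrArg Subtype.val h
    rw [hf', hf'] at h'
    exact Subtype.ext (mul_left_cancel₀ hd0 h')
  exact ⟨Module.finBasisOfFinrankEq ℤ _ (le_antisymm h2 h1)⟩

/-- If the determinant vanished, b₀/b₁ would have equal images under ι and ι'. Since F is spanned
over ℚ by b₀/b₁ and 1, the embeddings would coincide. -/
lemma orientation_ne_zero (hF : Module.finrank ℚ F = 2) (hι : ι ≠ ι')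
    {N : Submodule O F} (b : Module.Basis (Fin 2) ℤ N) :
    ι (b 0) * ι' (b 1) - ι' (b 0) * ι (b 1) ≠ 0 := by
  intro h
  have hli : LinearIndependent ℤ fun i => (b i : F) :=
    b.linearIndependent.map' (N.subtype.restrictScalars ℤ)
      (LinearMap.ker_eq_bot.mpr Subtype.val_injective)
  have hli' : LinearIndependent ℚ fun i => (b i : F) :=
    (LinearIndependent.iff_fractionRing ℤ ℚ).mp hli
  let B := basisOfLinearIndependentOfCardEqFinrank hli' (by simp [hF])
  have hB : ∀ i, B i = b i := fun i => by simp [B]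
  have h1 : (b 1 : F) ≠ 0 := hli'.ne_zero 1
  have hι1 : ι (b 1) ≠ 0 := (map_ne_zero ι).mpr h1
  have hι1' : ι' (b 1) ≠ 0 := (map_ne_zero ι').mpr h1
  apply hι
  have hdiv : ι (b 0 / b 1) = ι' (b 0 / b 1) := by
    rw [map_div₀, map_div₀, div_eq_div_iff hι1 hι1']
    linarith
  ext z
  have hz := B.sum_repr (z * b 1)
  rw [Fin.sum_univ_two, hB, hB] at hz
  rw [Rat.smul_def, Rat.smul_def] at hz
  generalize B.repr (z * b 1) 0 = r at hz
  generalize B.repr (z * b 1) 1 = q at hz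
  have hz' : z = (r : F) * (b 0 / b 1) + (q : F) := by
    apply mul_right_cancel₀ h1
    rw [← hz, add_mul, mul_assoc, div_mul_cancel₀ _ h1]
  rw [hz', map_add, map_mul, map_ratCast, map_ratCast, map_add, map_mul, map_ratCast, map_ratCast,
    hdiv]

lemma exists_oriented_basis (hF : Module.finrank ℚ F = 2) (hι : ι ≠ ι')
    (𝔞 : (FractionalIdeal O⁰ F)ˣ) :
    ∃ b : Module.Basis (Fin 2) ℤ ((𝔞 : FractionalIdeal O⁰ F) : Submodule O F),
      0 < ι (b 0) * ι' (b 1) - ι' (b 0) * ι (b 1) := by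
  obtain ⟨b⟩ := nonempty_basis O hF 𝔞
  rcases (orientation_ne_zero O hF hι b).lt_or_gt with h | h
  · refine ⟨b.reindex (Equiv.swap 0 1), ?_⟩
    simp only [Module.Basis.reindex_apply, Equiv.symm_swap, Equiv.swap_apply_left,
      Equiv.swap_apply_right]
    linarith
  · exact ⟨b, h⟩

/-- The matrix of multiplication by an element of `O`. -/
lemma exists_matrix {N : Submodule O F} (b : Module.Basis (Fin 2) ℤ N)
    (h : ι (b 0) * ι' (b 1) - ι' (b 0) * ι (b 1) ≠ 0) (η : O) :
    ∃ M : Matrix (Fin 2) (Fin 2) ℤ,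
      (∀ i, (M i 0 : F) * b 0 + (M i 1 : F) * b 1 = η * b i) ∧ (M.det : ℝ) = ι η * ι' η := by
  have hM : ∀ i, ((b.equivFun (η • b i) 0 : ℤ) : F) * b 0 +
      ((b.equivFun (η • b i) 1 : ℤ) : F) * b 1 = η * b i := by
    intro i
    have := congrArg Subtype.val (b.sum_equivFun (η • b i))
    rw [Fin.sum_univ_two] at this
    simpa [Subring.smul_def] using this
  refine ⟨Matrix.of fun i j => b.equivFun (η • b i) j, hM, ?_⟩
  rw [Matrix.det_fin_two]
  simp only [Matrix.of_apply]
  have a1 := congrArg ι (hM 0)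
  have a2 := congrArg ι (hM 1)
  have b1 := congrArg ι' (hM 0)
  have b2 := congrArg ι' (hM 1)
  simp only [map_add, map_mul, map_intCast] at a1 a2 b1 b2
  -- The determinant is found from its effect on the oriented covolume, which multiplication by η
  -- scales by ηη'.
  apply mul_right_cancel₀ h
  push_cast
  set A := ((b.equivFun (η • b 0) 0 : ℤ) : ℝ)
  set B := ((b.equivFun (η • b 0) 1 : ℤ) : ℝ)
  set C := ((b.equivFun (η • b 1) 0 : ℤ) : ℝ)
  set D := ((b.equivFun (η • b 1) 1 : ℤ) : ℝ)
  calc _ = (A * ι (b 0) + B * ι (b 1)) * (C * ι' (b 0) + D * ι' (b 1)) -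
      (C * ι (b 0) + D * ι (b 1)) * (A * ι' (b 0) + B * ι' (b 1)) := by ring
    _ = _ := by rw [a1, a2, b1, b2]; ring

theorem nonempty_cycleData (hF : Module.finrank ℚ F = 2) (hι : ι ≠ ι') (A : NarrowClassGroup O) :
    Nonempty (CycleData ι ι' O A) := by
  obtain ⟨𝔞, h𝔞⟩ := QuotientGroup.mk_surjective A
  obtain ⟨b, hb⟩ := exists_oriented_basis O hF hι 𝔞
  obtain ⟨ε, hε, h1⟩ := exists_generator O hF hι
  obtain ⟨M, hM, hdet⟩ := exists_matrix O b hb.ne' (ε : O)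
  have hεm : ε ∈ positiveUnits O := hε ▸ Subgroup.mem_zpowers ε
  rw [mul_conj_positiveUnit O hF hι hεm] at hdet
  exact ⟨{
    ideal := 𝔞
    ideal_mem := h𝔞
    basis := b
    orientation := hb
    unit := ε
    unit_generates := hε
    one_lt_unit := h1
    matrix := ⟨M, by exact_mod_cast hdet⟩
    matrix_mul_zero := hM 0
    matrix_mul_one := hM 1
    basePoint := UpperHalfPlane.I }⟩

end

/-- The values of the continuation of a partial zeta function outside `1` are determined. -/
lemma IsPartialZeta.eqOn {F : Type*} [Field F] {O : Subring F} [IsFractionRing O F]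
    {A : NarrowClassGroup O} {Z Z' : ℂ → ℂ} (h : IsPartialZeta O A Z) (h' : IsPartialZeta O A Z') :
    Set.EqOn Z Z' {1}ᶜ := by
  have hopen : IsOpen ({1}ᶜ : Set ℂ) := isOpen_compl_singleton
  refine (h.2.1.analyticOnNhd hopen).eqOn_of_preconnected_of_eventuallyEq
    (h'.2.1.analyticOnNhd hopen) (isConnected_compl_singleton_of_one_lt_rank (by simp) 1).isPreconnected
    (z₀ := 2) (by simp) ?_
  have hU : {s : ℂ | 1 < s.re} ∈ nhds (2 : ℂ) :=
    (isOpen_lt continuous_const Complex.continuous_re).mem_nhds (by simp)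
  filter_upwards [hU] with s hs
  exact (h.1 s hs).unique (h'.1 s hs)

end HeckeCycle

end

theorem proposition8 {F : Type*} [Field F] [NumberField F] (hF : Module.finrank ℚ F = 2)
    (ι ι' : F →+* ℝ) (hι : ι ≠ ι') (O : Subring F) [Module.Finite ℤ O] [IsFractionRing O F]
    (k : ℕ) (hk : 2 ≤ k) (A : NarrowClassGroup O) :
    ∃ Z : ℂ → ℂ, IsPartialZeta O A⁻¹ Z ∧
      ∀ d : CycleData ι ι' O A,
        pairing (2 * (k - 1)) (Eis (2 * (k - 1)) (by omega)) (d.cycle hF hι k) =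
          (-1) ^ k * (Z (1 - k) / riemannZeta (1 - 2 * k)) := by
  -- One choice of data defines the continuation. Any other choice has a continuation of its own
  -- that computes its pairing, and the two agree at 1 - k because this point differs from 1.
  obtain ⟨d₀⟩ := nonempty_cycleData O hF hι A
  refine ⟨d₀.partialZeta, d₀.isPartialZeta hF hι, fun d => ?_⟩
  have hne : (1 - k : ℂ) ∈ ({1}ᶜ : Set ℂ) := by
    rw [Set.mem_compl_singleton_iff, Ne, sub_eq_self]
    exact_mod_cast (by omega : k ≠ 0)
  rw [d.pairing_eq hF hι hk, (d.isPartialZeta hF hι).eqOn (d₀.isPartialZeta hF hι) hne]
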